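/- Let $X$ be a primitive multiple curve of multiplicity $n\ge 1$ over $\mathbb{C}$: a separated scheme of finite type over $\mathbb{C}$ whose reduced subscheme $C$ is a smooth irreducible curve, and such that every closed point $P$ has a neighbourhood in $X$ which can be embedded in a smooth surface $S$ in such a way that the ideals of $C$ and of $X$ in $\mathcal{O}_{S,P}$ are $(z)$ and $(z^n)$ for some $z\in\mathcal{O}_{S,P}$. (The curve $C$ is not required to be projective.) Let $\mathcal{I}_C\subset\mathcal{O}_X$ be the ideal sheaf of $C$. A sheaf on $C$ is identified with its direct image on $X$. For a coherent sheaf $F$ on $C$, with torsion subsheaf $T$ and generic rank $r$, let $\det(F)$ be its determinant, that is the line bundle $\bigwedge^r(F/T)\otimes\mathcal{O}_C\bigl(\sum_{x}\operatorname{length}(T_x)\,x\bigr)$. For a coherent sheaf $\mathcal{E}$ on $X$ and $k\ge 0$ let $\mathcal{E}^{(k)}\subset\mathcal{E}$ be the subsheaf of sections annihilated by $\mathcal{I}_C^k$; then $0=\mathcal{E}^{(0)}\subset\mathcal{E}^{(1)}\subset\cdots\subset\mathcal{E}^{(n)}=\mathcal{E}$ is the second canonical filtration of $\mathcal{E}$,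 its graded pieces are sheaves on $C$, and one sets $$\det\nolimits_C(\mathcal{E})=\bigotimes_{k=1}^n\det\bigl(\mathcal{E}^{(k)}/\mathcal{E}^{(k-1)}\bigr).$$ (i) Let $\mathcal{E}$ be a coherent sheaf on $X$ and $0=\mathcal{F}_0\subset\mathcal{F}_1\subset\cdots\subset\mathcal{F}_m=\mathcal{E}$ a filtration of $\mathcal{E}$ by coherent subsheaves whose graded pieces $\mathcal{F}_j/\mathcal{F}_{j-1}$ are sheaves on $C$. Then $$\det\nolimits_C(\mathcal{E})\simeq\bigotimes_{j=1}^m\det(\mathcal{F}_j/\mathcal{F}_{j-1}).$$ (ii) Let $0\to\mathcal{E}'\to\mathcal{E}\to\mathcal{E}''\to 0$ be an exact sequence of coherent sheaves on $X$. Then $$\det\nolimits_C(\mathcal{E})\simeq\det\nolimits_C(\mathcal{E}')\otimes\det\nolimits_C(\mathcal{E}'').$$ -/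

import Mathlib

open CategoryTheory CategoryTheory.Limits AlgebraicGeometry TopologicalSpace

universe u

namespace MultipleCurve

noncomputable section

section Sheaves

/-- The stalk `F_x` of a sheaf of `𝒪_X`-modules. -/
abbrev StalkAt {X : Scheme.{u}} (F : X.Modules) (x : X) : Type u :=
  F.presheaf.stalk x

/-- The `𝒪_{X,x}`-module structure of `F_x`. -/
instance stalkModule {X : Scheme.{u}} (F : X.Modules) (x : X) :
    Module (X.presheaf.stalk x) (StalkAt F x) :=
  PresheafOfModules.instModuleCarrierStalkCommRingCatCarrierAbPresheafOpensCarrier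
    (R := X.presheaf) F.val x

theorem germ_smul_stalk {X : Scheme.{u}} (F : X.Modules) (x : X) (U : X.Opens) (hx : x ∈ U)
    (r : Γ(X, U)) (m : Γ(F, U)) :
    (F.presheaf.germ U x hx (r • m) : StalkAt F x) =
      (X.presheaf.germ U x hx r : X.presheaf.stalk x) • (F.presheaf.germ U x hx m : StalkAt F x) :=
  PresheafOfModules.germ_smul (R := X.presheaf) F.val x U hx r m

/-- The tensor product `M ⊗ N` of sheaves of `𝒪_X`-modules: the sheaf associated with the presheaf
`U ↦ M(U) ⊗ N(U)`. -/
def tensor {X : Scheme.{u}} (M N : X.Modules) : X.Modules :=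
  (PresheafOfModules.sheafification (𝟙 X.ringCatSheaf.obj)).obj
    (PresheafOfModules.Monoidal.tensorObj (R := X.presheaf) M.val N.val)

/-- The tensor product `L 0 ⊗ L 1 ⊗ ⋯ ⊗ L (m - 1)`; it is `𝒪_X` for `m = 0`. -/
def tensorProd {X : Scheme.{u}} (L : ℕ → X.Modules) : ℕ → X.Modules
  | 0 => SheafOfModules.unit X.ringCatSheaf
  | m + 1 => tensor (tensorProd L m) (L m)

/-- Coherent sheaves (used on noetherian schemes only): quasi-coherent and of finite type. -/
def IsCoherent {X : Scheme.{u}} (F : X.Modules) : Prop :=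
  SheafOfModules.IsQuasicoherent F ∧ SheafOfModules.IsFiniteType F

end Sheaves

section Det

/-!
The determinant of a coherent sheaf `F` on a smooth irreducible curve `C`. Let `T ⊆ F` be the
torsion subsheaf and `r` the rank of `F`. Then
`det F = ⋀ ^ r (F / T) ⊗ 𝒪_C (∑ x, length (T_x) • x)`,
the same line bundle as the one given by locally free resolutions. It is
constructed as a subsheaf of the constant sheaf `⋀ ^ r (F_η)`, where `η` is the generic point.
-/

variable {C : Scheme.{u}} [IsIntegral C] (F : C.Modules)

/-- The rank of `F`, i.e. the dimension of the generic stalk `F_η` over the function field. -/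
def genericRank : ℕ := Module.finrank C.functionField (StalkAt F (genericPoint C))

/-- The top exterior power of the generic stalk `F_η`, a line over the function field. -/
def TopWedge : Type u :=
  ⋀[C.functionField]^(genericRank F) (StalkAt F (genericPoint C))

instance : AddCommGroup (TopWedge F) :=
  inferInstanceAs (AddCommGroup (⋀[C.functionField]^(genericRank F) (StalkAt F (genericPoint C))))

/-- `𝒪_{C,x}` acts through its embedding in the function field. -/
instance (x : C) : Module (C.presheaf.stalk x) (TopWedge F) :=
  letI : Module C.functionField (TopWedge F) := inferInstanceAs (Module C.functionField
    (⋀[C.functionField]^(genericRank F) (StalkAt F (genericPoint C))))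
  Module.compHom _ (algebraMap (C.presheaf.stalk x) C.functionField)

instance : Module C.functionField (TopWedge F) :=
  inferInstanceAs (Module C.functionField
    (⋀[C.functionField]^(genericRank F) (StalkAt F (genericPoint C))))

/-- The map `F_x → F_η` to the generic stalk. -/
def toGeneric (x : C) : StalkAt F x → StalkAt F (genericPoint C) :=
  F.presheaf.stalkSpecializes ((genericPoint_spec C).specializes trivial)

/-- The image of `⋀ ^ r (F_x)` in `⋀ ^ r (F_η)`, which is the stalk at `x` of
`⋀ ^ r (F / T)`. -/
def wedgeLattice (x : C) : Submodule (C.presheaf.stalk x) (TopWedge F) :=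
  Submodule.span _ (Set.range fun s : Fin (genericRank F) → StalkAt F x =>
    (exteriorPower.ιMulti C.functionField (genericRank F) fun j => toGeneric F x (s j) :
      TopWedge F))

/-- The length of the torsion submodule of `F_x`. -/
def torsionLength (x : C) : ℕ :=
  (Module.length (C.presheaf.stalk x)
    (Submodule.torsion (C.presheaf.stalk x) (StalkAt F x))).toNat

/-- The stalk at `x` of `det F`: the elements `ω` of `⋀ ^ r (F_η)` such that `𝔪_x ^ ℓ • ω` lies in
`⋀ ^ r (F / T)_x`, where `ℓ = length (T_x)`. -/
def detLattice (x : C) : Submodule (C.presheaf.stalk x) (TopWedge F) where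
  carrier := {ω | ∀ a ∈ IsLocalRing.maximalIdeal (C.presheaf.stalk x) ^ torsionLength F x,
    a • ω ∈ wedgeLattice F x}
  add_mem' hv hw a ha := by rw [smul_add]; exact add_mem (hv a ha) (hw a ha)
  zero_mem' a _ := by rw [smul_zero]; exact zero_mem _
  smul_mem' c v hv a ha := by rw [smul_comm]; exact Submodule.smul_mem _ c (hv a ha)

/-- The sections of `det F` over `U` are the constant functions from `U` to `⋀ ^ r (F_η)` whose
value lies in the stalk of `det F` at every point of `U`. -/
def detPredicate : TopCat.LocalPredicate (fun _ : C => TopWedge F) where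
  pred {U} s := (∀ x y : U, s x = s y) ∧ ∀ x : U, s x ∈ detLattice F x
  res i _ h := ⟨fun _ _ => h.1 _ _, fun x => h.2 (i x)⟩
  locality {U} s h := by
    refine ⟨fun x y => ?_, fun x => ?_⟩
    · obtain ⟨V, hxV, i, hV, -⟩ := h x
      obtain ⟨W, hyW, j, hW, -⟩ := h y
      obtain ⟨z, -, hzV, hzW⟩ :=
        (IrreducibleSpace.isIrreducible_univ C).2 V W V.2 W.2 ⟨x, trivial, hxV⟩
          ⟨y, trivial, hyW⟩
      exact (hV ⟨x, hxV⟩ ⟨z, hzV⟩).trans (hW ⟨z, hzW⟩ ⟨y, hyW⟩)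
    · obtain ⟨V, hxV, i, -, hV⟩ := h x
      exact hV ⟨x, hxV⟩

/-- The group of sections of `det F` over `U`. -/
def detSections (U : C.Opens) : AddSubgroup (U → TopWedge F) where
  carrier := {s | (detPredicate F).pred s}
  add_mem' hs ht := ⟨fun x y => congrArg₂ (· + ·) (hs.1 x y) (ht.1 x y),
    fun x => add_mem (hs.2 x) (ht.2 x)⟩
  zero_mem' := ⟨fun _ _ => rfl, fun _ => zero_mem _⟩
  neg_mem' hs := ⟨fun x y => congrArg Neg.neg (hs.1 x y), fun x => neg_mem (hs.2 x)⟩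

theorem germ_smul_eq {U : C.Opens} (a : Γ(C, U)) (x y : U) (ω : TopWedge F) :
    C.presheaf.germ U x x.2 a • ω = C.presheaf.germ U y y.2 a • ω := by
  have : Nonempty U := ⟨x⟩
  change algebraMap (C.presheaf.stalk x.1) C.functionField _ • ω =
    algebraMap (C.presheaf.stalk y.1) C.functionField _ • ω
  rw [Scheme.algebraMap_germ_eq_germToFunctionField,
    Scheme.algebraMap_germ_eq_germToFunctionField]

instance (U : C.Opens) : Module Γ(C, U) (detSections F U) where
  smul a s := ⟨fun x => C.presheaf.germ U x x.2 a • s.1 x,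
    fun x y => by
      change _ • s.1 x = _ • s.1 y
      rw [s.2.1 x y]
      exact germ_smul_eq F a x y _,
    fun x => Submodule.smul_mem _ _ (s.2.2 x)⟩
  one_smul s := Subtype.ext <| funext fun x => by
    change C.presheaf.germ U x x.2 1 • s.1 x = s.1 x
    rw [map_one, one_smul]
  mul_smul a b s := Subtype.ext <| funext fun x => by
    change C.presheaf.germ U x x.2 (a * b) • s.1 x =
      C.presheaf.germ U x x.2 a • C.presheaf.germ U x x.2 b • s.1 x
    rw [map_mul, mul_smul]
  smul_zero a := Subtype.ext <| funext fun x => smul_zero (C.presheaf.germ U x x.2 a)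
  smul_add a s t := Subtype.ext <| funext fun x =>
    smul_add (C.presheaf.germ U x x.2 a) (s.1 x) (t.1 x)
  add_smul a b s := Subtype.ext <| funext fun x => by
    change C.presheaf.germ U x x.2 (a + b) • s.1 x =
      C.presheaf.germ U x x.2 a • s.1 x + C.presheaf.germ U x x.2 b • s.1 x
    rw [map_add, add_smul]
  zero_smul s := Subtype.ext <| funext fun x => by
    change C.presheaf.germ U x x.2 0 • s.1 x = 0
    rw [map_zero, zero_smul]

/-- `det F` as a presheaf of abelian groups. -/
def detPresheaf : TopCat.Presheaf Ab.{u} C where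
  obj U := AddCommGrpCat.of (detSections F U.unop)
  map i := AddCommGrpCat.ofHom
    { toFun := fun s => ⟨fun x => s.1 (i.unop x), (detPredicate F).res i.unop s.1 s.2⟩
      map_zero' := rfl
      map_add' := fun _ _ => rfl }

instance (U : (Opens C)ᵒᵖ) :
    Module (C.ringCatSheaf.obj.obj U) ((detPresheaf F).obj U) :=
  inferInstanceAs (Module Γ(C, U.unop) (detSections F U.unop))

/-- The determinant `det F` of a coherent sheaf `F` on a smooth irreducible curve. -/
def det : C.Modules where
  val := PresheafOfModules.ofPresheaf (R := C.ringCatSheaf.obj) (detPresheaf F)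
    fun U V i a s => Subtype.ext <| funext fun x => by
      change C.presheaf.germ U.unop (i.unop x) (i.unop x).2 a • s.1 (i.unop x) =
        C.presheaf.germ V.unop x x.2 (C.presheaf.map i a) • s.1 (i.unop x)
      congr 1
      exact (C.presheaf.germ_res_apply i.unop x.1 x.2 a).symm
  isSheaf := (TopCat.Presheaf.isSheaf_iff_isSheaf_comp (forget AddCommGrpCat)
      (detPresheaf F)).2 (TopCat.subpresheafToTypes.isSheaf (detPredicate F))

end Det

section Filtrations

/-!
`i : C ⟶ X` is the inclusion of the reduced curve `C` in the multiple curve `X`, and `I` is the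
ideal sheaf of `C` in `X`.
-/

variable {X C : Scheme.{u}} (i : C ⟶ X) (E : X.Modules)

/-- The sections of `E` over `U` whose germs at the points `i c` are annihilated by the `k`-th
power of the stalk of `I` (by `z ^ k`, if `z` generates this stalk). -/
def killedSections (k : ℕ) (U : X.Opens) : Submodule Γ(X, U) Γ(E, U) where
  carrier := {s | ∀ (c : C) (hc : i c ∈ U), ∀ a ∈ RingHom.ker (i.stalkMap c).hom ^ k,
    a • (E.presheaf.germ U (i c) hc s : StalkAt E (i c)) = 0}
  add_mem' hs ht c hc a ha := by
    rw [map_add, smul_add, hs c hc a ha, ht c hc a ha, add_zero]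
  zero_mem' c hc a _ := by rw [map_zero, smul_zero]
  smul_mem' r s hs c hc a ha := by
    rw [germ_smul_stalk, smul_comm, hs c hc a ha, smul_zero]

theorem killedSections_iff_res {k : ℕ} {U V : X.Opens} (f : V ⟶ U) (s : Γ(E, U)) :
    E.presheaf.map f.op s ∈ killedSections i E k V ↔
      ∀ (c : C) (hc : i c ∈ V), ∀ a ∈ RingHom.ker (i.stalkMap c).hom ^ k,
        a • (E.presheaf.germ U (i c) (f.le hc) s : StalkAt E (i c)) = 0 := by
  refine forall₄_congr fun c hc a ha => ?_
  rw [TopCat.Presheaf.germ_res_apply]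

/-- The sections annihilated by `I ^ k`, as a submodule of `E`. -/
def killedSubmodule (k : ℕ) : PresheafOfModules.Submodule (R := X.ringCatSheaf.obj) E.val where
  obj U := killedSections i E k U.unop
  map f s hs := (killedSections_iff_res i E f.unop s).2
    fun c hc a ha => hs c (f.unop.le hc) a ha

theorem killed_isSheaf (k : ℕ) : TopCat.Presheaf.IsSheaf (X := X.toTopCat) (C := Ab.{u})
    (killedSubmodule i E k).toPresheafOfModules.presheaf := by
  rw [TopCat.Presheaf.isSheaf_iff_isSheafUniqueGluing]
  intro ι U sf hsf
  obtain ⟨s, hs, huniq⟩ := TopCat.Presheaf.IsSheaf.isSheafUniqueGluing E.isSheaf U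
    (fun j => (sf j).1) fun j k => congrArg Subtype.val (hsf j k)
  refine ⟨⟨s, fun c hc a ha => ?_⟩, fun j => Subtype.ext (hs j), fun t ht => Subtype.ext
    (huniq t.1 fun j => congrArg Subtype.val (ht j))⟩
  obtain ⟨j, hj⟩ := Opens.mem_iSup.1 hc
  have h2 : E.presheaf.map (Opens.leSupr U j).op s ∈ killedSections i E k (U j) := by
    rw [show E.presheaf.map (Opens.leSupr U j).op s = (sf j).1 from hs j]
    exact (sf j).2
  exact (killedSections_iff_res i E _ s).1 h2 c hj a ha

/-- The subsheaf `E^(k)` of the sections of `E` annihilated by `I ^ k`. -/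
def killedSheaf (k : ℕ) : X.Modules where
  val := (killedSubmodule i E k).toPresheafOfModules
  isSheaf := killed_isSheaf i E k

/-- The inclusion of `E^(k)` in `E`. -/
def killedIncl (k : ℕ) : killedSheaf i E k ⟶ E := ⟨(killedSubmodule i E k).ι⟩

instance (k : ℕ) : Mono (killedIncl i E k) :=
  (Scheme.Modules.toPresheafOfModules X).mono_of_mono_map
    (inferInstanceAs (Mono (killedSubmodule i E k).ι))

theorem killedSubmodule_mono : Monotone (killedSubmodule i E) :=
  fun _ _ hkl _ _ hs c hc a ha => hs c hc a (Ideal.pow_le_pow_right hkl ha)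

/-- The second canonical filtration `E^(0) ⊆ E^(1) ⊆ E^(2) ⊆ ⋯` of `E`. -/
def secondFiltration : ℕ →o Subobject E where
  toFun k := Subobject.mk (killedIncl i E k)
  monotone' k l hkl := Subobject.mk_le_mk_of_comm
    (⟨PresheafOfModules.Submodule.homOfLE (killedSubmodule_mono i E hkl)⟩ :
      killedSheaf i E k ⟶ killedSheaf i E l) rfl

variable {E} in
/-- The graded piece `F (j + 1) / F j` of an increasing sequence of subsheaves of `E`. -/
def graded (F : ℕ →o Subobject E) (j : ℕ) : X.Modules :=
  cokernel ((F j).ofLE (F (j + 1)) (F.monotone j.le_succ))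

/-- `G` is a sheaf on `C`: it is the direct image of a sheaf of `𝒪_C`-modules. -/
def IsSheafOn (G : X.Modules) : Prop :=
  ∃ G' : C.Modules, Nonempty (G ≅ (Scheme.Modules.pushforward i).obj G')

variable {E} in
/-- The tensor product of the determinants of the first `m` graded pieces of `F`. A graded piece
that is a sheaf on `C` is considered as a sheaf of `𝒪_C`-modules by restricting it to `C`. -/
def detGraded [IsIntegral C] (F : ℕ →o Subobject E) (m : ℕ) : C.Modules :=
  tensorProd (fun j => det ((Scheme.Modules.pullback i).obj (graded F j))) m

/-- `det_C (E)`, the tensor product of the determinants of `E^(k) / E^(k-1)` for `1 ≤ k ≤ n`. -/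
def detC [IsIntegral C] (n : ℕ) : C.Modules := detGraded i (secondFiltration i E) n

end Filtrations

/-- `f : X ⟶ Spec ℂ` is a primitive multiple curve of multiplicity `n`, and `i : C ⟶ X` is the
inclusion of its reduced subscheme, which is a smooth irreducible curve. Every closed point of `C`
has a neighbourhood `U` in `X` that can be embedded in a smooth surface `S`, in such a way that the
ideals of `C` and of `X` in the local ring of `S` at this point are `(z)` and `(z ^ n)`. -/
structure IsPrimitiveMultipleCurve {X C : Scheme.{0}} [IsIntegral C]
    (f : X ⟶ Spec (.of ℂ)) (i : C ⟶ X) (n : ℕ) : Prop where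
  separated : IsSeparated f
  locallyOfFiniteType : LocallyOfFiniteType f
  quasiCompact : QuasiCompact f
  closedImmersion : IsClosedImmersion i
  surjective : Surjective i
  smooth : SmoothOfRelativeDimension 1 (i ≫ f)
  one_le : 1 ≤ n
  local_structure : ∀ c : C, IsClosed {c} →
    ∃ (U : X.Opens) (hc : i c ∈ U) (S : Scheme.{0}) (g : S ⟶ Spec (.of ℂ)) (j : U.toScheme ⟶ S),
      SmoothOfRelativeDimension 2 g ∧ IsImmersion j ∧ j ≫ g = U.ι ≫ f ∧
      ∃ z : S.presheaf.stalk (j ((i ∣_ U) ⟨c, hc⟩)),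
        RingHom.ker (j.stalkMap ((i ∣_ U) ⟨c, hc⟩) ≫ (i ∣_ U).stalkMap ⟨c, hc⟩).hom =
          Ideal.span {z} ∧
        RingHom.ker (j.stalkMap ((i ∣_ U) ⟨c, hc⟩)).hom = Ideal.span {z ^ n}

end

end MultipleCurve

set_option linter.unusedSectionVars false

/-! The local rings of C are principal ideal domains with common fraction field K, the function
field. A basis of the generic stalk of a coherent sheaf F on C identifies det F with a subsheaf of
the constant sheaf K, that is, with a family of invertible fractional ideals indexed by the points
of C (`nonempty_det_iso`). Another basis multiplies the whole family by one rational function, so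
det F is recorded by its class in `IdealClass`, and families with equal classes give isomorphic
sheaves (`nonempty_idealSheaf_iso`). For locally principal families, tensor products of sheaves
correspond to products of ideals (`nonempty_tensor_latticeSheaf_iso`).

The arithmetic rests on `detIdeal_mul_pow`: if elements n_i of a stalk N map to nonzero multiples
c_i b_i of a basis of the generic stalk and span L, then the determinant ideal times the power of
the maximal ideal with exponent length(N / L) is generated by the product of the c_i. Torsion is
thereby built into a length, and additivity of length gives multiplicativity in short exact
sequences (`detIdeal_mul_of_exact`).

Filtrations are compared in the modular lattice of families of submodules of the stalks of E. A pair
P ≤ Q whose quotient is annihilated by the ideal of C has a determinant class `quotCls`, which is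
multiplicative and respects the second isomorphism theorem (`quotientInvariant`). Schreier's
refinement argument then shows that the product of the classes over the steps is the same for all
filtrations (`QuotientInvariant.prod_eq_prod`). This gives (i), since the second canonical
filtration reaches E because the n-th power of the ideal vanishes. For (ii), the image of the
filtration of the subsheaf followed by the preimage of the filtration of the quotient is a
filtration of the middle term (`IsShortExact.prod_eq_mul`).

The geometric input is that stalks of coherent sheaves are finitely generated with the generic stalk
as localization, that direct image under a closed immersion is fully faithful, so that restricting a
graded piece to C loses nothing (`nonempty_pullback_iso`), and that determinant families are trivial
near the generic point, hence locally principal on a noetherian curve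
(`isLocallyPrincipal_of_open`). The members of the canonical filtration need not be shown coherent:
finite local generation and compatibility with localization suffice. -/

namespace MultipleCurve

/-! ### Determinant ideals of finite modules over a local principal ideal domain -/

section LocalAlgebra

open Module IsLocalRing

variable {O K : Type*} [CommRing O] [IsDomain O] [IsPrincipalIdealRing O] [IsLocalRing O]
  [Field K] [Algebra O K] [IsFractionRing O K]

/-- A cyclic torsion module is a quotient of O / (a) with a ≠ 0, which has finite length; finite
sums of Artinian submodules are Artinian. -/
theorem isArtinian_of_isTorsion {M : Type*} [AddCommGroup M] [Module O M] [Module.Finite O M]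
    (h : ∀ m : M, ∃ a : O, a ≠ 0 ∧ a • m = 0) : IsArtinian O M := by
  suffices H : ∀ N : Submodule O M, N.FG → IsArtinian O N by
    have := H ⊤ Module.Finite.fg_top
    exact isArtinian_of_linearEquiv (Submodule.topEquiv (R := O) (M := M))
  intro N hN
  induction N, hN using Submodule.fg_induction with
  | singleton x =>
    obtain ⟨a, ha, hax⟩ := h x
    have hfin : IsArtinian O (O ⧸ Ideal.span {a}) :=
      (isFiniteLength_iff_isNoetherian_isArtinian.1
        (isFiniteLength_quotient_span_singleton O (mem_nonZeroDivisors_of_ne_zero ha))).2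
    let g : O →ₗ[O] (Submodule.span O {x}) :=
      LinearMap.toSpanSingleton O _ ⟨x, Submodule.mem_span_singleton_self x⟩
    have hg : Ideal.span {a} ≤ LinearMap.ker g := by
      rw [Ideal.span_le]
      rintro _ rfl
      exact Subtype.ext hax
    refine isArtinian_of_surjective _ (Submodule.liftQ _ g hg) ?_
    rintro ⟨y, hy⟩
    obtain ⟨r, rfl⟩ := Submodule.mem_span_singleton.1 hy
    exact ⟨Submodule.Quotient.mk r, Subtype.ext rfl⟩
  | sup N₁ N₂ h₁ h₂ i₁ i₂ => exact isArtinian_sup N₁ N₂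

theorem length_ne_top_of_isTorsion {M : Type*} [AddCommGroup M] [Module O M] [Module.Finite O M]
    (h : ∀ m : M, ∃ a : O, a ≠ 0 ∧ a • m = 0) : Module.length O M ≠ ⊤ := by
  have := isArtinian_of_isTorsion h
  exact Module.length_ne_top

/-- This is the degenerate case of the generic point, where the local ring is the function field
itself and is not a discrete valuation ring. -/
theorem subsingleton_of_isField (hO : IsField O) {M : Type*} [AddCommGroup M] [Module O M]
    (h : ∀ m : M, ∃ a : O, a ≠ 0 ∧ a • m = 0) : Subsingleton M := by
  refine subsingleton_of_forall_eq 0 fun m => ?_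
  obtain ⟨a, ha, ham⟩ := h m
  obtain ⟨b, hb⟩ := hO.mul_inv_cancel ha
  rw [← one_smul O m, ← hb, mul_comm, mul_smul, ham, smul_zero]

/-- A power of a uniformizer works over a discrete valuation ring. Over a field the maximal ideal is
zero, but then M is zero too and the exponent is 0. With a single generator, the condition defining
`detIdeal` becomes a condition on one scalar. -/
theorem exists_maximalIdeal_pow_eq_span {M : Type*} [AddCommGroup M] [Module O M]
    (h : ∀ m : M, ∃ a : O, a ≠ 0 ∧ a • m = 0) :
    ∃ a : O, a ≠ 0 ∧ maximalIdeal O ^ (Module.length O M).toNat = Ideal.span {a} := by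
  by_cases hO : IsField O
  · have := subsingleton_of_isField hO h
    exact ⟨1, one_ne_zero, by simp⟩
  · have : IsDiscreteValuationRing O := { not_a_field' := fun h => hO (isField_iff_maximalIdeal_eq.2 h) }
    obtain ⟨p, hp⟩ := IsDiscreteValuationRing.exists_irreducible O
    refine ⟨p ^ (Module.length O M).toNat, pow_ne_zero _ hp.ne_zero, ?_⟩
    rw [hp.maximalIdeal_eq, Ideal.span_singleton_pow]

theorem maximalIdeal_pow_ord {a : O} (ha : a ≠ 0) :
    maximalIdeal O ^ (Ring.ord O a).toNat = Ideal.span {a} := by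
  by_cases hO : IsField O
  · have hu : IsUnit a := by
      obtain ⟨b, hb⟩ := hO.mul_inv_cancel ha
      exact IsUnit.of_mul_eq_one b hb
    rw [Ring.ord_of_isUnit hu, Ideal.span_singleton_eq_top.2 hu]
    simp
  · have : IsDiscreteValuationRing O := { not_a_field' := fun h => hO (isField_iff_maximalIdeal_eq.2 h) }
    obtain ⟨p, hp⟩ := IsDiscreteValuationRing.exists_irreducible O
    obtain ⟨n, hn⟩ := IsDiscreteValuationRing.associated_pow_irreducible ha hp
    rw [Ring.ord_eq_of_associated hn, Ring.ord_pow (mem_nonZeroDivisors_of_ne_zero hp.ne_zero),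
      Ring.ord_of_irreducible hp, Ideal.span_singleton_eq_span_singleton.2 hn,
      hp.maximalIdeal_eq, Ideal.span_singleton_pow]
    simp

variable {N W : Type*} [AddCommGroup N] [Module O N] [AddCommGroup W] [Module K W]
  (φ : N →ₛₗ[algebraMap O K] W) {ι : Type*} [Fintype ι] [DecidableEq ι] (b : Basis ι K W)

/-- `φ : N → W` identifies `W` with the localization `N ⊗ K` of the finite module `N`. -/
structure IsLattice : Prop where
  finite : Module.Finite O N
  exists_smul_eq_zero : ∀ n, φ n = 0 → ∃ a : O, a ≠ 0 ∧ a • n = 0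
  exists_smul_mem_range : ∀ w, ∃ a : O, a ≠ 0 ∧ ∃ n, φ n = algebraMap O K a • w

/-- The image of `⋀ ^ r N` in `⋀ ^ r W ≃ K`. -/
def wedgeCoord : Submodule O K :=
  Submodule.span O (Set.range fun s : ι → N => b.det fun i => φ (s i))

/-- The elements `a` of `K` for which `𝔪 ^ ℓ • a` is contained in `wedgeCoord φ b`, where `ℓ` is the
length of the torsion of `N`. -/
def detIdeal : Submodule O K where
  carrier := {x | ∀ a ∈ maximalIdeal O ^ (Module.length O (Submodule.torsion O N)).toNat,
    a • x ∈ wedgeCoord φ b}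
  add_mem' hv hw a ha := by rw [smul_add]; exact add_mem (hv a ha) (hw a ha)
  zero_mem' a _ := by rw [smul_zero]; exact zero_mem _
  smul_mem' c v hv a ha := by rw [smul_comm]; exact Submodule.smul_mem _ c (hv a ha)

theorem exists_smul_eq_zero_of_mem_torsion {n : N} (hn : n ∈ Submodule.torsion O N) :
    ∃ a : O, a ≠ 0 ∧ a • n = 0 := by
  obtain ⟨⟨a, ha⟩, h⟩ := (Submodule.mem_torsion_iff n).1 hn
  exact ⟨a, nonZeroDivisors.ne_zero ha, h⟩

theorem map_eq_zero_of_smul_eq_zero {a : O} (ha : a ≠ 0) {n : N} (h : a • n = 0) : φ n = 0 := by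
  have h1 : algebraMap O K a • φ n = 0 := by rw [← LinearMap.map_smulₛₗ, h, map_zero]
  exact (smul_eq_zero.1 h1).resolve_left
    fun h0 => ha ((FaithfulSMul.algebraMap_injective O K) (by rw [h0, map_zero]))

variable {φ} in
-- Linear independence passes from O to K by clearing denominators, and every vector of W is a
-- fraction of some φ n.
theorem exists_basis_of_isLattice (h : IsLattice φ) (hφ : Function.Injective φ) {κ : Type*}
    [Finite κ] (f : Basis κ O N) : ∃ e : Basis κ K W, ∀ i, e i = φ (f i) := by
  let _ : Module O W := Module.compHom W (algebraMap O K)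
  have : IsScalarTower O K W := IsScalarTower.of_compHom O K W
  let φ' : N →ₗ[O] W := { toFun := φ, map_add' := map_add φ, map_smul' := fun a n => map_smulₛₗ φ a n }
  have hli : LinearIndependent K (fun i => φ (f i)) :=
    (LinearIndependent.iff_fractionRing O K).1
      (f.linearIndependent.map' φ' (LinearMap.ker_eq_bot.2 hφ))
  refine ⟨Basis.mk hli fun w _ => ?_, fun i => by simp⟩
  obtain ⟨a, ha, n, hn⟩ := h.exists_smul_mem_range w
  have ha' : algebraMap O K a ≠ 0 := by
    simpa using ha
  have hw : w = (algebraMap O K a)⁻¹ • φ n := by rw [hn, smul_smul, inv_mul_cancel₀ ha', one_smul]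
  rw [hw]
  refine Submodule.smul_mem _ _ ?_
  have := Fintype.ofFinite κ
  rw [← f.sum_repr n, map_sum]
  refine Submodule.sum_mem _ fun i _ => ?_
  rw [map_smulₛₗ]
  exact Submodule.smul_mem _ _ (Submodule.subset_span ⟨i, rfl⟩)

/-- Relative to a basis f of N, each generator is `b.det e` times the determinant of a matrix with
entries in O, and that matrix determinant is 1 for f itself. -/
theorem wedgeCoord_eq_of_basis {e : Basis ι K W} (f : Basis ι O N) (he : ∀ i, e i = φ (f i)) :
    wedgeCoord φ b = Submodule.span O {b.det e} := by
  refine le_antisymm (Submodule.span_le.2 ?_) (Submodule.span_le.2 ?_)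
  · rintro _ ⟨s, rfl⟩
    have h1 : b.det = b.det e • e.det := AlternatingMap.eq_smul_basis_det e b.det
    have h2 : e.det (fun i => φ (s i)) = algebraMap O K (f.det s) := by
      rw [Basis.det_apply, Basis.det_apply, RingHom.map_det]
      congr 1
      ext i j
      simp only [Basis.toMatrix_apply, RingHom.mapMatrix_apply, Matrix.map_apply]
      conv_lhs => rw [← f.sum_repr (s j), map_sum]
      simp only [map_smulₛₗ, ← he, map_sum, Finset.sum_apply', RingHom.id_apply]
      simp [Finsupp.single_apply, Algebra.smul_def]
    change b.det (fun i => φ (s i)) ∈ _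
    rw [show b.det (fun i => φ (s i)) = b.det e • e.det (fun i => φ (s i)) from
      congrArg (fun D => D fun i => φ (s i)) h1, h2, smul_eq_mul, mul_comm, ← Algebra.smul_def]
    exact Submodule.smul_mem _ _ (Submodule.mem_span_singleton_self _)
  · rintro _ rfl
    refine Submodule.subset_span ⟨f, ?_⟩
    simp only [← he]

/-- This allows N to be replaced by its quotient by torsion. -/
theorem wedgeCoord_eq_of_range_eq {N' : Type*} [AddCommGroup N'] [Module O N']
    (ψ : N' →ₛₗ[algebraMap O K] W) (h : Set.range φ = Set.range ψ) :
    wedgeCoord φ b = wedgeCoord ψ b := by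
  unfold wedgeCoord
  congr 1
  ext x
  constructor
  · rintro ⟨s, rfl⟩
    have : ∀ i, ∃ n, ψ n = φ (s i) := fun i => h.subset ⟨s i, rfl⟩
    choose t ht using this
    exact ⟨t, by simp only [ht]⟩
  · rintro ⟨s, rfl⟩
    have : ∀ i, ∃ n, φ n = ψ (s i) := fun i => h.symm.subset ⟨s i, rfl⟩
    choose t ht using this
    exact ⟨t, by simp only [ht]⟩

variable {φ} in
-- The torsion-free case of `detIdeal_mul_pow`. Here N is free, and by Smith normal form L has a
-- basis a_i f_i for some basis f of N. Then N / L is the product of the O / (a_i), so its length is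
-- the exponent for which the power of the maximal ideal is generated by the product of the a_i, and
-- this product is also the index between the top exterior powers of L and N.
theorem wedgeCoord_mul_of_injective (h : IsLattice φ) (hφ : Function.Injective φ) (n : ι → N)
    (c : ι → K) (hc : ∀ i, c i ≠ 0) (hn : ∀ i, φ (n i) = c i • b i) :
    Module.length O (N ⧸ Submodule.span O (Set.range n)) ≠ ⊤ ∧
      wedgeCoord φ b * IsLocalization.coeSubmodule K (maximalIdeal O ^
        (Module.length O (N ⧸ Submodule.span O (Set.range n))).toNat) =
      Submodule.span O {∏ i, c i} := by
  let _ : Module O W := Module.compHom W (algebraMap O K)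
  have : IsScalarTower O K W := IsScalarTower.of_compHom O K W
  let φ' : N →ₗ[O] W := { toFun := φ, map_add' := map_add φ, map_smul' := fun a n => map_smulₛₗ φ a n }
  have hfin := h.finite
  have hfree : Module.Free O N := by
    have : IsTorsionFree O N := by
      refine ⟨fun {a} ha x y hxy => hφ ?_⟩
      have ha0 : a ≠ 0 := ha.ne_zero
      have := map_eq_zero_of_smul_eq_zero φ ha0 (n := x - y)
        (by rw [smul_sub]; exact sub_eq_zero.2 hxy)
      rwa [map_sub, sub_eq_zero] at this
    exact Module.free_of_finite_type_torsion_free'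
  obtain ⟨e₀, -⟩ := exists_basis_of_isLattice h hφ (Module.Free.chooseBasis O N)
  let f₀ : Basis ι O N := (Module.Free.chooseBasis O N).reindex (e₀.indexEquiv b)
  have hli : LinearIndependent O n := by
    have hK : LinearIndependent K fun i => φ (n i) := by
      simp only [hn]
      exact b.linearIndependent.units_smul (fun i => Units.mk0 (c i) (hc i))
    exact LinearIndependent.of_comp φ' ((LinearIndependent.iff_fractionRing O K).2 hK)
  set L := Submodule.span O (Set.range n) with hL
  let g : Basis ι O L := Basis.span hli
  have hg : ∀ i, (g i : N) = n i := fun i => congrArg Subtype.val (Basis.span_apply hli i)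
  obtain ⟨f, a, ab, hab⟩ := Submodule.exists_smith_normal_form_of_rank_eq (N := L) f₀
    (by rw [Module.finrank_eq_card_basis g, Module.finrank_eq_card_basis f₀])
  obtain ⟨e, he⟩ := exists_basis_of_isLattice h hφ f
  have ha : ∀ i, a i ≠ 0 := fun i h0 => ab.ne_zero i (Subtype.ext (by rw [hab, h0, zero_smul]; rfl))
  let φL : L →ₛₗ[algebraMap O K] W := φ.comp L.subtype
  let u : ι → Kˣ := fun i => Units.mk0 (c i) (hc i)
  let v : ι → Kˣ := fun i => Units.mk0 (algebraMap O K (a i)) (by simpa using ha i)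
  -- The top exterior power of L is computed twice: from the basis n here, and from the Smith basis
  -- in `h2`. Comparing the two gives the formula.
  have h1 : wedgeCoord φL b = Submodule.span O {∏ i, c i} := by
    rw [wedgeCoord_eq_of_basis φL b (e := b.unitsSMul u) g fun i => by
      rw [Basis.unitsSMul_apply]; exact ((congrArg φ (hg i)).trans (hn i)).symm]
    congr 2
    rw [Basis.det_unitsSMul_self]
    simp [u]
  have h2 : wedgeCoord φL b = Submodule.span O {algebraMap O K (∏ i, a i) * b.det e} := by
    rw [wedgeCoord_eq_of_basis φL b (e := e.unitsSMul v) ab fun i => by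
      rw [Basis.unitsSMul_apply, he]
      change _ = φ (ab i : N)
      rw [hab, map_smulₛₗ]; rfl]
    congr 2
    have : b.det = b.det e • e.det := AlternatingMap.eq_smul_basis_det e b.det
    rw [show b.det (e.unitsSMul v) = b.det e • e.det (e.unitsSMul v) from
      congrArg (fun D => D (e.unitsSMul v)) this, Basis.det_unitsSMul_self]
    simp [v, mul_comm]
  have h3 : Module.length O (N ⧸ L) = ∑ i, Ring.ord O (a i) := by
    have hL' : L = (Submodule.pi Set.univ fun i => Ideal.span {a i}).comap
        (f.equivFun : N →ₗ[O] ι → O) := by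
      ext x
      rw [Submodule.mem_comap, Submodule.mem_pi]
      constructor
      · intro hx i _
        rw [show x = ((⟨x, hx⟩ : L) : N) from rfl, ← ab.sum_repr ⟨x, hx⟩]
        simp only [Submodule.coe_sum, Submodule.coe_smul, hab]
        rw [Ideal.mem_span_singleton]
        simp [Finsupp.single_apply]
      · intro hx
        rw [← f.sum_repr x]
        refine Submodule.sum_mem _ fun i _ => ?_
        obtain ⟨d, hd⟩ := Ideal.mem_span_singleton.1 (hx i trivial)
        have : f.repr x i = d * a i := by rw [mul_comm]; exact hd
        rw [this, mul_smul, ← hab]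
        exact Submodule.smul_mem _ _ (ab i).2
    have e1 : (N ⧸ L) ≃ₗ[O] ∀ i, O ⧸ Ideal.span {a i} :=
      (Submodule.Quotient.equiv L (Submodule.pi Set.univ fun i => Ideal.span {a i}) f.equivFun
        (by
          rw [hL', Submodule.map_comap_eq_of_surjective]
          exact f.equivFun.surjective)).trans (Submodule.quotientPi _)
    rw [e1.length_eq, Module.length_pi_of_fintype]
    rfl
  have h4 : ∀ i, Ring.ord O (a i) ≠ ⊤ := fun i =>
    Ring.ord_ne_top (mem_nonZeroDivisors_of_ne_zero (ha i))
  refine ⟨by rw [h3]; simp [h4], ?_⟩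
  have h5 : maximalIdeal O ^ (∑ i, Ring.ord O (a i)).toNat = Ideal.span {∏ i, a i} := by
    rw [ENat.toNat_sum (fun i _ => h4 i), ← Finset.prod_pow_eq_pow_sum, ← Ideal.prod_span_singleton]
    exact Finset.prod_congr rfl fun i _ => maximalIdeal_pow_ord (ha i)
  rw [h3, h5, IsLocalization.coeSubmodule_span_singleton, wedgeCoord_eq_of_basis φ b f he,
    ← h1, h2, Submodule.span_mul_span, Set.singleton_mul_singleton, mul_comm]

variable {φ} in
-- The sublattice L meets the torsion T trivially, so N / L is an extension of the quotient of N / T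
-- by the image of L by T. Its length is therefore the torsion-free length plus length(T), and the
-- second summand is exactly the twist in the definition of `detIdeal`.
theorem detIdeal_mul_pow (h : IsLattice φ) (n : ι → N) (c : ι → K) (hc : ∀ i, c i ≠ 0)
    (hn : ∀ i, φ (n i) = c i • b i) :
    Module.length O (N ⧸ Submodule.span O (Set.range n)) ≠ ⊤ ∧
      detIdeal φ b * IsLocalization.coeSubmodule K (maximalIdeal O ^
        (Module.length O (N ⧸ Submodule.span O (Set.range n))).toNat) =
      Submodule.span O {∏ i, c i} := by
  have hfin := h.finite
  set T := Submodule.torsion O N with hT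
  have hTφ : ∀ t ∈ T, φ t = 0 := fun t ht => by
    obtain ⟨a, ha, hat⟩ := exists_smul_eq_zero_of_mem_torsion ht
    exact map_eq_zero_of_smul_eq_zero φ ha hat
  let ψ : (N ⧸ T) →ₛₗ[algebraMap O K] W := T.liftQ φ hTφ
  have hψ : Function.Injective ψ := by
    rw [injective_iff_map_eq_zero]
    intro x
    obtain ⟨x, rfl⟩ := T.mkQ_surjective x
    intro hx
    obtain ⟨a, ha, hax⟩ := h.exists_smul_eq_zero x hx
    exact (Submodule.Quotient.mk_eq_zero T).2 ((Submodule.mem_torsion_iff x).2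
      ⟨⟨a, mem_nonZeroDivisors_of_ne_zero ha⟩, hax⟩)
  have hψL : IsLattice ψ :=
    { finite := inferInstance
      exists_smul_eq_zero := fun x hx => ⟨1, one_ne_zero, by
        rw [one_smul]; exact hψ (by rw [hx, map_zero])⟩
      exists_smul_mem_range := fun w => by
        obtain ⟨a, ha, x, hx⟩ := h.exists_smul_mem_range w
        exact ⟨a, ha, T.mkQ x, hx⟩ }
  have hwedge : wedgeCoord φ b = wedgeCoord ψ b := by
    refine wedgeCoord_eq_of_range_eq φ b ψ ?_
    ext x
    constructor
    · rintro ⟨y, rfl⟩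
      exact ⟨T.mkQ y, rfl⟩
    · rintro ⟨y, rfl⟩
      obtain ⟨y, rfl⟩ := T.mkQ_surjective y
      exact ⟨y, rfl⟩
  set L := Submodule.span O (Set.range n) with hL
  obtain ⟨hlen, hmul⟩ := wedgeCoord_mul_of_injective b hψL hψ (fun i => T.mkQ (n i)) c hc hn
  have hLmap : Submodule.span O (Set.range fun i => T.mkQ (n i)) = L.map T.mkQ := by
    rw [hL, Submodule.map_span, ← Set.range_comp]
    rfl
  -- φ kills T, but is injective on L, because the vectors c_i b_i are linearly independent.
  have hLT : ∀ x ∈ L, x ∈ T → x = 0 := by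
    intro x hx hxT
    obtain ⟨a, rfl⟩ := (Submodule.mem_span_range_iff_exists_fun O).1 hx
    have h0 := hTφ _ hxT
    simp only [map_sum, map_smulₛₗ, hn, smul_smul] at h0
    have h1 := Fintype.linearIndependent_iff.1 b.linearIndependent _ h0
    refine Finset.sum_eq_zero fun i _ => ?_
    have := (mul_eq_zero.1 (h1 i)).resolve_right (hc i)
    rw [show a i = 0 by simpa using this, zero_smul]
  have hle : L ≤ (Submodule.span O (Set.range fun i => T.mkQ (n i))).comap T.mkQ := by
    rw [hLmap]
    exact Submodule.le_comap_map _ _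
  have hadd := Module.length_eq_add_of_exact (L.mkQ.comp T.subtype)
    (L.mapQ (Submodule.span O (Set.range fun i => T.mkQ (n i))) T.mkQ hle)
    (by
      rw [injective_iff_map_eq_zero]
      intro t ht
      exact Subtype.ext (hLT t.1 ((Submodule.Quotient.mk_eq_zero L).1 ht) t.2))
    (by
      intro x
      obtain ⟨x, rfl⟩ := Submodule.mkQ_surjective _ x
      obtain ⟨x, rfl⟩ := Submodule.mkQ_surjective _ x
      exact ⟨L.mkQ x, rfl⟩)
    (by
      intro x
      obtain ⟨x, rfl⟩ := Submodule.mkQ_surjective _ x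
      constructor
      · intro hx
        have hx' : T.mkQ x ∈ Submodule.span O (Set.range fun i => T.mkQ (n i)) :=
          (Submodule.Quotient.mk_eq_zero _).1 hx
        rw [hLmap] at hx'
        obtain ⟨l, hl, hlx⟩ := hx'
        have hxl : x - l ∈ T := (Submodule.Quotient.eq T).1 hlx.symm
        refine ⟨⟨x - l, hxl⟩, ?_⟩
        exact (Submodule.Quotient.eq L).2 (by simpa using hl)
      · rintro ⟨t, ht⟩
        rw [← ht]
        refine (Submodule.Quotient.mk_eq_zero _).2 ?_
        rw [show T.mkQ ((T.subtype) t) = 0 from (Submodule.Quotient.mk_eq_zero T).2 t.2]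
        exact zero_mem _)
  have hTtor : ∀ t : T, ∃ a : O, a ≠ 0 ∧ a • t = 0 := fun t => by
    obtain ⟨a, ha, hat⟩ := exists_smul_eq_zero_of_mem_torsion t.2
    exact ⟨a, ha, Subtype.ext hat⟩
  have hTlen := length_ne_top_of_isTorsion hTtor
  refine ⟨by rw [hadd]; exact WithTop.add_ne_top.2 ⟨hTlen, hlen⟩, ?_⟩
  rw [hadd, ENat.toNat_add hTlen hlen, pow_add, IsLocalization.coeSubmodule_mul, ← mul_assoc,
    ← hmul, ← hwedge]
  congr 1
  -- With a generator a of the relevant power of the maximal ideal, `detIdeal` is `wedgeCoord`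
  -- divided by a.
  obtain ⟨a, ha, haT⟩ := exists_maximalIdeal_pow_eq_span hTtor
  have ha' : algebraMap O K a ≠ 0 := by simpa using ha
  rw [haT, IsLocalization.coeSubmodule_span_singleton, mul_comm]
  ext x
  rw [Submodule.mem_span_singleton_mul]
  constructor
  · rintro ⟨z, hz, rfl⟩
    rw [← Algebra.smul_def]
    exact hz a (by rw [← hT, haT]; exact Ideal.mem_span_singleton_self a)
  · intro hx
    refine ⟨(algebraMap O K a)⁻¹ * x, fun t ht => ?_, by rw [mul_inv_cancel_left₀ ha']⟩
    rw [← hT, haT] at ht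
    obtain ⟨r, rfl⟩ := Ideal.mem_span_singleton.1 ht
    rw [mul_comm a r, mul_smul, Algebra.smul_def a, mul_inv_cancel_left₀ ha']
    exact Submodule.smul_mem _ _ hx

end LocalAlgebra

/-! ### Change of basis and multiplicativity of determinant ideals -/

section LocalAlgebraExact

open Module IsLocalRing

variable {O K : Type*} [CommRing O] [IsDomain O] [IsPrincipalIdealRing O] [IsLocalRing O]
  [Field K] [Algebra O K] [IsFractionRing O K]

theorem isUnit_span_singleton {x : K} (hx : x ≠ 0) : IsUnit (Submodule.span O {x}) := by
  refine IsUnit.of_mul_eq_one (Submodule.span O {x⁻¹}) ?_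
  rw [Submodule.span_mul_span, Set.singleton_mul_singleton, mul_inv_cancel₀ hx,
    Submodule.one_eq_span]

variable {N W : Type*} [AddCommGroup N] [Module O N] [AddCommGroup W] [Module K W]
  {φ : N →ₛₗ[algebraMap O K] W} {ι : Type*} [Fintype ι] [DecidableEq ι] (b : Basis ι K W)

theorem IsLattice.exists_smul_basis (h : IsLattice φ) :
    ∃ (n : ι → N) (c : ι → K), (∀ i, c i ≠ 0) ∧ ∀ i, φ (n i) = c i • b i := by
  choose a ha n hn using fun i => h.exists_smul_mem_range (b i)
  exact ⟨n, fun i => algebraMap O K (a i), fun i => by simpa using ha i, hn⟩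

/-- By `detIdeal_mul_pow` the ideal is a factor of a nonzero principal fractional ideal. -/
theorem isUnit_detIdeal (h : IsLattice φ) : IsUnit (detIdeal φ b) := by
  obtain ⟨n, c, hc, hn⟩ := h.exists_smul_basis b
  refine isUnit_of_mul_isUnit_left (y := IsLocalization.coeSubmodule K (maximalIdeal O ^
    (Module.length O (N ⧸ Submodule.span O (Set.range n))).toNat)) ?_
  rw [(detIdeal_mul_pow b h n c hc hn).2]
  exact isUnit_span_singleton (Finset.prod_ne_zero_iff.2 fun i _ => hc i)

/-- The scalar depends only on the two bases of W, not on φ or O. At all points of a curve it is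
therefore the same rational function. -/
theorem detIdeal_basis_change (φ : N →ₛₗ[algebraMap O K] W) {ι' : Type*} [Fintype ι']
    [DecidableEq ι'] (b' : Basis ι' K W) :
    detIdeal φ b' =
      Submodule.span O {b'.det (b.reindex (b.indexEquiv b'))} * detIdeal φ b := by
  set e := b.indexEquiv b'
  set d := b'.det (b.reindex e) with hd
  have hd0 : d ≠ 0 := by
    have := (Basis.isUnit_det b' (b.reindex e))
    exact this.ne_zero
  have hdet : ∀ v : ι' → W, b'.det v = d * b.det (v ∘ e) := fun v => by
    have h1 : b'.det = d • (b.reindex e).det := AlternatingMap.eq_smul_basis_det _ _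
    rw [show b'.det v = d • (b.reindex e).det v from congrArg (fun D => D v) h1,
      Basis.det_reindex, smul_eq_mul]
  have hw : wedgeCoord φ b' = Submodule.span O {d} * wedgeCoord φ b := by
    unfold wedgeCoord
    rw [Submodule.span_mul_span]
    congr 1
    ext x
    rw [Set.singleton_mul]
    constructor
    · rintro ⟨s, rfl⟩
      exact ⟨_, ⟨s ∘ e, rfl⟩, (hdet fun i => φ (s i)).symm⟩
    · rintro ⟨_, ⟨s, rfl⟩, rfl⟩
      refine ⟨s ∘ e.symm, ?_⟩
      simp only [hdet]
      congr 2
      ext i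
      simp
  ext x
  rw [Submodule.mem_span_singleton_mul]
  constructor
  · intro hx
    refine ⟨d⁻¹ * x, fun t ht => ?_, mul_inv_cancel_left₀ hd0 x⟩
    have := hx t ht
    rw [hw, Submodule.mem_span_singleton_mul] at this
    obtain ⟨z, hz, hzx⟩ := this
    rw [← mul_smul_comm, ← hzx, inv_mul_cancel_left₀ hd0]
    exact hz
  · rintro ⟨z, hz, rfl⟩ t ht
    rw [hw, ← mul_smul_comm]
    exact Submodule.mul_mem_mul (Submodule.mem_span_singleton_self d) (hz t ht)

theorem detIdeal_congr {N' W' : Type*} [AddCommGroup N'] [Module O N'] [AddCommGroup W']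
    [Module K W'] (φ : N →ₛₗ[algebraMap O K] W) (φ' : N' →ₛₗ[algebraMap O K] W') (e : N ≃ₗ[O] N')
    (e' : W ≃ₗ[K] W') (he : ∀ n, e' (φ n) = φ' (e n)) :
    detIdeal φ' (b.map e') = detIdeal φ b := by
  have hw : wedgeCoord φ' (b.map e') = wedgeCoord φ b := by
    unfold wedgeCoord
    congr 1
    ext x
    constructor
    · rintro ⟨s, rfl⟩
      refine ⟨fun i => e.symm (s i), ?_⟩
      simp only [Basis.det_map]
      congr 1
      ext i
      simp only [Function.comp]
      rw [LinearEquiv.eq_symm_apply, he, LinearEquiv.apply_symm_apply]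
    · rintro ⟨s, rfl⟩
      refine ⟨fun i => e (s i), ?_⟩
      simp only [Basis.det_map]
      congr 1
      ext i
      simp only [Function.comp]
      rw [← he, LinearEquiv.symm_apply_apply]
  have hl : Module.length O (Submodule.torsion O N') = Module.length O (Submodule.torsion O N) := by
    have : Submodule.torsion O N' = (Submodule.torsion O N).map (e : N →ₗ[O] N') := by
      ext x
      simp only [Submodule.mem_torsion_iff, Submodule.mem_map]
      constructor
      · rintro ⟨a, ha⟩
        refine ⟨e.symm x, ⟨a, ?_⟩, e.apply_symm_apply x⟩
        apply e.injective
        rw [map_zero, ← ha]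
        change e ((a : O) • e.symm x) = (a : O) • x
        rw [map_smul, e.apply_symm_apply]
      · rintro ⟨y, ⟨a, ha⟩, rfl⟩
        refine ⟨a, ?_⟩
        change (a : O) • e y = 0
        rw [← map_smul]
        change e (a • y) = 0
        rw [ha, map_zero]
    rw [this]
    exact (e.submoduleMap (Submodule.torsion O N)).length_eq.symm
  ext x
  change (∀ a ∈ _, _) ↔ ∀ a ∈ _, _
  rw [hw, hl]

variable {N' W' N'' W'' : Type*} [AddCommGroup N'] [Module O N'] [AddCommGroup W']
  [Module K W'] [AddCommGroup N''] [Module O N''] [AddCommGroup W''] [Module K W'']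
  {φ' : N' →ₛₗ[algebraMap O K] W'} {φ'' : N'' →ₛₗ[algebraMap O K] W''}
  {ι' ι'' : Type*} [Fintype ι'] [DecidableEq ι'] [Fintype ι''] [DecidableEq ι'']

/-- Sublattices L', L, L'' adapted to the bases are chosen so that they form an exact sequence
themselves. The quotients by them again form a short exact sequence, their lengths add up, and the
product of the two outer instances of `detIdeal_mul_pow` is the middle one. -/
theorem detIdeal_mul_of_exact (h' : IsLattice φ') (h : IsLattice φ) (h'' : IsLattice φ'')
    (f : N' →ₗ[O] N) (g : N →ₗ[O] N'') (f' : W' →ₗ[K] W) (g' : W →ₗ[K] W'')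
    (hf : Function.Injective f) (hg : Function.Surjective g) (hfg : Function.Exact f g)
    (hf' : ∀ n, φ (f n) = f' (φ' n)) (hg' : ∀ n, φ'' (g n) = g' (φ n))
    (b' : Basis ι' K W') (b'' : Basis ι'' K W'') (b : Basis (ι' ⊕ ι'') K W)
    (hb' : ∀ i, b (Sum.inl i) = f' (b' i)) (hb'' : ∀ j, g' (b (Sum.inr j)) = b'' j) :
    detIdeal φ b = detIdeal φ' b' * detIdeal φ'' b'' := by
  obtain ⟨n', c', hc', hn'⟩ := h'.exists_smul_basis b'
  -- Only the `inr` half of m is kept: its images under g serve as the sublattice of N''. The `inl`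
  -- half is replaced by the images of n', so that L contains the image of L'.
  obtain ⟨m, c₀, hc₀, hm⟩ := h.exists_smul_basis b
  have hn'' : ∀ j, φ'' (g (m (Sum.inr j))) = c₀ (Sum.inr j) • b'' j := fun j => by
    rw [hg', hm, map_smul, hb'']
  let n : ι' ⊕ ι'' → N := Sum.elim (fun i => f (n' i)) fun j => m (Sum.inr j)
  let c : ι' ⊕ ι'' → K := Sum.elim c' fun j => c₀ (Sum.inr j)
  have hc : ∀ i, c i ≠ 0 := by
    rintro (i | j)
    · exact hc' i
    · exact hc₀ _
  have hn : ∀ i, φ (n i) = c i • b i := by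
    rintro (i | j)
    · change φ (f (n' i)) = c' i • b (Sum.inl i)
      rw [hf', hn', map_smul, hb']
    · exact hm _
  obtain ⟨hl', hd'⟩ := detIdeal_mul_pow b' h' n' c' hc' hn'
  obtain ⟨hl, hd⟩ := detIdeal_mul_pow b h n c hc hn
  obtain ⟨hl'', hd''⟩ := detIdeal_mul_pow b'' h'' _ _ (fun j => hc₀ (Sum.inr j)) hn''
  set L' := Submodule.span O (Set.range n')
  set L := Submodule.span O (Set.range n)
  set L'' := Submodule.span O (Set.range fun j => g (m (Sum.inr j)))
  have hmemL : ∀ x, x ∈ L ↔ ∃ (a : ι' → O) (d : ι'' → O),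
      f (∑ i, a i • n' i) + ∑ j, d j • m (Sum.inr j) = x := by
    intro x
    rw [Submodule.mem_span_range_iff_exists_fun]
    constructor
    · rintro ⟨a, rfl⟩
      refine ⟨fun i => a (Sum.inl i), fun j => a (Sum.inr j), ?_⟩
      simp [n, map_sum]
    · rintro ⟨a, d, rfl⟩
      refine ⟨Sum.elim a d, ?_⟩
      simp [n, map_sum]
  have hgf : ∀ x, g (f x) = 0 := fun x => (hfg (f x)).2 ⟨x, rfl⟩
  have hLL : L' ≤ L.comap f := fun x hx => by
    obtain ⟨a, rfl⟩ := (Submodule.mem_span_range_iff_exists_fun O).1 hx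
    exact (hmemL _).2 ⟨a, 0, by simp⟩
  have hLL'' : L ≤ L''.comap g := fun x hx => by
    obtain ⟨a, d, rfl⟩ := (hmemL _).1 hx
    refine (Submodule.mem_span_range_iff_exists_fun O).2 ⟨d, ?_⟩
    rw [map_add, hgf, zero_add, map_sum]
    simp
  have hadd := Module.length_eq_add_of_exact (L'.mapQ L f hLL) (L.mapQ L'' g hLL'')
    (by
      rw [injective_iff_map_eq_zero]
      intro x
      obtain ⟨x, rfl⟩ := Submodule.mkQ_surjective _ x
      intro hx
      obtain ⟨a, d, had⟩ := (hmemL _).1 ((Submodule.Quotient.mk_eq_zero L).1 hx)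
      have h0 := congrArg (fun y => φ'' (g y)) had
      simp only [map_add, hgf, map_sum, map_smulₛₗ, hn'', smul_smul, smul_zero,
        Finset.sum_const_zero, zero_add, map_zero] at h0
      -- If f x lies in L, applying g leaves a relation among independent vectors of N'', so only
      -- the part coming from L' survives.
      have hd0 : d = 0 := by
        funext j
        have := (mul_eq_zero.1 (Fintype.linearIndependent_iff.1 b''.linearIndependent _ h0 j)).resolve_right
          (hc₀ _)
        simpa using this
      rw [hd0] at had
      refine (Submodule.Quotient.mk_eq_zero L').2 ?_
      rw [← hf (by simpa using had : f (∑ i, a i • n' i) = f x)]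
      exact Submodule.sum_mem _ fun i _ => Submodule.smul_mem _ _ (Submodule.subset_span ⟨i, rfl⟩))
    (by
      intro x
      obtain ⟨x, rfl⟩ := Submodule.mkQ_surjective _ x
      obtain ⟨x, rfl⟩ := hg x
      exact ⟨L.mkQ x, rfl⟩)
    (by
      intro x
      obtain ⟨x, rfl⟩ := Submodule.mkQ_surjective _ x
      constructor
      · intro hx
        obtain ⟨d, hd⟩ := (Submodule.mem_span_range_iff_exists_fun O).1
          ((Submodule.Quotient.mk_eq_zero L'').1 hx : g x ∈ L'')
        have : g (x - ∑ j, d j • m (Sum.inr j)) = 0 := by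
          rw [map_sub, ← hd, map_sum]
          simp
        obtain ⟨y, hy⟩ := (hfg _).1 this
        refine ⟨L'.mkQ y, (Submodule.Quotient.eq L).2 ?_⟩
        rw [hy]
        exact (hmemL _).2 ⟨0, -d, by simp⟩
      · rintro ⟨y, hy⟩
        obtain ⟨y, rfl⟩ := Submodule.mkQ_surjective _ y
        rw [← hy]
        refine (Submodule.Quotient.mk_eq_zero _).2 ?_
        change g (f y) ∈ L''
        rw [hgf]
        exact zero_mem _)
  rw [hadd, ENat.toNat_add hl' hl'', pow_add, IsLocalization.coeSubmodule_mul] at hd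
  have hprod : (∏ i, c i) = (∏ i, c' i) * ∏ j, c₀ (Sum.inr j) := by
    rw [Fintype.prod_sum_type]
    rfl
  rw [hprod, ← Set.singleton_mul_singleton, ← Submodule.span_mul_span, ← hd', ← hd'',
    mul_mul_mul_comm] at hd
  -- The power of the maximal ideal can be cancelled since it is a factor of a product of two
  -- nonzero principal ideals.
  refine IsUnit.mul_right_cancel ?_ hd
  refine isUnit_of_mul_isUnit_right (x := detIdeal φ b) ?_
  rw [hd, mul_mul_mul_comm, hd', hd'']
  exact (isUnit_span_singleton (Finset.prod_ne_zero_iff.2 fun i _ => hc' i)).mul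
    (isUnit_span_singleton (Finset.prod_ne_zero_iff.2 fun i _ => hc₀ _))

theorem exists_basis_of_exact {W W' W'' : Type*} [AddCommGroup W] [Module K W] [AddCommGroup W']
    [Module K W'] [AddCommGroup W''] [Module K W''] (f' : W' →ₗ[K] W) (g' : W →ₗ[K] W'')
    (hf : Function.Injective f') (hg : Function.Surjective g') (hfg : Function.Exact f' g')
    {ι' ι'' : Type*} (b' : Basis ι' K W') (b'' : Basis ι'' K W'') :
    ∃ b : Basis (ι' ⊕ ι'') K W,
      (∀ i, b (Sum.inl i) = f' (b' i)) ∧ ∀ j, g' (b (Sum.inr j)) = b'' j := by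
  have hker : LinearMap.ker g' = LinearMap.range f' := by
    ext x
    exact hfg x
  let e : (W ⧸ LinearMap.range f') ≃ₗ[K] W'' :=
    (Submodule.quotEquivOfEq _ _ hker.symm).trans (g'.quotKerEquivOfSurjective hg)
  have he : ∀ w, e (Submodule.Quotient.mk w) = g' w := fun w => rfl
  refine ⟨Basis.sumQuot (b'.map (LinearEquiv.ofInjective f' hf)) (b''.map e.symm),
    fun i => ?_, fun j => ?_⟩
  · rw [Basis.sumQuot_inl]
    rfl
  · rw [← he, Basis.sumQuot_inr, Basis.map_apply, e.apply_symm_apply]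

end LocalAlgebraExact

/-! ### Schreier refinement in a modular lattice -/

section Refinement

variable {α G : Type*} [Lattice α] [IsModularLattice α] [CommGroup G]

/-- A function on the pairs `P ≤ Q` of good elements of a modular lattice for which the quotient is
thin, which is multiplicative and satisfies the second isomorphism theorem. -/
structure QuotientInvariant (good : α → Prop) (thin : α → α → Prop) (δ : α → α → G) : Prop where
  good_sup : ∀ {P Q}, good P → good Q → good (P ⊔ Q)
  good_inf : ∀ {P Q}, good P → good Q → good (P ⊓ Q)
  thin_mono : ∀ {P Q P' Q'}, thin P Q → P ≤ P' → Q' ≤ Q → thin P' Q'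
  thin_inf : ∀ {P Q} (R), thin P Q → thin (P ⊓ R) (Q ⊓ R)
  mul_eq : ∀ {P Q R}, good P → good Q → good R → P ≤ Q → Q ≤ R → thin P R →
    δ P Q * δ Q R = δ P R
  inf_eq : ∀ {P Q}, good P → good Q → thin (P ⊓ Q) Q → δ (P ⊓ Q) Q = δ P (P ⊔ Q)

namespace QuotientInvariant

variable {good : α → Prop} {thin : α → α → Prop} {δ : α → α → G} (h : QuotientInvariant good thin δ)

include h

/-- Telescoping, allowed because the whole chain is thin from bottom to top. -/
theorem prod_eq {c : ℕ → α} (hc : Monotone c) {n : ℕ} (hg : ∀ j ≤ n, good (c j))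
    (ht : thin (c 0) (c n)) : ∏ j ∈ Finset.range n, δ (c j) (c (j + 1)) = δ (c 0) (c n) := by
  induction n with
  | zero =>
    -- The empty product requires δ P P = 1, which is multiplicativity for P ≤ P ≤ P.
    have := h.mul_eq (hg 0 le_rfl) (hg 0 le_rfl) (hg 0 le_rfl) le_rfl le_rfl ht
    rw [Finset.prod_range_zero]
    exact (mul_eq_left.1 this).symm
  | succ n ih =>
    rw [Finset.prod_range_succ, ih (fun j hj => hg j (by omega))
      (h.thin_mono ht le_rfl (hc n.le_succ))]
    exact h.mul_eq (hg 0 (by omega)) (hg n (by omega)) (hg _ le_rfl) (hc n.zero_le)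
      (hc n.le_succ) ht

/-- Half of Zassenhaus' lemma: the modular law computes the meet and the join of a ⊔ a' ⊓ b with a'
⊓ b', and the second isomorphism theorem does the rest. The right-hand side is symmetric in the two
chains. -/
theorem butterfly {a a' b b' : α} (ha : a ≤ a') (hb : b ≤ b') (hga : good a) (hga' : good a')
    (hgb : good b) (hgb' : good b') (ht : thin a a') :
    δ (a ⊔ a' ⊓ b) (a ⊔ a' ⊓ b') = δ (a ⊓ b' ⊔ a' ⊓ b) (a' ⊓ b') := by
  have h1 : (a ⊔ a' ⊓ b) ⊓ (a' ⊓ b') = a ⊓ b' ⊔ a' ⊓ b := by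
    rw [← inf_assoc, inf_eq_left.2 (sup_le ha inf_le_left : a ⊔ a' ⊓ b ≤ a'), sup_comm,
      sup_inf_assoc_of_le a (inf_le_right.trans hb : a' ⊓ b ≤ b'), sup_comm]
  have h2 : (a ⊔ a' ⊓ b) ⊔ (a' ⊓ b') = a ⊔ a' ⊓ b' := by
    rw [sup_assoc, sup_eq_right.2 (inf_le_inf_left a' hb : a' ⊓ b ≤ a' ⊓ b')]
  have h3 := h.inf_eq (P := a ⊔ a' ⊓ b) (Q := a' ⊓ b')
    (h.good_sup hga (h.good_inf hga' hgb)) (h.good_inf hga' hgb') (by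
      rw [h1]
      exact h.thin_mono (h.thin_inf b' ht) le_sup_left le_rfl)
  rw [← h2, ← h3, h1]

/-- Each step of a is subdivided by the members of b, and conversely. After `butterfly` both
products become one double product with its factors in a different order. -/
theorem prod_eq_prod {a b : ℕ → α} {m n : ℕ} (ha : Monotone a) (hb : Monotone b)
    (h0 : a 0 = b 0) (h1 : a m = b n) (hga : ∀ i ≤ m, good (a i)) (hgb : ∀ j ≤ n, good (b j))
    (hta : ∀ i < m, thin (a i) (a (i + 1))) (htb : ∀ j < n, thin (b j) (b (j + 1))) :
    ∏ i ∈ Finset.range m, δ (a i) (a (i + 1)) = ∏ j ∈ Finset.range n, δ (b j) (b (j + 1)) := by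
  have key : ∀ {a b : ℕ → α} {m n : ℕ}, Monotone a → Monotone b → a 0 = b 0 → a m = b n →
      (∀ i ≤ m, good (a i)) → (∀ j ≤ n, good (b j)) → (∀ i < m, thin (a i) (a (i + 1))) →
      ∏ i ∈ Finset.range m, δ (a i) (a (i + 1)) = ∏ i ∈ Finset.range m, ∏ j ∈ Finset.range n,
        δ (a i ⊓ b (j + 1) ⊔ a (i + 1) ⊓ b j) (a (i + 1) ⊓ b (j + 1)) := by
    intro a b m n ha hb h0 h1 hga hgb hta
    refine Finset.prod_congr rfl fun i hi => ?_
    have him : i < m := Finset.mem_range.1 hi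
    -- The common endpoints of the two chains ensure that the subdivision of the i-th step starts at
    -- a i and ends at a (i + 1).
    have hc0 : a i ⊔ a (i + 1) ⊓ b 0 = a i :=
      sup_eq_left.2 (inf_le_right.trans (h0 ▸ ha i.zero_le))
    have hcn : a i ⊔ a (i + 1) ⊓ b n = a (i + 1) := by
      rw [← h1, inf_eq_left.2 (ha him), sup_eq_right.2 (ha i.le_succ)]
    have := h.prod_eq (c := fun j => a i ⊔ a (i + 1) ⊓ b j) (n := n)
      (fun j k hjk => sup_le_sup_left (inf_le_inf_left _ (hb hjk)) _)
      (fun j hj => h.good_sup (hga i him.le) (h.good_inf (hga _ him) (hgb j hj)))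
      (by simp only [hc0, hcn]; exact hta i him)
    simp only [hc0, hcn] at this
    rw [← this]
    refine Finset.prod_congr rfl fun j hj => ?_
    have hjn : j < n := Finset.mem_range.1 hj
    exact h.butterfly (ha i.le_succ) (hb j.le_succ) (hga i him.le) (hga _ him) (hgb j hjn.le)
      (hgb _ hjn) (hta i him)
  rw [key ha hb h0 h1 hga hgb hta, key hb ha h0.symm h1.symm hgb hga htb, Finset.prod_comm]
  refine Finset.prod_congr rfl fun j _ => Finset.prod_congr rfl fun i _ => ?_
  rw [sup_comm, inf_comm (b j), inf_comm (b (j + 1)), inf_comm (b (j + 1))]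

end QuotientInvariant

end Refinement

/-! ### Families of lattices and classes of families of fractional ideals -/

section Families

open Module

variable {I : Type*} (O : I → Type*) [∀ x, CommRing (O x)] [∀ x, IsDomain (O x)]
  [∀ x, IsPrincipalIdealRing (O x)] [∀ x, IsLocalRing (O x)] (K : Type*) [Field K]
  [∀ x, Algebra (O x) K] [∀ x, IsFractionRing (O x) K]

/-- A family of finite modules `N x` over the rings `O x` with a common localization `W`. -/
structure LatticeFamily where
  /-- the modules -/
  N : I → Type u
  /-- the common localization -/
  W : Type u
  [addCommGroup : ∀ x, AddCommGroup (N x)]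
  [module : ∀ x, Module (O x) (N x)]
  [addCommGroup_W : AddCommGroup W]
  [module_W : Module K W]
  /-- the localization maps -/
  φ : ∀ x, N x →ₛₗ[algebraMap (O x) K] W
  isLattice : ∀ x, IsLattice (φ x)
  finite : Module.Finite K W

attribute [instance] LatticeFamily.addCommGroup LatticeFamily.module LatticeFamily.addCommGroup_W
  LatticeFamily.module_W LatticeFamily.finite

/-- Families of invertible fractional ideals. -/
abbrev IdealFamily : Type _ := ∀ x, (Submodule (O x) K)ˣ

/-- The family of principal fractional ideals generated by `a`. -/
noncomputable def principal : Kˣ →* IdealFamily O K where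
  toFun a := fun x => Units.map (Submodule.spanSingleton (O x)).toMonoidHom a
  map_one' := by
    funext x
    rw [map_one]
    rfl
  map_mul' a b := by
    funext x
    rw [map_mul]
    rfl

theorem coe_principal (a : Kˣ) (x : I) :
    (principal O K a x : Submodule (O x) K) = Submodule.span (O x) {(a : K)} := rfl

/-- Families of invertible fractional ideals up to principal ones. -/
abbrev IdealClass : Type _ := IdealFamily O K ⧸ (principal O K).range

variable {O K}

namespace LatticeFamily

variable (F : LatticeFamily.{u} O K) {ι : Type*} [Fintype ι] [DecidableEq ι]

/-- The family of the determinants of the modules `F.N x`. -/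
noncomputable def ideal (b : Basis ι K F.W) : IdealFamily O K :=
  fun x => (isUnit_detIdeal b (F.isLattice x)).unit

/-- The class of the family of determinants, which does not depend on the choice of a basis. -/
noncomputable def cls : IdealClass O K :=
  QuotientGroup.mk (F.ideal (Module.finBasis K F.W))

/-- By `detIdeal_basis_change` two bases give families that differ by the same scalar at every
point, hence by a principal family. -/
theorem mk_ideal (b : Basis ι K F.W) : QuotientGroup.mk (F.ideal b) = F.cls := by
  refine QuotientGroup.eq.2 ?_
  refine ⟨(Basis.isUnit_det (Module.finBasis K F.W) (b.reindex (b.indexEquiv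
    (Module.finBasis K F.W)))).unit, ?_⟩
  rw [eq_inv_mul_iff_mul_eq, mul_comm]
  funext x
  refine Units.ext ?_
  exact (detIdeal_basis_change b (F.φ x) (Module.finBasis K F.W)).symm

variable {F} in
theorem cls_congr {F' : LatticeFamily.{u} O K} (e : ∀ x, F.N x ≃ₗ[O x] F'.N x)
    (e' : F.W ≃ₗ[K] F'.W) (he : ∀ x n, e' (F.φ x n) = F'.φ x (e x n)) : F.cls = F'.cls := by
  rw [← F'.mk_ideal ((Module.finBasis K F.W).map e')]
  unfold cls
  congr 1
  funext x
  refine Units.ext ?_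
  exact (detIdeal_congr _ (F.φ x) (F'.φ x) (e x) e' (he x)).symm

/-- One basis of the common localization adapted to the generic exact sequence serves at all points,
so the pointwise identities combine into one identity of families. -/
theorem cls_mul_of_exact {F' F F'' : LatticeFamily.{u} O K} (f : ∀ x, F'.N x →ₗ[O x] F.N x)
    (g : ∀ x, F.N x →ₗ[O x] F''.N x) (f' : F'.W →ₗ[K] F.W) (g' : F.W →ₗ[K] F''.W)
    (hf : ∀ x, Function.Injective (f x)) (hg : ∀ x, Function.Surjective (g x))
    (hfg : ∀ x, Function.Exact (f x) (g x)) (hf' : Function.Injective f')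
    (hg' : Function.Surjective g') (hfg' : Function.Exact f' g')
    (hfφ : ∀ x n, F.φ x (f x n) = f' (F'.φ x n)) (hgφ : ∀ x n, F''.φ x (g x n) = g' (F.φ x n)) :
    F'.cls * F''.cls = F.cls := by
  obtain ⟨b, hb', hb''⟩ := exists_basis_of_exact f' g' hf' hg' hfg' (Module.finBasis K F'.W)
    (Module.finBasis K F''.W)
  rw [← F.mk_ideal b]
  unfold cls
  rw [← QuotientGroup.mk_mul]
  congr 1
  funext x
  refine Units.ext ?_
  exact (detIdeal_mul_of_exact (F'.isLattice x) (F.isLattice x) (F''.isLattice x) (f x) (g x) f' g'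
    (hf x) (hg x) (hfg x) (hfφ x) (hgφ x) _ _ b hb' hb'').symm

end LatticeFamily

theorem IsLattice.finite_space {O K N W : Type*} [CommRing O] [IsDomain O] [Field K] [Algebra O K]
    [IsFractionRing O K] [AddCommGroup N] [Module O N] [AddCommGroup W] [Module K W]
    {φ : N →ₛₗ[algebraMap O K] W} (h : IsLattice φ) : Module.Finite K W := by
  obtain ⟨s, hs⟩ := h.finite.fg_top
  classical
  refine ⟨⟨s.image φ, ?_⟩⟩
  rw [eq_top_iff]
  intro w _
  obtain ⟨a, ha, n, hn⟩ := h.exists_smul_mem_range w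
  have ha' : algebraMap O K a ≠ 0 := by simpa using ha
  have hw : w = (algebraMap O K a)⁻¹ • φ n := by rw [hn, smul_smul, inv_mul_cancel₀ ha', one_smul]
  rw [hw]
  refine Submodule.smul_mem _ _ ?_
  have hn' : n ∈ Submodule.span O (s : Set N) := hs ▸ Submodule.mem_top
  clear hn hw
  induction hn' using Submodule.span_induction with
  | mem y hy => exact Submodule.subset_span (by simpa using ⟨y, hy, rfl⟩)
  | zero => rw [map_zero]; exact zero_mem _
  | add y z _ _ hy hz => rw [map_add]; exact add_mem hy hz
  | smul r y _ hy => rw [map_smulₛₗ]; exact Submodule.smul_mem _ _ hy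

end Families

/-! ### Submodules of stalks over a thickening and the class of a thin quotient -/

section ThinPairs

variable {I : Type*} (O : I → Type*) [∀ x, CommRing (O x)] [∀ x, IsDomain (O x)]
  [∀ x, IsPrincipalIdealRing (O x)] [∀ x, IsLocalRing (O x)] (K : Type*) [Field K]
  [∀ x, Algebra (O x) K] [∀ x, IsFractionRing (O x) K]

/-- Rings `A x` with quotients `O x`, and a common localization `A'` with quotient `K`. -/
structure Thickening where
  /-- the rings -/
  A : I → Type u
  /-- the common localization -/
  A' : Type u
  [commRing : ∀ x, CommRing (A x)]
  [commRing' : CommRing A']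
  [noetherian : ∀ x, IsNoetherianRing (A x)]
  /-- the localization maps -/
  sp : ∀ x, A x →+* A'
  /-- the projection to `O x` -/
  π : ∀ x, A x →+* O x
  /-- the projection to `K` -/
  π' : A' →+* K
  surjective : ∀ x, Function.Surjective (π x)
  surjective' : Function.Surjective π'
  comm : ∀ x a, π' (sp x a) = algebraMap (O x) K (π x a)

attribute [instance] Thickening.commRing Thickening.commRing' Thickening.noetherian

variable {O K}

/-- A family of finite modules over the rings of `T`. -/
structure Thickening.Mod (T : Thickening.{u} O K) where
  /-- the modules -/
  E : I → Type u
  /-- the common localization -/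
  E' : Type u
  [addCommGroup : ∀ x, AddCommGroup (E x)]
  [module : ∀ x, Module (T.A x) (E x)]
  [addCommGroup' : AddCommGroup E']
  [module' : Module T.A' E']
  [finite : ∀ x, Module.Finite (T.A x) (E x)]
  /-- the localization maps -/
  sp : ∀ x, E x →ₛₗ[T.sp x] E'
  exists_smul_eq_zero : ∀ x m, sp x m = 0 → ∃ a, T.π x a ≠ 0 ∧ a • m = 0

attribute [instance] Thickening.Mod.addCommGroup Thickening.Mod.module Thickening.Mod.addCommGroup'
  Thickening.Mod.module' Thickening.Mod.finite

namespace Thickening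

variable {T : Thickening.{u} O K}

/-- Families of submodules of `M`. -/
abbrev Mod.Sub (M : T.Mod) : Type _ := (∀ x, Submodule (T.A x) (M.E x)) × Submodule T.A' M.E'

instance (M : T.Mod) : IsModularLattice M.Sub :=
  ⟨fun {_} _ {_} h => ⟨fun x => IsModularLattice.sup_inf_le_assoc_of_le _ (h.1 x),
    IsModularLattice.sup_inf_le_assoc_of_le _ h.2⟩⟩

/-- The submodules `P.1 x` have the common localization `P.2`. -/
structure Mod.IsGood {M : T.Mod} (P : M.Sub) : Prop where
  map_mem : ∀ x m, m ∈ P.1 x → M.sp x m ∈ P.2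
  exists_smul_mem : ∀ x w, w ∈ P.2 → ∃ a, T.π x a ≠ 0 ∧ ∃ m ∈ P.1 x, M.sp x m = T.sp x a • w

/-- The quotient of `Q` by `P` is annihilated by the kernels of the projections. -/
structure Mod.IsThin {M : T.Mod} (P Q : M.Sub) : Prop where
  smul_mem : ∀ x a, T.π x a = 0 → ∀ m ∈ Q.1 x, a • m ∈ P.1 x
  smul_mem' : ∀ a, T.π' a = 0 → ∀ m ∈ Q.2, a • m ∈ P.2

namespace Mod

variable {M : T.Mod}

/-- Numerators of w found in P and in Q agree in the localization after cross-multiplication. A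
further denominator c makes them equal already in the module, and the resulting element lies in both
submodules. -/
theorem IsGood.inf {P Q : M.Sub} (hP : IsGood P) (hQ : IsGood Q) : IsGood (P ⊓ Q) where
  map_mem x m hm := ⟨hP.map_mem x m hm.1, hQ.map_mem x m hm.2⟩
  exists_smul_mem x w hw := by
    obtain ⟨a, ha, m, hm, hma⟩ := hP.exists_smul_mem x w hw.1
    obtain ⟨b, hb, n, hn, hnb⟩ := hQ.exists_smul_mem x w hw.2
    obtain ⟨c, hc, hcm⟩ := M.exists_smul_eq_zero x (b • m - a • n) (by
      rw [map_sub, map_smulₛₗ, map_smulₛₗ, hma, hnb, smul_smul, smul_smul, mul_comm, sub_self])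
    rw [smul_sub, sub_eq_zero] at hcm
    refine ⟨c * (b * a), ?_, c • b • m, ⟨?_, ?_⟩, ?_⟩
    · simp only [map_mul]
      exact mul_ne_zero hc (mul_ne_zero hb ha)
    · exact Submodule.smul_mem _ _ (Submodule.smul_mem _ _ hm)
    · rw [hcm]
      exact Submodule.smul_mem _ _ (Submodule.smul_mem _ _ hn)
    · simp only [map_smulₛₗ, hma, map_mul, mul_smul]

theorem IsGood.sup {P Q : M.Sub} (hP : IsGood P) (hQ : IsGood Q) : IsGood (P ⊔ Q) where
  map_mem x m hm := by
    obtain ⟨p, hp, q, hq, rfl⟩ := Submodule.mem_sup.1 hm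
    rw [map_add]
    exact Submodule.add_mem_sup (hP.map_mem x p hp) (hQ.map_mem x q hq)
  exists_smul_mem x w hw := by
    obtain ⟨p, hp, q, hq, rfl⟩ := Submodule.mem_sup.1 hw
    obtain ⟨a, ha, m, hm, hma⟩ := hP.exists_smul_mem x p hp
    obtain ⟨b, hb, n, hn, hnb⟩ := hQ.exists_smul_mem x q hq
    refine ⟨a * b, ?_, b • m + a • n, ?_, ?_⟩
    · rw [map_mul]
      exact mul_ne_zero ha hb
    · exact Submodule.add_mem_sup (Submodule.smul_mem _ _ hm) (Submodule.smul_mem _ _ hn)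
    · rw [map_add, map_smulₛₗ, map_smulₛₗ, hma, hnb, smul_smul, smul_smul, smul_add, map_mul,
        mul_comm (T.sp x b)]

/-- A module which is annihilated by the kernel of a surjective ring homomorphism is a module over
the target. -/
@[reducible] noncomputable def moduleOfSurjective {A O N : Type*} [CommRing A] [CommRing O]
    [AddCommGroup N] [Module A N] (π : A →+* O) (hπ : Function.Surjective π)
    (h : ∀ a, π a = 0 → ∀ n : N, a • n = 0) : Module O N :=
  letI : SMul O N := ⟨fun r n => Function.surjInv hπ r • n⟩
  Function.Surjective.moduleLeft π hπ fun a n => by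
    change Function.surjInv hπ (π a) • n = a • n
    rw [← sub_eq_zero, ← sub_smul]
    exact h _ (by rw [map_sub, Function.surjInv_eq hπ, sub_self]) n

theorem moduleOfSurjective_smul {A O N : Type*} [CommRing A] [CommRing O] [AddCommGroup N]
    [Module A N] (π : A →+* O) (hπ : Function.Surjective π)
    (h : ∀ a, π a = 0 → ∀ n : N, a • n = 0) (a : A) (n : N) :
    letI := moduleOfSurjective π hπ h
    π a • n = a • n := by
  change Function.surjInv hπ (π a) • n = a • n
  rw [← sub_eq_zero, ← sub_smul]
  exact h _ (by rw [map_sub, Function.surjInv_eq hπ, sub_self]) n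

theorem IsThin.smul_eq_zero {P Q : M.Sub} (h : IsThin P Q) (x : I) (a : T.A x) (ha : T.π x a = 0)
    (n : Q.1 x ⧸ (P.1 x).submoduleOf (Q.1 x)) : a • n = 0 := by
  obtain ⟨n, rfl⟩ := Submodule.mkQ_surjective _ n
  exact (Submodule.Quotient.mk_eq_zero _).2 (h.smul_mem x a ha n.1 n.2)

theorem IsThin.smul_eq_zero' {P Q : M.Sub} (h : IsThin P Q) (a : T.A') (ha : T.π' a = 0)
    (n : Q.2 ⧸ P.2.submoduleOf Q.2) : a • n = 0 := by
  obtain ⟨n, rfl⟩ := Submodule.mkQ_surjective _ n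
  exact (Submodule.Quotient.mk_eq_zero _).2 (h.smul_mem' a ha n.1 n.2)

/-- The map `Q.1 x / P.1 x → Q.2 / P.2`. -/
def quotMap {P Q : M.Sub} (hP : IsGood P) (hQ : IsGood Q) (x : I) :
    (Q.1 x ⧸ (P.1 x).submoduleOf (Q.1 x)) →ₛₗ[T.sp x] (Q.2 ⧸ P.2.submoduleOf Q.2) :=
  Submodule.mapQ _ _ (((M.sp x).comp (Q.1 x).subtype).codRestrict Q.2
    fun m => hQ.map_mem x m m.2) fun m hm => hP.map_mem x m hm

/-- The family of the modules `Q.1 x / P.1 x`, for a thin pair. -/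
noncomputable def quotFamily {P Q : M.Sub} (hP : IsGood P) (hQ : IsGood Q) (h : IsThin P Q)
    [Nonempty I] : LatticeFamily.{u} O K :=
  letI : ∀ x, Module (O x) (Q.1 x ⧸ (P.1 x).submoduleOf (Q.1 x)) := fun x =>
    moduleOfSurjective (T.π x) (T.surjective x) (h.smul_eq_zero x)
  letI : Module K (Q.2 ⧸ P.2.submoduleOf Q.2) :=
    moduleOfSurjective T.π' T.surjective' h.smul_eq_zero'
  have hs : ∀ x (a : T.A x) (n : Q.1 x ⧸ (P.1 x).submoduleOf (Q.1 x)), T.π x a • n = a • n :=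
    fun x => moduleOfSurjective_smul (T.π x) (T.surjective x) (h.smul_eq_zero x)
  have hs' : ∀ (a : T.A') (n : Q.2 ⧸ P.2.submoduleOf Q.2), T.π' a • n = a • n :=
    moduleOfSurjective_smul T.π' T.surjective' h.smul_eq_zero'
  let φ : ∀ x, (Q.1 x ⧸ (P.1 x).submoduleOf (Q.1 x)) →ₛₗ[algebraMap (O x) K]
      (Q.2 ⧸ P.2.submoduleOf Q.2) := fun x =>
    { toFun := quotMap hP hQ x
      map_add' := map_add _
      map_smul' := fun r n => by
        obtain ⟨a, rfl⟩ := T.surjective x r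
        rw [hs, map_smulₛₗ, ← hs', T.comm] }
  have hφ : ∀ x, IsLattice (φ x) := fun x =>
    { finite := by
        refine ⟨?_⟩
        obtain ⟨s, hs1⟩ := (inferInstance : Module.Finite (T.A x)
          (Q.1 x ⧸ (P.1 x).submoduleOf (Q.1 x))).fg_top
        refine ⟨s, eq_top_iff.2 fun n _ => ?_⟩
        have hn : n ∈ Submodule.span (T.A x)
          (s : Set (Q.1 x ⧸ (P.1 x).submoduleOf (Q.1 x))) := hs1 ▸ Submodule.mem_top
        induction hn using Submodule.span_induction with
        | mem y hy => exact Submodule.subset_span hy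
        | zero => exact zero_mem _
        | add y z _ _ hy hz => exact add_mem (hy trivial) (hz trivial)
        | smul r y _ hy => rw [← hs]; exact Submodule.smul_mem _ _ (hy trivial)
      exists_smul_eq_zero := fun n hn => by
        obtain ⟨n, rfl⟩ := Submodule.mkQ_surjective _ n
        have hn' : M.sp x n.1 ∈ P.2 :=
          (Submodule.Quotient.mk_eq_zero (P.2.submoduleOf Q.2)).1 hn
        obtain ⟨a, ha, m, hm, hma⟩ := hP.exists_smul_mem x _ hn'
        -- The element a n and a member m of P have the same localization, so c a n = c m lies in P.
        obtain ⟨c, hc, hcm⟩ := M.exists_smul_eq_zero x (a • n.1 - m) (by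
          rw [map_sub, map_smulₛₗ, hma, sub_self])
        rw [smul_sub, sub_eq_zero] at hcm
        refine ⟨T.π x (c * a), by rw [map_mul]; exact mul_ne_zero hc ha, ?_⟩
        rw [hs]
        refine (Submodule.Quotient.mk_eq_zero _).2 ?_
        change (c * a) • n.1 ∈ P.1 x
        rw [mul_smul, hcm]
        exact Submodule.smul_mem _ _ hm
      exists_smul_mem_range := fun w => by
        obtain ⟨w, rfl⟩ := Submodule.mkQ_surjective _ w
        obtain ⟨a, ha, m, hm, hma⟩ := hQ.exists_smul_mem x w.1 w.2
        refine ⟨T.π x a, ha, Submodule.mkQ _ ⟨m, hm⟩, ?_⟩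
        rw [← T.comm, hs', ← map_smul]
        exact congrArg (Submodule.mkQ _) (Subtype.ext hma) }
  { N := fun x => Q.1 x ⧸ (P.1 x).submoduleOf (Q.1 x)
    W := Q.2 ⧸ P.2.submoduleOf Q.2
    φ := φ
    isLattice := hφ
    -- Finite dimension of the common localization can be read off at any single point.
    finite := (hφ (Classical.arbitrary I)).finite_space }

/-- `F` is isomorphic to the quotient of `Q` by `P`. -/
structure Realizes (F : LatticeFamily.{u} O K) (P Q : M.Sub) where
  /-- the quotient maps -/
  p : ∀ x, Q.1 x →ₛₗ[T.π x] F.N x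
  /-- the quotient map of the localizations -/
  p' : Q.2 →ₛₗ[T.π'] F.W
  surj : ∀ x, Function.Surjective (p x)
  surj' : Function.Surjective p'
  ker : ∀ x m, p x m = 0 ↔ (m : M.E x) ∈ P.1 x
  ker' : ∀ m, p' m = 0 ↔ (m : M.E') ∈ P.2
  comm : ∀ x (m : Q.1 x) (w : Q.2), M.sp x m = w → F.φ x (p x m) = p' w

/-- The literal quotients are one model. Allowing other models matters because the determinants of
graded pieces are computed from stalks of sheaves on C. -/
theorem exists_realizes {P Q : M.Sub} (hP : IsGood P) (hQ : IsGood Q) (h : IsThin P Q)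
    [Nonempty I] : ∃ F : LatticeFamily.{u} O K, Nonempty (Realizes F P Q) :=
  ⟨quotFamily hP hQ h, ⟨{
    p := fun x =>
      { toFun := fun m => Submodule.mkQ _ m
        map_add' := map_add _
        map_smul' := fun a m => (moduleOfSurjective_smul (T.π x) (T.surjective x)
          (h.smul_eq_zero x) a (Submodule.mkQ ((P.1 x).submoduleOf (Q.1 x)) m)).symm }
    p' :=
      { toFun := fun m => Submodule.mkQ _ m
        map_add' := map_add _
        map_smul' := fun a m => (moduleOfSurjective_smul T.π' T.surjective'
          h.smul_eq_zero' a (Submodule.mkQ (P.2.submoduleOf Q.2) m)).symm }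
    surj := fun _ => Submodule.mkQ_surjective _
    surj' := Submodule.mkQ_surjective _
    ker := fun _ _ => Submodule.Quotient.mk_eq_zero _
    ker' := fun _ => Submodule.Quotient.mk_eq_zero _
    comm := fun _ _ _ hw => congrArg (Submodule.mkQ (P.2.submoduleOf Q.2)) (Subtype.ext hw) }⟩⟩

theorem exists_factor {A O Q N N₂ : Type*} [CommRing A] [CommRing O] {π : A →+* O}
    (hπ : Function.Surjective π) [AddCommGroup Q] [Module A Q] [AddCommGroup N] [Module O N]
    [AddCommGroup N₂] [Module O N₂] (p : Q →ₛₗ[π] N) (q : Q →ₛₗ[π] N₂)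
    (hp : Function.Surjective p) (h : ∀ m, p m = 0 → q m = 0) :
    ∃ f : N →ₗ[O] N₂, ∀ m, f (p m) = q m := by
  have key : ∀ m m', p m = p m' → q m = q m' := fun m m' hm => by
    rw [← sub_eq_zero, ← map_sub]
    exact h _ (by rw [map_sub, hm, sub_self])
  have hf : ∀ m, q (Function.surjInv hp (p m)) = q m := fun m => key _ _ (Function.surjInv_eq hp _)
  refine ⟨{ toFun := fun n => q (Function.surjInv hp n), map_add' := fun n n' => ?_,
            map_smul' := fun r n => ?_ }, hf⟩
  · obtain ⟨m, rfl⟩ := hp n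
    obtain ⟨m', rfl⟩ := hp n'
    rw [← map_add, hf, hf, hf, map_add]
  · obtain ⟨m, rfl⟩ := hp n
    obtain ⟨a, rfl⟩ := hπ r
    rw [← map_smulₛₗ, hf, hf, map_smulₛₗ, RingHom.id_apply]

/-- The hypotheses on h say that it induces isomorphisms from Q / P to Q₂ / P₂. This one comparison
covers independence of the model, the second isomorphism theorem, and transport along the maps of an
exact sequence. -/
theorem Realizes.cls_eq {M₂ : T.Mod} {P Q : M.Sub} {P₂ Q₂ : M₂.Sub} {F F₂ : LatticeFamily.{u} O K}
    (r : Realizes F P Q) (r₂ : Realizes F₂ P₂ Q₂) (hQ : IsGood Q) (h : ∀ x, M.E x →ₗ[T.A x] M₂.E x)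
    (h' : M.E' →ₗ[T.A'] M₂.E') (hh : ∀ x m, M₂.sp x (h x m) = h' (M.sp x m))
    (hQQ : ∀ x, ∀ m ∈ Q.1 x, h x m ∈ Q₂.1 x) (hQQ' : ∀ m ∈ Q.2, h' m ∈ Q₂.2)
    (hP : ∀ x, ∀ m ∈ Q.1 x, h x m ∈ P₂.1 x ↔ m ∈ P.1 x) (hP' : ∀ m ∈ Q.2, h' m ∈ P₂.2 ↔ m ∈ P.2)
    (hs : ∀ x, ∀ m ∈ Q₂.1 x, ∃ n ∈ Q.1 x, m - h x n ∈ P₂.1 x)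
    (hs' : ∀ m ∈ Q₂.2, ∃ n ∈ Q.2, m - h' n ∈ P₂.2) : F.cls = F₂.cls := by
  let q : ∀ x, Q.1 x →ₛₗ[T.π x] F₂.N x := fun x =>
    (r₂.p x).comp (((h x).comp (Q.1 x).subtype).codRestrict (Q₂.1 x) fun m => hQQ x m m.2)
  let q' : Q.2 →ₛₗ[T.π'] F₂.W :=
    r₂.p'.comp ((h'.comp Q.2.subtype).codRestrict Q₂.2 fun m => hQQ' m m.2)
  have hq : ∀ x m, q x m = 0 ↔ r.p x m = 0 := fun x m =>
    ((r₂.ker x _).trans (hP x m m.2)).trans (r.ker x m).symm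
  have hq' : ∀ m, q' m = 0 ↔ r.p' m = 0 := fun m =>
    ((r₂.ker' _).trans (hP' m m.2)).trans (r.ker' m).symm
  choose f hf using fun x => exists_factor (T.surjective x) (r.p x) (q x) (r.surj x)
    fun m => (hq x m).2
  obtain ⟨f', hf'⟩ := exists_factor T.surjective' r.p' q' r.surj' fun m => (hq' m).2
  have hfb : ∀ x, Function.Bijective (f x) := fun x => by
    constructor
    · rw [injective_iff_map_eq_zero]
      intro n hn
      obtain ⟨m, rfl⟩ := r.surj x n
      rw [hf] at hn
      exact (hq x m).1 hn
    · intro n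
      obtain ⟨m, rfl⟩ := r₂.surj x n
      obtain ⟨l, hl, hlm⟩ := hs x m m.2
      refine ⟨r.p x ⟨l, hl⟩, ?_⟩
      rw [hf]
      refine (sub_eq_zero.1 ?_).symm
      change r₂.p x m - r₂.p x ⟨h x l, hQQ x l hl⟩ = 0
      rw [← map_sub]
      exact (r₂.ker x _).2 hlm
  have hfb' : Function.Bijective f' := by
    constructor
    · rw [injective_iff_map_eq_zero]
      intro n hn
      obtain ⟨m, rfl⟩ := r.surj' n
      rw [hf'] at hn
      exact (hq' m).1 hn
    · intro n
      obtain ⟨m, rfl⟩ := r₂.surj' n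
      obtain ⟨l, hl, hlm⟩ := hs' m m.2
      refine ⟨r.p' ⟨l, hl⟩, ?_⟩
      rw [hf']
      refine (sub_eq_zero.1 ?_).symm
      change r₂.p' m - r₂.p' ⟨h' l, hQQ' l hl⟩ = 0
      rw [← map_sub]
      exact (r₂.ker' _).2 hlm
  refine LatticeFamily.cls_congr (fun x => LinearEquiv.ofBijective (f x) (hfb x))
    (LinearEquiv.ofBijective f' hfb') fun x n => ?_
  obtain ⟨m, rfl⟩ := r.surj x n
  rw [LinearEquiv.ofBijective_apply, LinearEquiv.ofBijective_apply,
    r.comm x m ⟨_, hQ.map_mem x m m.2⟩ rfl, hf, hf']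
  exact (r₂.comm x _ _ (hh x m)).symm

/-- The sequences 0 → Q / P → R / P → R / Q → 0 are exact at every point and generically, and any
chosen models inherit the maps through their projections. -/
theorem Realizes.cls_mul {P Q R : M.Sub} {F' F F'' : LatticeFamily.{u} O K} (r' : Realizes F' P Q)
    (r : Realizes F P R) (r'' : Realizes F'' Q R) (hQ : IsGood Q) (hR : IsGood R) (hPQ : P ≤ Q)
    (hQR : Q ≤ R) : F'.cls * F''.cls = F.cls := by
  have hsp : ∀ x (m : R.1 x), M.sp x m ∈ R.2 := fun x m => hR.map_mem x m m.2
  choose f hf using fun x => exists_factor (T.surjective x) (r'.p x)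
    ((r.p x).comp (Submodule.inclusion (hQR.1 x))) (r'.surj x)
    fun m hm => (r.ker x _).2 ((r'.ker x m).1 hm)
  obtain ⟨f', hf'⟩ := exists_factor T.surjective' r'.p' (r.p'.comp (Submodule.inclusion hQR.2))
    r'.surj' fun m hm => (r.ker' _).2 ((r'.ker' m).1 hm)
  choose g hg using fun x => exists_factor (T.surjective x) (r.p x) (r''.p x) (r.surj x)
    fun m hm => (r''.ker x _).2 (hPQ.1 x ((r.ker x m).1 hm))
  obtain ⟨g', hg'⟩ := exists_factor T.surjective' r.p' r''.p' r.surj'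
    fun m hm => (r''.ker' _).2 (hPQ.2 ((r.ker' m).1 hm))
  refine LatticeFamily.cls_mul_of_exact f g f' g' (fun x => ?_) (fun x n => ?_) (fun x n => ?_) ?_
    (fun n => ?_) (fun n => ?_) (fun x n => ?_) (fun x n => ?_)
  · rw [injective_iff_map_eq_zero]
    intro n hn
    obtain ⟨m, rfl⟩ := r'.surj x n
    rw [hf] at hn
    exact (r'.ker x m).2 ((r.ker x _).1 hn)
  · obtain ⟨m, rfl⟩ := r''.surj x n
    exact ⟨r.p x m, hg x m⟩
  · obtain ⟨m, rfl⟩ := r.surj x n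
    rw [hg, r''.ker x]
    constructor
    · intro hm
      exact ⟨r'.p x ⟨m, hm⟩, hf x _⟩
    · rintro ⟨n, hn⟩
      obtain ⟨l, rfl⟩ := r'.surj x n
      rw [hf] at hn
      have h0 : r.p x (m - Submodule.inclusion (hQR.1 x) l) = 0 := by
        rw [map_sub, sub_eq_zero]
        exact hn.symm
      have h1 := hPQ.1 x ((r.ker x _).1 h0)
      have := add_mem h1 l.2
      simpa using this
  · rw [injective_iff_map_eq_zero]
    intro n hn
    obtain ⟨m, rfl⟩ := r'.surj' n
    rw [hf'] at hn
    exact (r'.ker' m).2 ((r.ker' _).1 hn)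
  · obtain ⟨m, rfl⟩ := r''.surj' n
    exact ⟨r.p' m, hg' m⟩
  · obtain ⟨m, rfl⟩ := r.surj' n
    rw [hg', r''.ker']
    constructor
    · intro hm
      exact ⟨r'.p' ⟨m, hm⟩, hf' _⟩
    · rintro ⟨n, hn⟩
      obtain ⟨l, rfl⟩ := r'.surj' n
      rw [hf'] at hn
      have h0 : r.p' (m - Submodule.inclusion hQR.2 l) = 0 := by
        rw [map_sub, sub_eq_zero]
        exact hn.symm
      have h1 := hPQ.2 ((r.ker' _).1 h0)
      have := add_mem h1 l.2
      simpa using this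
  · obtain ⟨m, rfl⟩ := r'.surj x n
    rw [hf, r'.comm x m ⟨_, hQ.map_mem x m m.2⟩ rfl, hf']
    exact r.comm x _ _ rfl
  · obtain ⟨m, rfl⟩ := r.surj x n
    rw [hg, r.comm x m ⟨_, hR.map_mem x m m.2⟩ rfl, hg']
    exact r''.comm x _ _ rfl

open Classical in
/-- The class of the determinants of the quotients `Q.1 x / P.1 x`. -/
noncomputable def quotCls (P Q : M.Sub) : IdealClass O K :=
  -- The default 1 only makes the function total: good thin pairs always have a realization by
  -- `exists_realizes`.
  if h : ∃ F : LatticeFamily.{u} O K, Nonempty (Realizes F P Q) then h.choose.cls else 1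

theorem Realizes.cls_eq_quotCls {P Q : M.Sub} {F : LatticeFamily.{u} O K} (r : Realizes F P Q)
    (hQ : IsGood Q) : F.cls = quotCls P Q := by
  have h : ∃ F : LatticeFamily.{u} O K, Nonempty (Realizes F P Q) := ⟨F, ⟨r⟩⟩
  rw [quotCls, dif_pos h]
  obtain ⟨r₂⟩ := h.choose_spec
  refine r.cls_eq r₂ hQ (fun _ => LinearMap.id) LinearMap.id (fun _ _ => rfl) (fun _ _ hm => hm)
    (fun _ hm => hm) (fun _ _ _ => Iff.rfl) (fun _ _ => Iff.rfl)
    (fun _ m hm => ⟨m, hm, ?_⟩) (fun m hm => ⟨m, hm, ?_⟩)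
  · rw [LinearMap.id_apply, sub_self]; exact zero_mem _
  · rw [LinearMap.id_apply, sub_self]; exact zero_mem _

theorem IsThin.mono {P Q P' Q' : M.Sub} (h : IsThin P Q) (hP : P ≤ P') (hQ : Q' ≤ Q) :
    IsThin P' Q' where
  smul_mem x a ha m hm := hP.1 x (h.smul_mem x a ha m (hQ.1 x hm))
  smul_mem' a ha m hm := hP.2 (h.smul_mem' a ha m (hQ.2 hm))

theorem quotientInvariant [Nonempty I] :
    QuotientInvariant (IsGood (M := M)) IsThin quotCls where
  good_sup := IsGood.sup
  good_inf := IsGood.inf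
  thin_mono := IsThin.mono
  thin_inf R h :=
    { smul_mem := fun x a ha m hm => ⟨h.smul_mem x a ha m hm.1, Submodule.smul_mem _ _ hm.2⟩
      smul_mem' := fun a ha m hm => ⟨h.smul_mem' a ha m hm.1, Submodule.smul_mem _ _ hm.2⟩ }
  mul_eq {P Q R} hP hQ hR hPQ hQR h := by
    obtain ⟨F', ⟨r'⟩⟩ := exists_realizes hP hQ (h.mono le_rfl hQR)
    obtain ⟨F, ⟨r⟩⟩ := exists_realizes hP hR h
    obtain ⟨F'', ⟨r''⟩⟩ := exists_realizes hQ hR (h.mono hPQ le_rfl)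
    rw [← r'.cls_eq_quotCls hQ, ← r.cls_eq_quotCls hR, ← r''.cls_eq_quotCls hR]
    exact r'.cls_mul r r'' hQ hR hPQ hQR
  inf_eq {P Q} hP hQ h := by
    -- The kernel preserves P and sends Q into P ⊓ Q, hence into P.
    have h2 : IsThin P (P ⊔ Q) :=
      { smul_mem := fun x a ha m hm => by
          obtain ⟨p, hp, q, hq, rfl⟩ := Submodule.mem_sup.1 hm
          rw [smul_add]
          exact add_mem (Submodule.smul_mem _ _ hp) (h.smul_mem x a ha q hq).1
        smul_mem' := fun a ha m hm => by
          obtain ⟨p, hp, q, hq, rfl⟩ := Submodule.mem_sup.1 hm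
          rw [smul_add]
          exact add_mem (Submodule.smul_mem _ _ hp) (h.smul_mem' a ha q hq).1 }
    obtain ⟨F, ⟨r⟩⟩ := exists_realizes (hP.inf hQ) hQ h
    obtain ⟨F₂, ⟨r₂⟩⟩ := exists_realizes hP (hP.sup hQ) h2
    rw [← r.cls_eq_quotCls hQ, ← r₂.cls_eq_quotCls (hP.sup hQ)]
    refine r.cls_eq r₂ hQ (fun _ => LinearMap.id) LinearMap.id (fun _ _ => rfl)
      (fun _ _ hm => Submodule.mem_sup_right hm) (fun _ hm => Submodule.mem_sup_right hm)
      (fun _ _ hm => ⟨fun h => ⟨h, hm⟩, fun h => h.1⟩) (fun _ hm => ⟨fun h => ⟨h, hm⟩, fun h => h.1⟩)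
      (fun _ _ hm => ?_) (fun _ hm => ?_)
    · obtain ⟨p, hp, q, hq, rfl⟩ := Submodule.mem_sup.1 hm
      exact ⟨q, hq, by simpa using hp⟩
    · obtain ⟨p, hp, q, hq, rfl⟩ := Submodule.mem_sup.1 hm
      exact ⟨q, hq, by simpa using hp⟩

end Mod

end Thickening

end ThinPairs

/-! ### Sheafification of locally bijective morphisms -/

theorem isIso_sheafificationAdjunction_homEquiv_symm {C : Type*} [Category* C]
    {J : GrothendieckTopology C} {A : Type*} [Category* A] [HasWeakSheafify J A] {P : Cᵒᵖ ⥤ A}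
    {F : Sheaf J A} (f : P ⟶ F.obj) (hf : J.W f) :
    IsIso (((sheafificationAdjunction J A).homEquiv P F).symm f) := by
  rw [GrothendieckTopology.W_iff] at hf
  rw [Adjunction.homEquiv_counit]
  infer_instance

/-- The forgetful functor to sheaves of abelian groups reflects isomorphisms. There the transpose is
the sheafification of a locally bijective map followed by the counit at a sheaf, and both are
invertible. -/
theorem isIso_sheafificationHomEquiv_symm {C : Type*} [Category* C] {J : GrothendieckTopology C}
    {R₀ : Cᵒᵖ ⥤ RingCat.{u}} {R : Sheaf J RingCat.{u}} (α : R₀ ⟶ R.obj)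
    [Presheaf.IsLocallyInjective J α] [Presheaf.IsLocallySurjective J α]
    [J.WEqualsLocallyBijective AddCommGrpCat.{u}] [HasWeakSheafify J AddCommGrpCat.{u}]
    {P : PresheafOfModules.{u} R₀} {F : SheafOfModules.{u} R}
    (g : P ⟶ (PresheafOfModules.restrictScalars α).obj ((SheafOfModules.forget _).obj F))
    [Presheaf.IsLocallyInjective J ((PresheafOfModules.toPresheaf _).map g)]
    [Presheaf.IsLocallySurjective J ((PresheafOfModules.toPresheaf _).map g)] :
    IsIso ((PresheafOfModules.sheafificationHomEquiv α).symm g) := by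
  have hW := J.W_of_isLocallyBijective ((PresheafOfModules.toPresheaf _).map g)
  have : IsIso ((SheafOfModules.toSheaf _).map
      ((PresheafOfModules.sheafificationHomEquiv α).symm g)) := by
    rw [PresheafOfModules.toSheaf_map_sheafificationHomEquiv_symm]
    exact isIso_sheafificationAdjunction_homEquiv_symm (F := (SheafOfModules.toSheaf R).obj F) _ hW
  exact isIso_of_reflects_iso _ (SheafOfModules.toSheaf R)

/-! ### Tensor products of sheaves of modules -/

section TensorProducts

variable {X : Scheme.{u}}

/-- A morphism of sheaves of modules, given by its effect on sections. -/
noncomputable def homOfSections {M N : X.Modules} (φ : ∀ U : X.Opens, Γ(M, U) →ₗ[Γ(X, U)] Γ(N, U))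
    (h : ∀ (U V : X.Opens) (i : V ⟶ U) (m : Γ(M, U)),
      φ V (M.presheaf.map i.op m) = N.presheaf.map i.op (φ U m)) : M ⟶ N :=
  ⟨PresheafOfModules.homMk (R := X.ringCatSheaf.obj) (M₁ := M.val) (M₂ := N.val)
    { app := fun U => AddCommGrpCat.ofHom (φ U.unop).toAddMonoidHom
      naturality := fun U V i => by
        ext m
        exact h U.unop V.unop i.unop m }
    fun U r m => (φ U.unop).map_smul r m⟩

theorem isIso_of_bijective {M N : X.Modules} (f : M ⟶ N)
    (h : ∀ U, Function.Bijective (f.app U)) : IsIso f := by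
  rw [Scheme.Modules.Hom.isIso_iff_isIso_app]
  intro U
  exact (ConcreteCategory.isIso_iff_bijective _).2 (h U)

theorem nonempty_iso_of_bijective {M N : X.Modules}
    (φ : ∀ U : X.Opens, Γ(M, U) →ₗ[Γ(X, U)] Γ(N, U))
    (h : ∀ (U V : X.Opens) (i : V ⟶ U) (m : Γ(M, U)),
      φ V (M.presheaf.map i.op m) = N.presheaf.map i.op (φ U m))
    (hφ : ∀ U, Function.Bijective (φ U)) : Nonempty (M ≅ N) :=
  have := isIso_of_bijective (homOfSections φ h) hφ
  ⟨asIso (homOfSections φ h)⟩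

theorem tensor_congr {M M' N N' : X.Modules} (e : M ≅ M') (e' : N ≅ N') :
    Nonempty (tensor M N ≅ tensor M' N') := by
  let a := (Scheme.Modules.toPresheafOfModules X).mapIso e
  let a' := (Scheme.Modules.toPresheafOfModules X).mapIso e'
  refine ⟨(PresheafOfModules.sheafification (𝟙 X.ringCatSheaf.obj)).mapIso
    (MonoidalCategory.tensorIso (C := PresheafOfModules.{u} (X.presheaf ⋙ forget₂ _ _)) a a')⟩

/-- The section `m` of `M` over `U` freely generates the restriction of `M` to `U`. -/
def IsGenerator {M : X.Modules} {U : X.Opens} (m : Γ(M, U)) : Prop :=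
  ∀ (V : X.Opens) (i : V ⟶ U),
    Function.Bijective fun r : Γ(X, V) => r • M.presheaf.map i.op m

open scoped TensorProduct

/-- The morphism of presheaves of modules given by a bilinear map on sections. -/
noncomputable def tensorDesc {M N L : X.Modules}
    (β : ∀ U : X.Opens, Γ(M, U) →ₗ[Γ(X, U)] Γ(N, U) →ₗ[Γ(X, U)] Γ(L, U))
    (h : ∀ (U V : X.Opens) (i : V ⟶ U) (m : Γ(M, U)) (n : Γ(N, U)),
      β V (M.presheaf.map i.op m) (N.presheaf.map i.op n) = L.presheaf.map i.op (β U m n)) :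
    PresheafOfModules.Monoidal.tensorObj (R := X.presheaf) M.val N.val ⟶
      (PresheafOfModules.restrictScalars (𝟙 X.ringCatSheaf.obj)).obj
        ((SheafOfModules.forget _).obj L) where
  app U := ModuleCat.ofHom (R := Γ(X, U.unop)) (X := Γ(M, U.unop) ⊗[Γ(X, U.unop)] Γ(N, U.unop))
    (Y := Γ(L, U.unop)) (TensorProduct.lift (β U.unop))
  naturality {U V} i := by
    refine ModuleCat.MonoidalCategory.tensor_ext (R := Γ(X, U.unop)) fun m n => ?_
    exact h U.unop V.unop i.unop m n

/-- Over V both factors are free of rank one, so every tensor is a multiple of the tensor of the two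
generators, which is sent to a free generator. -/
theorem bijective_lift_of_isGenerator {M N L : X.Modules}
    {β : ∀ U : X.Opens, Γ(M, U) →ₗ[Γ(X, U)] Γ(N, U) →ₗ[Γ(X, U)] Γ(L, U)}
    (h : ∀ (U V : X.Opens) (i : V ⟶ U) (m : Γ(M, U)) (n : Γ(N, U)),
      β V (M.presheaf.map i.op m) (N.presheaf.map i.op n) = L.presheaf.map i.op (β U m n))
    {U V : X.Opens} {m : Γ(M, U)} {n : Γ(N, U)} (hm : IsGenerator m) (hn : IsGenerator n)
    (hl : IsGenerator (β U m n)) (i : V ⟶ U) :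
    Function.Bijective (TensorProduct.lift (β V)) := by
  have key : ∀ r : Γ(X, V), TensorProduct.lift (β V)
      (r • (M.presheaf.map i.op m ⊗ₜ N.presheaf.map i.op n)) = r • L.presheaf.map i.op (β U m n) :=
    fun r => by rw [map_smul, TensorProduct.lift.tmul, h]
  have hs : ∀ t : Γ(M, V) ⊗[Γ(X, V)] Γ(N, V), ∃ r : Γ(X, V),
      r • (M.presheaf.map i.op m ⊗ₜ N.presheaf.map i.op n) = t := by
    intro t
    induction t using TensorProduct.induction_on with
    | zero => exact ⟨0, zero_smul _ _⟩
    | tmul a b =>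
      obtain ⟨r, rfl⟩ := (hm V i).2 a
      obtain ⟨s, rfl⟩ := (hn V i).2 b
      refine ⟨r * s, ?_⟩
      change _ = (r • M.presheaf.map i.op m) ⊗ₜ[Γ(X, V)] (s • N.presheaf.map i.op n)
      rw [mul_smul, TensorProduct.tmul_smul, ← TensorProduct.smul_tmul', smul_comm]
    | add a b ha hb =>
      obtain ⟨r, rfl⟩ := ha
      obtain ⟨s, rfl⟩ := hb
      exact ⟨r + s, add_smul _ _ _⟩
  constructor
  · intro s t hst
    obtain ⟨r, rfl⟩ := hs s
    obtain ⟨r', rfl⟩ := hs t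
    rw [key, key] at hst
    rw [(hl V i).1 hst]
  · intro l
    obtain ⟨r, rfl⟩ := (hl V i).2 l
    exact ⟨_, key r⟩

/-- The map on the presheaf tensor product need only be bijective on small opens; sheafification
turns it into an isomorphism. -/
theorem nonempty_tensor_iso {M N L : X.Modules}
    (β : ∀ U : X.Opens, Γ(M, U) →ₗ[Γ(X, U)] Γ(N, U) →ₗ[Γ(X, U)] Γ(L, U))
    (h : ∀ (U V : X.Opens) (i : V ⟶ U) (m : Γ(M, U)) (n : Γ(N, U)),
      β V (M.presheaf.map i.op m) (N.presheaf.map i.op n) = L.presheaf.map i.op (β U m n))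
    (hβ : ∀ x : X, ∃ (U : X.Opens) (_ : x ∈ U) (m : Γ(M, U)) (n : Γ(N, U)),
      IsGenerator m ∧ IsGenerator n ∧ IsGenerator (β U m n)) :
    Nonempty (tensor M N ≅ L) := by
  let g := tensorDesc β h
  have key : ∀ x : X, ∃ (U : X.Opens) (_ : x ∈ U), ∀ V ≤ U,
      Function.Bijective (TensorProduct.lift (β V)) := by
    intro x
    obtain ⟨U, hx, m, n, hm, hn, hl⟩ := hβ x
    exact ⟨U, hx, fun V hV => bijective_lift_of_isGenerator h hm hn hl (homOfLE hV)⟩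
  have hinj : Presheaf.IsLocallyInjective (Opens.grothendieckTopology X)
      ((PresheafOfModules.toPresheaf X.ringCatSheaf.obj).map g) := by
    constructor
    intro U a b hab x hx
    obtain ⟨U₀, hx₀, hU₀⟩ := key x
    refine ⟨U.unop ⊓ U₀, homOfLE inf_le_left, ?_, ⟨hx, hx₀⟩⟩
    refine (hU₀ (U.unop ⊓ U₀) inf_le_right).1 ?_
    let f := (PresheafOfModules.toPresheaf X.ringCatSheaf.obj).map g
    let i : U.unop ⊓ U₀ ⟶ U.unop := homOfLE inf_le_left
    have hn := f.naturality i.op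
    have h1 := ConcreteCategory.congr_hom hn a
    have h2 := ConcreteCategory.congr_hom hn b
    have h3 : (f.app U ≫ ((PresheafOfModules.toPresheaf X.ringCatSheaf.obj).obj
      ((PresheafOfModules.restrictScalars (𝟙 X.ringCatSheaf.obj)).obj
        ((SheafOfModules.forget _).obj L))).map i.op) a = (f.app U ≫ ((PresheafOfModules.toPresheaf X.ringCatSheaf.obj).obj
      ((PresheafOfModules.restrictScalars (𝟙 X.ringCatSheaf.obj)).obj
        ((SheafOfModules.forget _).obj L))).map i.op) b := by
      rw [ConcreteCategory.comp_apply, ConcreteCategory.comp_apply]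
      exact congrArg _ hab
    exact h1.trans (h3.trans h2.symm)
  have hsurj : Presheaf.IsLocallySurjective (Opens.grothendieckTopology X)
      ((PresheafOfModules.toPresheaf X.ringCatSheaf.obj).map g) := by
    constructor
    intro U l x hx
    obtain ⟨U₀, hx₀, hU₀⟩ := key x
    refine ⟨U ⊓ U₀, homOfLE inf_le_left, ?_, ⟨hx, hx₀⟩⟩
    exact (hU₀ (U ⊓ U₀) inf_le_right).2 (L.presheaf.map (homOfLE inf_le_left).op l)
  let G : tensor M N ⟶ L := (PresheafOfModules.sheafificationHomEquiv (𝟙 X.ringCatSheaf.obj)).symm g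
  have : IsIso G := isIso_sheafificationHomEquiv_symm (𝟙 X.ringCatSheaf.obj) g
  exact ⟨asIso G⟩

end TensorProducts

noncomputable section

/-! ### Subsheaves of the constant sheaf of rational functions -/

section LatticeSheaves

variable {C : Scheme.{u}} [IsIntegral C]
  (J : ∀ x : C, Submodule (C.presheaf.stalk x) C.functionField)

/-- The functions that are constant, with value in `J x` for all `x`. -/
def latticePredicate : TopCat.LocalPredicate (fun _ : C => (C.functionField : Type u)) where
  pred {U} s := (∀ x y : U, s x = s y) ∧ ∀ x : U, s x ∈ J x
  res i _ h := ⟨fun _ _ => h.1 _ _, fun x => h.2 (i x)⟩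
  locality {U} s h := by
    refine ⟨fun x y => ?_, fun x => ?_⟩
    · obtain ⟨V, hxV, i, hV, -⟩ := h x
      obtain ⟨W, hyW, j, hW, -⟩ := h y
      obtain ⟨z, -, hzV, hzW⟩ :=
        (IrreducibleSpace.isIrreducible_univ C).2 V W V.2 W.2 ⟨x, trivial, hxV⟩
          ⟨y, trivial, hyW⟩
      exact (hV ⟨x, hxV⟩ ⟨z, hzV⟩).trans (hW ⟨z, hzW⟩ ⟨y, hyW⟩)
    · obtain ⟨V, hxV, i, -, hV⟩ := h x
      exact hV ⟨x, hxV⟩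

/-- The group of sections of the sheaf with stalks `J x`. -/
def latticeSections (U : C.Opens) : AddSubgroup (U → C.functionField) where
  carrier := {s | (latticePredicate J).pred s}
  add_mem' hs ht := ⟨fun x y => congrArg₂ (· + ·) (hs.1 x y) (ht.1 x y),
    fun x => add_mem (hs.2 x) (ht.2 x)⟩
  zero_mem' := ⟨fun _ _ => rfl, fun _ => zero_mem _⟩
  neg_mem' hs := ⟨fun x y => congrArg Neg.neg (hs.1 x y), fun x => neg_mem (hs.2 x)⟩

theorem germ_smul_eq_germ_smul {U : C.Opens} (a : Γ(C, U)) (x y : U) (w : C.functionField) :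
    C.presheaf.germ U x x.2 a • w = C.presheaf.germ U y y.2 a • w := by
  have : Nonempty U := ⟨x⟩
  rw [Algebra.smul_def, Algebra.smul_def, Scheme.algebraMap_germ_eq_germToFunctionField,
    Scheme.algebraMap_germ_eq_germToFunctionField]

instance (U : C.Opens) : Module Γ(C, U) (latticeSections J U) where
  smul a s := ⟨fun x => C.presheaf.germ U x x.2 a • s.1 x,
    fun x y => by
      change _ • s.1 x = _ • s.1 y
      rw [s.2.1 x y]
      exact germ_smul_eq_germ_smul a x y _,
    fun x => Submodule.smul_mem _ _ (s.2.2 x)⟩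
  one_smul s := Subtype.ext <| funext fun x => by
    change C.presheaf.germ U x x.2 1 • s.1 x = s.1 x
    rw [map_one, one_smul]
  mul_smul a b s := Subtype.ext <| funext fun x => by
    change C.presheaf.germ U x x.2 (a * b) • s.1 x =
      C.presheaf.germ U x x.2 a • C.presheaf.germ U x x.2 b • s.1 x
    rw [map_mul, mul_smul]
  smul_zero a := Subtype.ext <| funext fun x => smul_zero (C.presheaf.germ U x x.2 a)
  smul_add a s t := Subtype.ext <| funext fun x =>
    smul_add (C.presheaf.germ U x x.2 a) (s.1 x) (t.1 x)
  add_smul a b s := Subtype.ext <| funext fun x => by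
    change C.presheaf.germ U x x.2 (a + b) • s.1 x =
      C.presheaf.germ U x x.2 a • s.1 x + C.presheaf.germ U x x.2 b • s.1 x
    rw [map_add, add_smul]
  zero_smul s := Subtype.ext <| funext fun x => by
    change C.presheaf.germ U x x.2 0 • s.1 x = 0
    rw [map_zero, zero_smul]

/-- The presheaf of abelian groups of sections of the sheaf with stalks `J x`. -/
def latticePresheaf : TopCat.Presheaf Ab.{u} C where
  obj U := AddCommGrpCat.of (latticeSections J U.unop)
  map i := AddCommGrpCat.ofHom
    { toFun := fun s => ⟨fun x => s.1 (i.unop x), (latticePredicate J).res i.unop s.1 s.2⟩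
      map_zero' := rfl
      map_add' := fun _ _ => rfl }

instance (U : (Opens C)ᵒᵖ) :
    Module (C.ringCatSheaf.obj.obj U) ((latticePresheaf J).obj U) :=
  inferInstanceAs (Module Γ(C, U.unop) (latticeSections J U.unop))

/-- The subsheaf of the constant sheaf of rational functions with stalks `J x`. -/
def latticeSheaf : C.Modules where
  val := PresheafOfModules.ofPresheaf (R := C.ringCatSheaf.obj) (latticePresheaf J)
    fun U V i a s => Subtype.ext <| funext fun x => by
      change C.presheaf.germ U.unop (i.unop x) (i.unop x).2 a • s.1 (i.unop x) =
        C.presheaf.germ V.unop x x.2 (C.presheaf.map i a) • s.1 (i.unop x)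
      congr 1
      exact (C.presheaf.germ_res_apply i.unop x.1 x.2 a).symm
  isSheaf := (TopCat.Presheaf.isSheaf_iff_isSheaf_comp (forget AddCommGrpCat)
      (latticePresheaf J)).2 (TopCat.subpresheafToTypes.isSheaf (latticePredicate J))

/-- The value of a section of the lattice sheaf. -/
def latticeValue {U : C.Opens} (s : Γ(latticeSheaf J, U)) : latticeSections J U := s

variable {J}

theorem latticeValue_injective {U : C.Opens} :
    Function.Injective (latticeValue J (U := U)) := fun _ _ h => h

/-- A constant section of the lattice sheaf. -/
def latticeConst {U : C.Opens} (w : C.functionField) (h : ∀ x : U, w ∈ J x) :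
    Γ(latticeSheaf J, U) :=
  (⟨fun _ => w, fun _ _ => rfl, h⟩ : latticeSections J U)

/-- A rational function that is regular on `U` comes from a section over `U`. -/
theorem exists_germ_eq_of_forall_mem_range {U : C.Opens} (w : C.functionField)
    (h : ∀ x : U, w ∈ (algebraMap (C.presheaf.stalk x.1) C.functionField).range) :
    ∃ a : Γ(C, U), ∀ x : U, algebraMap (C.presheaf.stalk x.1) C.functionField
      (C.presheaf.germ U x x.2 a) = w := by
  have h' : ∀ x : U, ∃ (V : C.Opens) (_ : x.1 ∈ V) (_ : V ≤ U) (a : Γ(C, V)),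
      ∀ y (hy : y ∈ V), algebraMap (C.presheaf.stalk y) C.functionField
        (C.presheaf.germ V y hy a) = w := by
    intro x
    obtain ⟨r, hr⟩ := h x
    obtain ⟨V, hxV, a, rfl⟩ := C.presheaf.exists_germ_eq r
    refine ⟨V ⊓ U, ⟨hxV, x.2⟩, inf_le_right, C.presheaf.map (homOfLE inf_le_left).op a, ?_⟩
    intro y hy
    have : Nonempty V := ⟨⟨y, hy.1⟩⟩
    rw [TopCat.Presheaf.germ_res_apply', Scheme.algebraMap_germ_eq_germToFunctionField, ← hr,
      Scheme.algebraMap_germ_eq_germToFunctionField]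
  choose V hxV hVU a ha using h'
  obtain ⟨s, hs, -⟩ := C.sheaf.existsUnique_gluing' V U (fun x => homOfLE (hVU x))
    (fun x hx => Opens.mem_iSup.2 ⟨⟨x, hx⟩, hxV _⟩) a (by
      intro x y
      by_cases hne : Nonempty (V x ⊓ V y : C.Opens)
      · obtain ⟨z, hz⟩ := hne
        refine germ_injective_of_isIntegral C z hz ?_
        refine IsFractionRing.injective (C.presheaf.stalk z) C.functionField ?_
        have h1 := C.presheaf.germ_res_apply (Opens.infLELeft (V x) (V y)) z hz (a x)
        have h2 := C.presheaf.germ_res_apply (Opens.infLERight (V x) (V y)) z hz (a y)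
        erw [h1, h2]
        rw [ha x z hz.1, ha y z hz.2]
      · have he : V x ⊓ V y = ⊥ := by
          ext z
          exact ⟨fun hz => hne ⟨⟨z, hz⟩⟩, fun hz => hz.elim⟩
        have : Subsingleton Γ(C, V x ⊓ V y) := by
          rw [he]
          infer_instance
        exact Subsingleton.elim (α := Γ(C, V x ⊓ V y)) _ _)
  refine ⟨s, fun x => ?_⟩
  rw [← ha x x.1 (hxV x), ← hs x]
  congr 1
  exact (C.presheaf.germ_res_apply (homOfLE (hVU x)) x.1 (hxV x) s).symm

theorem exists_smul_eq_of_forall_mem_span {U : C.Opens} {w g : C.functionField} (hg : g ≠ 0)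
    (h : ∀ x : U, w ∈ Submodule.span (C.presheaf.stalk x.1) {g}) :
    ∃ a : Γ(C, U), ∀ x : U, C.presheaf.germ U x x.2 a • g = w := by
  obtain ⟨a, ha⟩ := exists_germ_eq_of_forall_mem_range (U := U) (w * g⁻¹) fun x => by
    obtain ⟨r, hr⟩ := Submodule.mem_span_singleton.1 (h x)
    refine ⟨r, ?_⟩
    rw [← hr, Algebra.smul_def, mul_inv_cancel_right₀ hg]
  refine ⟨a, fun x => ?_⟩
  rw [Algebra.smul_def, ha, inv_mul_cancel_right₀ hg]

theorem section_eq_of_germ_smul_eq {U : C.Opens} {g : C.functionField} (hg : g ≠ 0) {a b : Γ(C, U)}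
    (h : ∀ x : U, C.presheaf.germ U x x.2 a • g = C.presheaf.germ U x x.2 b • g) : a = b := by
  by_cases hU : Nonempty U
  · obtain ⟨x⟩ := hU
    refine germ_injective_of_isIntegral C x.1 x.2 ?_
    refine IsFractionRing.injective (C.presheaf.stalk x.1) C.functionField ?_
    have := h x
    rw [Algebra.smul_def, Algebra.smul_def] at this
    exact mul_right_cancel₀ hg this
  · have he : U = ⊥ := by
      ext z
      exact ⟨fun hz => hU ⟨⟨z, hz⟩⟩, fun hz => hz.elim⟩
    have : Subsingleton Γ(C, U) := by
      rw [he]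
      infer_instance
    exact Subsingleton.elim _ _

/-- For a section with value w, the quotient w / g lies in every local ring of V, so it is the image
of a section of the structure sheaf, which is unique since all germs embed in the function field. -/
theorem isGenerator_latticeConst {U : C.Opens} {g : C.functionField} (hg : g ≠ 0)
    (h : ∀ x : U, J x = Submodule.span _ {g}) :
    IsGenerator (latticeConst (J := J) (U := U) g
      fun x => h x ▸ Submodule.mem_span_singleton_self g) := by
  intro V i
  constructor
  · intro a b hab
    refine section_eq_of_germ_smul_eq hg fun x => ?_
    exact congrFun (congrArg Subtype.val (congrArg (latticeValue J) hab)) x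
  · intro s
    by_cases hV : Nonempty V
    · obtain ⟨y⟩ := hV
      obtain ⟨a, ha⟩ := exists_smul_eq_of_forall_mem_span (U := V) (w := (latticeValue J s).1 y)
        hg fun x => by
          have h1 := (latticeValue J s).2.2 x
          rw [(latticeValue J s).2.1 x y] at h1
          exact (h (i x)).le h1
      refine ⟨a, latticeValue_injective (Subtype.ext (funext fun x => ?_))⟩
      exact (ha x).trans ((latticeValue J s).2.1 y x)
    · exact ⟨0, latticeValue_injective (Subtype.ext (funext fun x => (hV ⟨x⟩).elim))⟩

variable (J) in
/-- The family `J` is locally generated by one rational function. -/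
def IsLocallyPrincipal : Prop :=
  ∀ x : C, ∃ (U : C.Opens) (_ : x ∈ U) (g : C.functionField), g ≠ 0 ∧
    ∀ y : U, J y = Submodule.span _ {g}

theorem isLocallyPrincipal_one :
    IsLocallyPrincipal (C := C) (fun x => (1 : Submodule (C.presheaf.stalk x) C.functionField)) :=
  fun _ => ⟨⊤, trivial, 1, one_ne_zero, fun _ => Submodule.one_eq_span⟩

theorem IsLocallyPrincipal.mul {J' : ∀ x : C, Submodule (C.presheaf.stalk x) C.functionField}
    (h : IsLocallyPrincipal J) (h' : IsLocallyPrincipal J') :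
    IsLocallyPrincipal (fun x => J x * J' x) := by
  intro x
  obtain ⟨U, hx, g, hg, hU⟩ := h x
  obtain ⟨U', hx', g', hg', hU'⟩ := h' x
  refine ⟨U ⊓ U', ⟨hx, hx'⟩, g * g', mul_ne_zero hg hg', fun y => ?_⟩
  change J y.1 * J' y.1 = _
  rw [hU ⟨y, y.2.1⟩, hU' ⟨y, y.2.2⟩, Submodule.span_mul_span, Set.singleton_mul_singleton]

/-- The product of sections. -/
def latticeMul (J J' : ∀ x : C, Submodule (C.presheaf.stalk x) C.functionField) (U : C.Opens) :
    Γ(latticeSheaf J, U) →ₗ[Γ(C, U)] Γ(latticeSheaf J', U) →ₗ[Γ(C, U)]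
      Γ(latticeSheaf fun x => J x * J' x, U) :=
  LinearMap.mk₂ _ (fun s t => (⟨fun x => (latticeValue J s).1 x * (latticeValue J' t).1 x,
      fun x y => congrArg₂ (· * ·) ((latticeValue J s).2.1 x y) ((latticeValue J' t).2.1 x y),
      fun x => Submodule.mul_mem_mul ((latticeValue J s).2.2 x) ((latticeValue J' t).2.2 x)⟩ :
        latticeSections (fun x => J x * J' x) U))
    (fun _ _ _ => Subtype.ext (funext fun _ => add_mul _ _ _))
    (fun _ _ _ => Subtype.ext (funext fun _ => smul_mul_assoc _ _ _))
    (fun _ _ _ => Subtype.ext (funext fun _ => mul_add _ _ _))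
    (fun _ _ _ => Subtype.ext (funext fun _ => mul_smul_comm _ _ _))

/-- Multiplication of rational functions is bilinear, and local generators g and g' have the local
generator g g' as product. -/
theorem nonempty_tensor_latticeSheaf_iso
    {J' : ∀ x : C, Submodule (C.presheaf.stalk x) C.functionField}
    (h : IsLocallyPrincipal J) (h' : IsLocallyPrincipal J') :
    Nonempty (tensor (latticeSheaf J) (latticeSheaf J') ≅ latticeSheaf fun x => J x * J' x) := by
  refine nonempty_tensor_iso (latticeMul J J') (fun U V i m n => rfl) fun x => ?_
  obtain ⟨U, hx, g, hg, hU⟩ := h x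
  obtain ⟨U', hx', g', hg', hU'⟩ := h' x
  refine ⟨U ⊓ U', ⟨hx, hx'⟩, _, _,
    isGenerator_latticeConst (J := J) (U := U ⊓ U') hg fun y => hU ⟨y.1, y.2.1⟩,
    isGenerator_latticeConst (J := J') (U := U ⊓ U') hg' fun y => hU' ⟨y.1, y.2.2⟩, ?_⟩
  exact isGenerator_latticeConst (J := fun x => J x * J' x) (mul_ne_zero hg hg')
    fun y : (U ⊓ U' : C.Opens) => by
    rw [hU ⟨y, y.2.1⟩, hU' ⟨y, y.2.2⟩, Submodule.span_mul_span, Set.singleton_mul_singleton]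

theorem nonempty_unit_iso : Nonempty ((SheafOfModules.unit C.ringCatSheaf : C.Modules) ≅
    latticeSheaf fun x => (1 : Submodule (C.presheaf.stalk x) C.functionField)) := by
  let J₁ : ∀ x : C, Submodule (C.presheaf.stalk x) C.functionField := fun _ => 1
  have h1 : ∀ (U : C.Opens) (x : U), (1 : C.functionField) ∈ J₁ x := fun U x => Submodule.one_le.1 le_rfl
  have hgen : ∀ U : C.Opens, IsGenerator (latticeConst (J := J₁) (U := U) 1 (h1 U)) := fun U =>
    isGenerator_latticeConst one_ne_zero fun x => Submodule.one_eq_span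
  refine nonempty_iso_of_bijective (M := (SheafOfModules.unit C.ringCatSheaf : C.Modules))
    (fun U => (LinearMap.toSpanSingleton Γ(C, U) Γ(latticeSheaf J₁, U)
      (latticeConst 1 (h1 U)) : Γ(C, U) →ₗ[Γ(C, U)] _)) (fun U V i a => ?_) fun U => ?_
  · exact ((latticeSheaf J₁).map_smul i a (latticeConst 1 (h1 U))).symm
  · have := hgen U U (𝟙 U)
    exact this

/-- The isomorphism is multiplication by the global rational function g. -/
theorem nonempty_latticeSheaf_iso_of_smul
    {J' : ∀ x : C, Submodule (C.presheaf.stalk x) C.functionField} {g : C.functionField}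
    (hg : g ≠ 0) (h : ∀ x w, g * w ∈ J' x ↔ w ∈ J x) :
    Nonempty (latticeSheaf J ≅ latticeSheaf J') := by
  refine nonempty_iso_of_bijective (fun U =>
    { toFun := fun s => (⟨fun x => g * (latticeValue J s).1 x,
        fun x y => congrArg (g * ·) ((latticeValue J s).2.1 x y),
        fun x => (h x _).2 ((latticeValue J s).2.2 x)⟩ : latticeSections J' U)
      map_add' := fun s t => Subtype.ext (funext fun x => mul_add _ _ _)
      map_smul' := fun a s => Subtype.ext (funext fun x => mul_smul_comm _ _ _) })
    (fun U V i m => rfl) fun U => ⟨fun s t hst => ?_, fun t => ?_⟩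
  · refine Subtype.ext (funext fun x => ?_)
    exact mul_left_cancel₀ hg (congrFun (congrArg Subtype.val hst) x)
  · refine ⟨(⟨fun x => g⁻¹ * (latticeValue J' t).1 x,
      fun x y => congrArg (g⁻¹ * ·) ((latticeValue J' t).2.1 x y), fun x => (h x _).1 ?_⟩ :
        latticeSections J U), Subtype.ext (funext fun x => ?_)⟩
    · rw [mul_inv_cancel_left₀ hg]
      exact (latticeValue J' t).2.2 x
    · exact mul_inv_cancel_left₀ hg _

end LatticeSheaves

/-! ### Specialization maps between stalks -/

section Specialization

variable {X : Scheme.{u}} (F : X.Modules)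

theorem exists_germ_eq_germ_eq (x : X) (r : X.presheaf.stalk x) (m : StalkAt F x) :
    ∃ (U : X.Opens) (hx : x ∈ U) (a : Γ(X, U)) (s : Γ(F, U)),
      X.presheaf.germ U x hx a = r ∧ F.presheaf.germ U x hx s = m := by
  obtain ⟨U, hU, r, rfl⟩ := X.presheaf.exists_germ_eq r
  obtain ⟨V, hV, m, rfl⟩ := F.presheaf.exists_germ_eq m
  exact ⟨U ⊓ V, ⟨hU, hV⟩, X.presheaf.map (Opens.infLELeft U V).op r,
    F.presheaf.map (Opens.infLERight U V).op m, X.presheaf.germ_res_apply _ _ _ _,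
    F.presheaf.germ_res_apply _ _ _ _⟩

/-- The specialization map `F_x → F_y`, for a specialization `x` of `y`. -/
def specializeStalk {x y : X} (h : y ⤳ x) :
    StalkAt F x →ₛₗ[(X.presheaf.stalkSpecializes h).hom] StalkAt F y where
  toFun := F.presheaf.stalkSpecializes h
  map_add' := map_add _
  map_smul' r m := by
    obtain ⟨U, hU, r, m, rfl, rfl⟩ := exists_germ_eq_germ_eq F x r m
    have h1 := X.presheaf.germ_stalkSpecializes_apply hU h r
    have h2 := F.presheaf.germ_stalkSpecializes_apply hU h m
    have h3 := F.presheaf.germ_stalkSpecializes_apply hU h (r • m)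
    rw [germ_smul_stalk, germ_smul_stalk] at h3
    refine h3.trans ?_
    rw [← h1, ← h2]

theorem specializeStalk_germ {x y : X} (h : y ⤳ x) {U : X.Opens} (hx : x ∈ U) (m : Γ(F, U)) :
    specializeStalk F h (F.presheaf.germ U x hx m) =
      F.presheaf.germ U y (h.mem_open U.2 hx) m :=
  F.presheaf.germ_stalkSpecializes_apply hx h m

end Specialization

/-! ### The determinant of a sheaf as a family of fractional ideals -/

section Determinant

variable {C : Scheme.{u}} [IsIntegral C] (F : C.Modules)

/-- The map `F_x → F_η`. -/
def stalkToGeneric (x : C) : StalkAt F x →ₛₗ[algebraMap (C.presheaf.stalk x) C.functionField]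
    StalkAt F (genericPoint C) :=
  specializeStalk F ((genericPoint_spec C).specializes trivial)

end Determinant

open Module in
/-- The determinant of a basis, as a linear map on the top exterior power. -/
def topWedgeEquiv {K W : Type*} [Field K] [AddCommGroup W] [Module K W] {n : ℕ}
    (b : Basis (Fin n) K W) : ⋀[K]^n W ≃ₗ[K] K :=
  LinearEquiv.ofLinearMap (exteriorPower.alternatingMapLinearEquiv b.det)
    (LinearMap.toSpanSingleton K _ (exteriorPower.ιMulti K n b))
    (by
      ext
      simp [exteriorPower.alternatingMapLinearEquiv_apply_ιMulti, Basis.det_self])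
    (by
      -- An alternating map is determined by its values on injective tuples of basis vectors. With
      -- as many slots as basis vectors these are permutations of the basis, which both sides
      -- transform by the sign.
      refine exteriorPower.linearMap_ext (Basis.ext_alternating b fun v hv => ?_)
      obtain ⟨σ, rfl⟩ : ∃ σ : Equiv.Perm (Fin n), ⇑σ = v :=
        ⟨Equiv.ofBijective v (Finite.injective_iff_bijective.1 hv), rfl⟩
      change exteriorPower.alternatingMapLinearEquiv b.det (exteriorPower.ιMulti K n (b ∘ σ)) • exteriorPower.ιMulti K n b = exteriorPower.ιMulti K n (b ∘ σ)
      rw [exteriorPower.alternatingMapLinearEquiv_apply_ιMulti, AlternatingMap.map_perm,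
        AlternatingMap.map_perm, Basis.det_self, Units.smul_def,
        Units.smul_def]
      simpa using Int.cast_smul_eq_zsmul K (σ.sign : ℤ) (exteriorPower.ιMulti K n b))

open Module in
theorem topWedgeEquiv_ιMulti {K W : Type*} [Field K] [AddCommGroup W] [Module K W] {n : ℕ}
    (b : Basis (Fin n) K W) (v : Fin n → W) :
    topWedgeEquiv b (exteriorPower.ιMulti K n v) = b.det v :=
  exteriorPower.alternatingMapLinearEquiv_apply_ιMulti _ _

section Determinant

variable {C : Scheme.{u}} [IsIntegral C] (F : C.Modules)
  (b : Module.Basis (Fin (genericRank F)) C.functionField (StalkAt F (genericPoint C)))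

/-- The isomorphism from the top exterior power of `F_η` to the function field. -/
def topWedgeCoord : TopWedge F ≃ₗ[C.functionField] C.functionField := topWedgeEquiv b

theorem topWedgeCoord_smul (x : C) (a : C.presheaf.stalk x) (w : TopWedge F) :
    topWedgeCoord F b (a • w) = a • topWedgeCoord F b w :=
  ((topWedgeCoord F b).map_smul (algebraMap (C.presheaf.stalk x) C.functionField a) w).trans
    (Algebra.smul_def _ _).symm

theorem topWedgeCoord_mem_wedgeCoord_iff (x : C) (w : TopWedge F) :
    topWedgeCoord F b w ∈ wedgeCoord (stalkToGeneric F x) b ↔ w ∈ wedgeLattice F x := by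
  let e : TopWedge F →ₗ[C.presheaf.stalk x] C.functionField :=
    { toFun := topWedgeCoord F b
      map_add' := map_add _
      map_smul' := topWedgeCoord_smul F b x }
  have he : wedgeCoord (stalkToGeneric F x) b = (wedgeLattice F x).map e := by
    rw [wedgeLattice, Submodule.map_span, wedgeCoord]
    congr 1
    refine (congrArg Set.range (funext fun s => ?_)).trans (Set.range_comp e _)
    exact (topWedgeEquiv_ιMulti b _).symm
  rw [he]
  constructor
  · rintro ⟨w', hw', hww⟩
    have : w' = w := (topWedgeCoord F b).injective hww
    exact this ▸ hw'
  · exact fun hw => ⟨w, hw, rfl⟩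

theorem topWedgeCoord_mem_detIdeal_iff (x : C) (w : TopWedge F) :
    topWedgeCoord F b w ∈ detIdeal (stalkToGeneric F x) b ↔ w ∈ detLattice F x := by
  refine forall₂_congr fun a _ => ?_
  rw [← topWedgeCoord_smul, topWedgeCoord_mem_wedgeCoord_iff]

/-- A basis of the generic stalk trivializes its top exterior power over K, and under this one
trivialization the stalk of det F at x goes to the determinant ideal at x, for all x at once. -/
theorem nonempty_det_iso :
    Nonempty (det F ≅ latticeSheaf fun x => detIdeal (stalkToGeneric F x) b) := by
  let e := topWedgeCoord F b
  let J : ∀ x : C, Submodule (C.presheaf.stalk x) C.functionField :=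
    fun x => detIdeal (stalkToGeneric F x) b
  have hJ := topWedgeCoord_mem_detIdeal_iff F b
  refine nonempty_iso_of_bijective (fun U =>
    ({ toFun := fun s => ⟨fun x => e (s.1 x), fun x y => congrArg e (s.2.1 x y),
        fun x => (hJ x _).2 (s.2.2 x)⟩
       map_add' := fun s t => Subtype.ext (funext fun x => map_add e _ _)
       map_smul' := fun a s => Subtype.ext (funext fun x => topWedgeCoord_smul F b x.1 _ _) } :
      detSections F U →ₗ[Γ(C, U)] latticeSections J U))
    (fun U V i m => rfl) fun U => ⟨fun s t hst => ?_, fun t => ?_⟩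
  · refine Subtype.ext (funext fun x => ?_)
    exact e.injective (congrFun (congrArg Subtype.val hst) x)
  · refine ⟨(⟨fun x => e.symm ((latticeValue J t).1 x),
      fun x y => congrArg e.symm ((latticeValue J t).2.1 x y), fun x => (hJ x _).1 ?_⟩ :
        detSections F U), Subtype.ext (funext fun x => ?_)⟩
    · change e (e.symm _) ∈ _
      rw [LinearEquiv.apply_symm_apply]
      exact (latticeValue J t).2.2 x
    · exact e.apply_symm_apply _

variable [∀ x : C, IsPrincipalIdealRing (C.presheaf.stalk x)]

/-- The family of the stalks of `F`. -/
def stalkFamily (h : ∀ x, IsLattice (stalkToGeneric F x)) :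
    LatticeFamily.{u} (fun x : C => (C.presheaf.stalk x : Type u)) C.functionField where
  N x := StalkAt F x
  W := StalkAt F (genericPoint C)
  φ := stalkToGeneric F
  isLattice := h
  finite := by
    obtain ⟨x⟩ : Nonempty C := inferInstance
    exact (h x).finite_space

/-- The sheaf with a given family of invertible stalks. -/
abbrev idealSheaf (J : IdealFamily (fun x : C => (C.presheaf.stalk x : Type u)) C.functionField) :
    C.Modules :=
  latticeSheaf fun x => (J x : Submodule (C.presheaf.stalk x) C.functionField)

theorem nonempty_det_iso_idealSheaf (h : ∀ x, IsLattice (stalkToGeneric F x)) :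
    Nonempty (det F ≅ idealSheaf ((stalkFamily F h).ideal
      (Module.finBasis C.functionField (stalkFamily F h).W))) :=
  nonempty_det_iso F (Module.finBasis C.functionField (stalkFamily F h).W)

/-- Equal classes mean that one rational function g multiplies the first family into the second. -/
theorem nonempty_idealSheaf_iso
    {J J' : IdealFamily (fun x : C => (C.presheaf.stalk x : Type u)) C.functionField}
    (h : (QuotientGroup.mk J : IdealClass _ _) = QuotientGroup.mk J') :
    Nonempty (idealSheaf J ≅ idealSheaf J') := by
  obtain ⟨g, hg⟩ := QuotientGroup.eq.1 h
  rw [eq_inv_mul_iff_mul_eq] at hg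
  refine nonempty_latticeSheaf_iso_of_smul (g := (g : C.functionField)) g.ne_zero fun x w => ?_
  rw [← hg, Pi.mul_apply, Units.val_mul, coe_principal, Submodule.mul_comm]
  rw [Submodule.mem_span_singleton_mul]
  constructor
  · rintro ⟨z, hz, hzw⟩
    rwa [← mul_left_cancel₀ g.ne_zero hzw]
  · exact fun hw => ⟨w, hw, rfl⟩

/-- Local principality is carried through the induction because each new tensor product needs local
generators of both factors. -/
theorem nonempty_tensorProd_iso {L : ℕ → C.Modules} {m : ℕ}
    {J : ℕ → IdealFamily (fun x : C => (C.presheaf.stalk x : Type u)) C.functionField}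
    (hL : ∀ j < m, Nonempty (L j ≅ idealSheaf (J j)))
    (hJ : ∀ j < m, IsLocallyPrincipal fun x => (J j x : Submodule _ C.functionField)) :
    Nonempty (tensorProd L m ≅ idealSheaf (∏ j ∈ Finset.range m, J j)) ∧
      IsLocallyPrincipal
        fun x => ((∏ j ∈ Finset.range m, J j) x : Submodule _ C.functionField) := by
  induction m with
  | zero => exact ⟨nonempty_unit_iso, isLocallyPrincipal_one⟩
  | succ m ih =>
    obtain ⟨⟨e⟩, h⟩ := ih (fun j hj => hL j (by omega)) fun j hj => hJ j (by omega)
    obtain ⟨e'⟩ := hL m (by omega)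
    have h' := hJ m (by omega)
    rw [Finset.prod_range_succ]
    obtain ⟨e₁⟩ := tensor_congr e e'
    obtain ⟨e₂⟩ := nonempty_tensor_latticeSheaf_iso h h'
    exact ⟨⟨e₁ ≪≫ e₂⟩, h.mul h'⟩

end Determinant

/-! ### Sections of quasi-coherent and coherent sheaves over affine opens -/

section Quasicoherent

variable {X : Scheme.{u}} (E : X.Modules)

/-- This reconciles two actions of Γ(X, U): through global sections of its spectrum, and by
restriction within X. -/
theorem fromSpec_appIso_inv {U : X.Opens} (hU : IsAffineOpen U)
    (V : (Spec Γ(X, U)).Opens) (r : Γ(X, U)) (h : hU.fromSpec ''ᵁ V ≤ U) :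
    (hU.fromSpec.appIso V).inv (((Spec Γ(X, U)).presheaf.map V.leTop.op)
      ((Scheme.ΓSpecIso Γ(X, U)).inv r)) = X.presheaf.map (homOfLE h).op r := by
  have key : (Scheme.ΓSpecIso Γ(X, U)).inv ≫ (Spec Γ(X, U)).presheaf.map V.leTop.op ≫
      (hU.fromSpec.appIso V).inv = X.presheaf.map (homOfLE h).op := by
    rw [← Category.assoc, Iso.comp_inv_eq, Scheme.Hom.appIso_hom', Scheme.Hom.map_appLE,
      Scheme.Hom.appLE, hU.fromSpec_app_self, Category.assoc, ← Functor.map_comp]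
    rfl
  rw [← key]
  rfl

variable {E} in
/-- A section of `E`, as a section of the restriction of `E` to an affine open. -/
def restrictSection {U : X.Opens} (hU : IsAffineOpen U) {V : (Spec Γ(X, U)).Opens}
    (x : Γ(E, hU.fromSpec ''ᵁ V)) : Γ(E.restrict hU.fromSpec, V) := x

theorem smul_restrictSection {U : X.Opens} (hU : IsAffineOpen U) (V : (Spec Γ(X, U)).Opens)
    (h : hU.fromSpec ''ᵁ V ≤ U) (r : Γ(X, U)) (x : Γ(E, hU.fromSpec ''ᵁ V)) :
    r • restrictSection hU x = restrictSection hU (X.presheaf.map (homOfLE h).op r • x) := by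
  rw [← fromSpec_appIso_inv hU V r h]
  rfl

variable {E}

/-- On the spectrum of Γ(X, U), the restriction of a quasi-coherent sheaf is associated with a
module, so its sections over a basic open are a localization. This is the surjectivity half, carried
back to X. -/
theorem exists_pow_smul_eq_map [E.IsQuasicoherent] {U : X.Opens}
    (hU : IsAffineOpen U) (f : Γ(X, U)) (t : Γ(E, X.basicOpen f)) :
    ∃ (n : ℕ) (m : Γ(E, U)), E.presheaf.map (homOfLE (X.basicOpen_le f)).op m =
      X.presheaf.map (homOfLE (X.basicOpen_le f)).op (f ^ n) • t := by
  let N : (Spec Γ(X, U)).Modules := E.restrict hU.fromSpec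
  have : N.IsQuasicoherent := inferInstanceAs
    ((Scheme.Modules.restrictFunctor hU.fromSpec).obj E).IsQuasicoherent
  have hN : IsLocalizing (modulesSpecToSheaf.obj N) :=
    (isIso_fromTildeΓ_iff_isLocalizing N).1 inferInstance
  have hD : hU.fromSpec ''ᵁ PrimeSpectrum.basicOpen f = X.basicOpen f :=
    hU.fromSpec_image_basicOpen f
  have hT : U ≤ hU.fromSpec ''ᵁ ⊤ := by
    rw [Scheme.Hom.image_top_eq_opensRange, hU.opensRange_fromSpec]
  let t' : Γ(E, hU.fromSpec ''ᵁ PrimeSpectrum.basicOpen f) := E.presheaf.map (homOfLE hD.le).op t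
  obtain ⟨n, m, h2⟩ : ∃ (n : ℕ) (m : Γ(E, hU.fromSpec ''ᵁ ⊤)),
      E.presheaf.map (homOfLE (hU.fromSpec.image_mono le_top)).op m =
        X.presheaf.map (homOfLE (hD.le.trans (X.basicOpen_le f))).op (f ^ n) • t' := by
    obtain ⟨⟨m, ⟨_, n, rfl⟩⟩, hm⟩ := (hN f).surj (restrictSection hU t')
    exact ⟨n, m, hm.symm.trans (smul_restrictSection E hU (PrimeSpectrum.basicOpen f)
      (hD.le.trans (X.basicOpen_le f)) (f ^ n) t')⟩
  refine ⟨n, E.presheaf.map (homOfLE hT).op m, ?_⟩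
  have h3 := congrArg (E.presheaf.map (homOfLE hD.ge).op) h2
  rw [Scheme.Modules.map_smul] at h3
  simp only [t', ← ConcreteCategory.comp_apply, ← Functor.map_comp, ← op_comp,
    homOfLE_comp] at h3 ⊢
  refine h3.trans ?_
  congr 1
  exact ConcreteCategory.congr_hom (E.presheaf.map_id _) t

theorem exists_pow_smul_eq_zero [E.IsQuasicoherent] {U : X.Opens}
    (hU : IsAffineOpen U) (f : Γ(X, U)) (m : Γ(E, U))
    (hm : E.presheaf.map (homOfLE (X.basicOpen_le f)).op m = 0) : ∃ n : ℕ, f ^ n • m = 0 := by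
  let N : (Spec Γ(X, U)).Modules := E.restrict hU.fromSpec
  have : N.IsQuasicoherent := inferInstanceAs
    ((Scheme.Modules.restrictFunctor hU.fromSpec).obj E).IsQuasicoherent
  have hN : IsLocalizing (modulesSpecToSheaf.obj N) :=
    (isIso_fromTildeΓ_iff_isLocalizing N).1 inferInstance
  have hD : hU.fromSpec ''ᵁ PrimeSpectrum.basicOpen f = X.basicOpen f :=
    hU.fromSpec_image_basicOpen f
  have hT : hU.fromSpec ''ᵁ ⊤ = U := by
    rw [Scheme.Hom.image_top_eq_opensRange, hU.opensRange_fromSpec]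
  let m' : Γ(E, hU.fromSpec ''ᵁ ⊤) := E.presheaf.map (homOfLE hT.le).op m
  have hm' : E.presheaf.map (homOfLE (hU.fromSpec.image_mono le_top) :
      hU.fromSpec ''ᵁ PrimeSpectrum.basicOpen f ⟶ hU.fromSpec ''ᵁ ⊤).op m' = 0 := by
    have := congrArg (E.presheaf.map (homOfLE hD.le).op) hm
    rw [map_zero] at this
    rw [← this]
    simp only [m', ← ConcreteCategory.comp_apply, ← Functor.map_comp, ← op_comp, homOfLE_comp]
  obtain ⟨⟨_, n, rfl⟩, hc⟩ := (hN f).exists_of_eq (x₁ := restrictSection hU m')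
    (x₂ := 0) (hm'.trans (map_zero _).symm)
  refine ⟨n, ?_⟩
  have h1 := smul_restrictSection E hU ⊤ hT.le (f ^ n) m'
  have h2 : X.presheaf.map (homOfLE hT.le).op (f ^ n) • m' = 0 :=
    h1.symm.trans (hc.trans (smul_zero _))
  have h3 := congrArg (E.presheaf.map (homOfLE hT.ge).op) h2
  rw [map_zero, Scheme.Modules.map_smul] at h3
  simp only [m', ← ConcreteCategory.comp_apply, ← Functor.map_comp, ← op_comp,
    homOfLE_comp] at h3
  rw [← h3]
  congr 1
  · exact (ConcreteCategory.congr_hom (X.presheaf.map_id _) _).symm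
  · exact (ConcreteCategory.congr_hom (E.presheaf.map_id _) m).symm

/-- The sections of `E` over `U` determine the stalks of `E` by localization. -/
structure LocalizesAt (E : X.Modules) (U : X.Opens) : Prop where
  exists_germ_eq : ∀ (y : X) (hy : y ∈ U) (w : StalkAt E y), ∃ (s : Γ(X, U)) (m : Γ(E, U)),
    IsUnit (X.presheaf.germ U y hy s) ∧
      E.presheaf.germ U y hy m = X.presheaf.germ U y hy s • w
  exists_smul_eq_zero : ∀ (y : X) (hy : y ∈ U) (m : Γ(E, U)),
    (E.presheaf.germ U y hy m : StalkAt E y) = 0 →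
      ∃ s : Γ(X, U), IsUnit (X.presheaf.germ U y hy s) ∧ s • m = 0

/-- Germs at y are represented on some basic open containing y, where f is invertible; a power of f
extends the section or kills it. -/
theorem localizesAt_of_isQuasicoherent [E.IsQuasicoherent] {U : X.Opens} (hU : IsAffineOpen U) :
    LocalizesAt E U where
  exists_germ_eq y hy w := by
    obtain ⟨V, hyV, t, rfl⟩ := E.presheaf.exists_germ_eq w
    obtain ⟨f, hfV, hyf⟩ := hU.exists_basicOpen_le ⟨y, hyV⟩ hy
    obtain ⟨n, m, hm⟩ := exists_pow_smul_eq_map hU f (E.presheaf.map (homOfLE hfV).op t)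
    have hf : IsUnit (X.presheaf.germ U y hy f) := (X.mem_basicOpen f y hy).1 hyf
    refine ⟨f ^ n, m, by rw [map_pow]; exact hf.pow n, ?_⟩
    have h1 := congrArg (E.presheaf.germ (X.basicOpen f) y hyf) hm
    rw [germ_smul_stalk] at h1
    have h2 := E.presheaf.germ_res_apply (homOfLE (X.basicOpen_le f)) y hyf m
    have h3 := E.presheaf.germ_res_apply (homOfLE hfV) y hyf t
    have h4 := X.presheaf.germ_res_apply (homOfLE (X.basicOpen_le f)) y hyf (f ^ n)
    exact h2.symm.trans (h1.trans (congrArg₂ (· • ·) h4 h3))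
  exists_smul_eq_zero y hy m hm := by
    obtain ⟨V, hyV, i, j, hV⟩ := E.presheaf.germ_eq y hy hy m 0 (hm.trans (map_zero _).symm)
    obtain ⟨f, hfV, hyf⟩ := hU.exists_basicOpen_le ⟨y, hyV⟩ hy
    have hf : IsUnit (X.presheaf.germ U y hy f) := (X.mem_basicOpen f y hy).1 hyf
    have h1 := congrArg (E.presheaf.map (homOfLE hfV).op) hV
    rw [map_zero, map_zero, ← ConcreteCategory.comp_apply, ← Functor.map_comp] at h1
    obtain ⟨n, hn⟩ := exists_pow_smul_eq_zero hU f m h1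
    exact ⟨f ^ n, by rw [map_pow]; exact hf.pow n, hn⟩

theorem exists_germ_eq_germ_mul {U : X.Opens} (hU : IsAffineOpen U) {y : X} (hy : y ∈ U)
    (r : X.presheaf.stalk y) : ∃ s a : Γ(X, U), IsUnit (X.presheaf.germ U y hy s) ∧
      X.presheaf.germ U y hy a = X.presheaf.germ U y hy s * r := by
  obtain ⟨V, hyV, t, rfl⟩ := X.presheaf.exists_germ_eq r
  obtain ⟨f, hfV, hyf⟩ := hU.exists_basicOpen_le ⟨y, hyV⟩ hy
  have hf : IsUnit (X.presheaf.germ U y hy f) := (X.mem_basicOpen f y hy).1 hyf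
  have := hU.isLocalization_basicOpen f
  obtain ⟨⟨a, ⟨_, n, rfl⟩⟩, ha⟩ := IsLocalization.surj (Submonoid.powers f)
    (X.presheaf.map (homOfLE hfV).op t)
  refine ⟨f ^ n, a, by rw [map_pow]; exact hf.pow n, ?_⟩
  have h1 := congrArg (X.presheaf.germ (X.basicOpen f) y hyf) ha
  rw [map_mul] at h1
  have h2 := X.presheaf.germ_res_apply (homOfLE (X.basicOpen_le f)) y hyf a
  have h3 := X.presheaf.germ_res_apply (homOfLE hfV) y hyf t
  have h4 := X.presheaf.germ_res_apply (homOfLE (X.basicOpen_le f)) y hyf (f ^ n)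
  rw [h3, mul_comm] at h1
  exact h2.symm.trans (h1.symm.trans (congrArg (· * _) h4))

/-- Finitely many generating sections give an epimorphism from a finite free sheaf. Both sheaves are
associated with modules, and the associated-sheaf functor is full and reflects epimorphisms, so the
module of sections is a quotient of a finite free module. -/
theorem finite_of_generatingSections {U : X.Opens} (hU : IsAffineOpen U) [E.IsQuasicoherent]
    (σ : SheafOfModules.GeneratingSections (E.restrict hU.fromSpec)) [σ.IsFiniteType] :
    Module.Finite Γ(X, U) Γ(E, U) := by
  let N : (Spec Γ(X, U)).Modules := E.restrict hU.fromSpec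
  have : N.IsQuasicoherent := inferInstanceAs
    ((Scheme.Modules.restrictFunctor hU.fromSpec).obj E).IsQuasicoherent
  have hΓ : IsIso N.fromTildeΓ := Scheme.Modules.isIso_fromTildeΓ_of_isQuasicoherent N
  have : Finite σ.I := SheafOfModules.GeneratingSections.IsFiniteType.finite
  have hT : hU.fromSpec ''ᵁ ⊤ = U := by
    rw [Scheme.Hom.image_top_eq_opensRange, hU.opensRange_fromSpec]
  let M := (modulesSpecToSheaf.obj N).presheaf.obj (.op ⊤)
  have hM : Module.Finite Γ(X, U) M := by
    let π : SheafOfModules.free σ.I ⟶ N := σ.π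
    have hπ : Epi π := σ.epi
    let e₁ : (tilde.functor Γ(X, U)).obj (ModuleCat.of Γ(X, U) (σ.I →₀ Γ(X, U))) ≅
      SheafOfModules.free σ.I := tildeFinsupp σ.I
    let e₂ : (tilde.functor Γ(X, U)).obj M ≅ N := @asIso _ _ _ _ N.fromTildeΓ hΓ
    let p : (tilde.functor Γ(X, U)).obj (ModuleCat.of Γ(X, U) (σ.I →₀ Γ(X, U))) ⟶
      (tilde.functor Γ(X, U)).obj M := e₁.hom ≫ π ≫ e₂.inv
    have hp : Epi ((tilde.functor Γ(X, U)).map ((tilde.functor Γ(X, U)).preimage p)) := by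
      rw [Functor.map_preimage]
      have h1 : Epi e₁.hom := @IsIso.epi_of_iso _ _ _ _ e₁.hom e₁.isIso_hom
      have h2 : Epi e₂.inv := @IsIso.epi_of_iso _ _ _ _ e₂.inv e₂.isIso_inv
      exact epi_comp' h1 (epi_comp' hπ h2)
    have hg := (tilde.functor Γ(X, U)).epi_of_epi_map hp
    have := (ModuleCat.epi_iff_surjective _).1 hg
    have : Module.Finite Γ(X, U) (ModuleCat.of Γ(X, U) (σ.I →₀ Γ(X, U))) :=
      inferInstanceAs (Module.Finite Γ(X, U) (σ.I →₀ Γ(X, U)))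
    exact Module.Finite.of_surjective _ ‹Function.Surjective _›
  let e : M →ₗ[Γ(X, U)] Γ(E, U) :=
    { toFun := fun m => E.presheaf.map (homOfLE hT.ge).op (m : Γ(E, hU.fromSpec ''ᵁ ⊤))
      map_add' := fun m m' => map_add _ _ _
      map_smul' := fun r m => by
        have h1 := smul_restrictSection E hU ⊤ hT.le r m
        refine (congrArg (E.presheaf.map (homOfLE hT.ge).op) h1).trans ?_
        refine (E.map_smul _ _ _).trans ?_
        rw [← ConcreteCategory.comp_apply, ← Functor.map_comp]
        congr 1
        exact ConcreteCategory.congr_hom (X.presheaf.map_id _) r }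
  refine Module.Finite.of_surjective e fun m => ⟨E.presheaf.map (homOfLE hT.le).op m, ?_⟩
  change E.presheaf.map _ (E.presheaf.map _ m) = m
  rw [← ConcreteCategory.comp_apply, ← Functor.map_comp]
  exact ConcreteCategory.congr_hom (E.presheaf.map_id _) m

/-- Generating sections of the restriction of `E` to an open subset, restricted to an affine open
subset. -/
def generatingSectionsRestrict {U V : X.Opens} (hV : IsAffineOpen V) (h : V ≤ U)
    (σ : (E.over U).GeneratingSections) :
    SheafOfModules.GeneratingSections (E.restrict hV.fromSpec) :=
  let u : Spec Γ(X, V) ⟶ U := hV.isoSpec.inv ≫ X.homOfLE h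
  have hu : u ≫ U.ι = hV.fromSpec := by
    simp only [u, Category.assoc, Scheme.homOfLE_ι]
    rfl
  have h₁ : PreservesColimitsOfSize.{u, u} (Scheme.Modules.restrictFunctor u) := inferInstance
  have h₂ : PreservesColimitsOfSize.{u, u} (Scheme.Modules.overEquiv U).functor := inferInstance
  let F : SheafOfModules (X.ringCatSheaf.over U) ⥤ SheafOfModules (Spec Γ(X, V)).ringCatSheaf :=
    (Scheme.Modules.overEquiv U).functor ⋙ Scheme.Modules.restrictFunctor u
  have h₃ : PreservesColimitsOfSize.{u, u} F := @comp_preservesColimits _ _ _ _ _ _ _ _ h₂ h₁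
  let iso : SheafOfModules.overFunctor X.ringCatSheaf _ ⋙ F ≅
      Scheme.Modules.restrictFunctor hV.fromSpec :=
    (Functor.associator _ _ _).symm ≪≫
      Functor.isoWhiskerRight (Scheme.Modules.overFunctorEquiv _) _ ≪≫
      (Scheme.Modules.restrictFunctorComp _ _).symm ≪≫ (Scheme.Modules.restrictFunctorCongr hu)
  let M : SheafOfModules (Spec Γ(X, V)).ringCatSheaf := E.restrict hV.fromSpec
  let e : F.obj (E.over U) ≅ M := iso.app E
  have h₄ : Epi e.hom := @IsIso.epi_of_iso _ _ _ _ e.hom e.isIso_hom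
  (σ.map F (Scheme.Modules.restrictUnitIso _).symm).ofEpi e.hom

/-- Local generating data live on some open of a cover; they are restricted to an affine
neighbourhood inside it. -/
theorem exists_finite_of_isCoherent (hE : IsCoherent E) (x : X) :
    ∃ U : X.Opens, IsAffineOpen U ∧ x ∈ U ∧ LocalizesAt E U ∧ Module.Finite Γ(X, U) Γ(E, U) := by
  have hqc : E.IsQuasicoherent := hE.1
  obtain ⟨⟨I, W, cov, gen⟩, hσ⟩ := hE.2.exists_localGeneratorsData
  obtain ⟨i, hxi⟩ : ∃ i, x ∈ W i := by
    rw [Opens.coversTop_iff] at cov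
    exact Opens.mem_iSup.1 (cov.ge (Opens.mem_top x))
  obtain ⟨_, ⟨V, hV, rfl⟩, hxV, hVW⟩ :=
    X.isBasis_affineOpens.exists_subset_of_mem_open hxi (W i).2
  have hV : IsAffineOpen V := hV
  have hfin : (gen i).IsFiniteType := hσ.isFiniteType i
  have hfin' : Finite (generatingSectionsRestrict hV hVW (gen i)).I :=
    (hfin.finite : Finite (gen i).I)
  have : (generatingSectionsRestrict hV hVW (gen i)).IsFiniteType := ⟨hfin'⟩
  exact ⟨V, hV, hxV, localizesAt_of_isQuasicoherent hV,
    finite_of_generatingSections hV (generatingSectionsRestrict hV hVW (gen i))⟩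

end Quasicoherent

/-! ### Stalks of morphisms and exact sequences -/

section Stalks

variable {X : Scheme.{u}} {E M N : X.Modules}

/-- The map of stalks. -/
def stalkHom (f : M ⟶ N) (x : X) : StalkAt M x →ₗ[X.presheaf.stalk x] StalkAt N x where
  toFun := (TopCat.Presheaf.stalkFunctor Ab x).map f.mapPresheaf
  map_add' := map_add _
  map_smul' r m := by
    obtain ⟨U, hU, r, m, rfl, rfl⟩ := exists_germ_eq_germ_eq M x r m
    have h1 := TopCat.Presheaf.stalkFunctor_map_germ_apply U x hU f.mapPresheaf (r • m)
    have h2 := TopCat.Presheaf.stalkFunctor_map_germ_apply U x hU f.mapPresheaf m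
    rw [germ_smul_stalk] at h1
    refine h1.trans ?_
    refine Eq.trans ?_ (congrArg (X.presheaf.germ U x hU r • ·) h2.symm)
    exact (congrArg (N.presheaf.germ U x hU) (f.app_smul r m)).trans
      (germ_smul_stalk N x U hU r (f.app U m))

theorem stalkHom_germ (f : M ⟶ N) {x : X} {U : X.Opens} (hx : x ∈ U) (m : Γ(M, U)) :
    stalkHom f x (M.presheaf.germ U x hx m) = N.presheaf.germ U x hx (f.app U m) :=
  TopCat.Presheaf.stalkFunctor_map_germ_apply U x hx f.mapPresheaf m

theorem stalkHom_comp (f : E ⟶ M) (g : M ⟶ N) (x : X) (m : StalkAt E x) :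
    stalkHom (f ≫ g) x m = stalkHom g x (stalkHom f x m) := by
  obtain ⟨U, hU, m, rfl⟩ := E.presheaf.exists_germ_eq m
  rw [stalkHom_germ, stalkHom_germ]
  exact (stalkHom_germ g hU _).symm

theorem stalkHom_zero (x : X) (m : StalkAt M x) : stalkHom (0 : M ⟶ N) x m = 0 := by
  obtain ⟨U, hU, m, rfl⟩ := M.presheaf.exists_germ_eq m
  rw [stalkHom_germ, Scheme.Modules.Hom.zero_app]
  exact map_zero _

theorem stalkHom_specializeStalk (f : M ⟶ N) {x y : X} (h : y ⤳ x) (m : StalkAt M x) :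
    stalkHom f y (specializeStalk M h m) = specializeStalk N h (stalkHom f x m) := by
  obtain ⟨U, hU, m, rfl⟩ := M.presheaf.exists_germ_eq m
  rw [specializeStalk_germ, stalkHom_germ, stalkHom_germ]
  exact (specializeStalk_germ N h hU _).symm

theorem exists_map_eq_zero {x : X} {U : X.Opens} (hx : x ∈ U) (s : Γ(E, U))
    (h : (E.presheaf.germ U x hx s : StalkAt E x) = 0) :
    ∃ (V : X.Opens) (_ : x ∈ V) (i : V ⟶ U), E.presheaf.map i.op s = 0 := by
  obtain ⟨V, hV, i, j, hs⟩ := E.presheaf.germ_eq x hx hx s 0 (h.trans (map_zero _).symm)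
  exact ⟨V, hV, i, hs.trans (map_zero _)⟩

theorem section_eq_zero {U : X.Opens} (s : Γ(E, U))
    (h : ∀ (x : X) (hx : x ∈ U), (E.presheaf.germ U x hx s : StalkAt E x) = 0) : s = 0 :=
  TopCat.Presheaf.section_ext ⟨E.presheaf, E.isSheaf⟩ U s 0 fun x hx =>
    (h x hx).trans (map_zero _).symm

variable (P : ∀ x : X, Submodule (X.presheaf.stalk x) (StalkAt E x))

/-- The sections of `E` whose germ at `x` lies in `P x`, for all `x`. -/
def stalkwiseSections (U : X.Opens) : Submodule Γ(X, U) Γ(E, U) where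
  carrier := {s | ∀ (x : X) (hx : x ∈ U), (E.presheaf.germ U x hx s : StalkAt E x) ∈ P x}
  add_mem' hs ht x hx := by
    rw [map_add]
    exact add_mem (hs x hx) (ht x hx)
  zero_mem' x hx := by
    rw [map_zero]
    exact zero_mem _
  smul_mem' r s hs x hx := by
    rw [germ_smul_stalk]
    exact Submodule.smul_mem _ _ (hs x hx)

theorem stalkwiseSections_iff_res {U V : X.Opens} (f : V ⟶ U) (s : Γ(E, U)) :
    E.presheaf.map f.op s ∈ stalkwiseSections P V ↔
      ∀ (x : X) (hx : x ∈ V), (E.presheaf.germ U x (f.le hx) s : StalkAt E x) ∈ P x := by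
  refine forall₂_congr fun x hx => ?_
  rw [TopCat.Presheaf.germ_res_apply]

/-- The sections of `E` whose germ at `x` lies in `P x`, as a submodule of `E`. -/
def stalkwiseSubmodule : PresheafOfModules.Submodule (R := X.ringCatSheaf.obj) E.val where
  obj U := stalkwiseSections P U.unop
  map f s hs := (stalkwiseSections_iff_res P f.unop s).2 fun x hx => hs x (f.unop.le hx)

theorem stalkwise_isSheaf : TopCat.Presheaf.IsSheaf (X := X.toTopCat) (C := Ab.{u})
    (stalkwiseSubmodule P).toPresheafOfModules.presheaf := by
  rw [TopCat.Presheaf.isSheaf_iff_isSheafUniqueGluing]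
  intro ι U sf hsf
  obtain ⟨s, hs, huniq⟩ := TopCat.Presheaf.IsSheaf.isSheafUniqueGluing E.isSheaf U
    (fun j => (sf j).1) fun j k => congrArg Subtype.val (hsf j k)
  refine ⟨⟨s, fun x hx => ?_⟩, fun j => Subtype.ext (hs j), fun t ht => Subtype.ext
    (huniq t.1 fun j => congrArg Subtype.val (ht j))⟩
  obtain ⟨j, hj⟩ := Opens.mem_iSup.1 hx
  have h2 : E.presheaf.map (Opens.leSupr U j).op s ∈ stalkwiseSections P (U j) := by
    rw [show E.presheaf.map (Opens.leSupr U j).op s = (sf j).1 from hs j]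
    exact (sf j).2
  exact (stalkwiseSections_iff_res P _ s).1 h2 x hj

/-- The subsheaf of `E` of the sections whose germ at `x` lies in `P x`. -/
def stalkwiseSheaf : X.Modules where
  val := (stalkwiseSubmodule P).toPresheafOfModules
  isSheaf := stalkwise_isSheaf P

/-- The inclusion of the subsheaf. -/
def stalkwiseIncl : stalkwiseSheaf P ⟶ E := ⟨(stalkwiseSubmodule P).ι⟩

instance : Mono (stalkwiseIncl P) :=
  (Scheme.Modules.toPresheafOfModules X).mono_of_mono_map
    (inferInstanceAs (Mono (stalkwiseSubmodule P).ι))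

variable {P}

/-- A section whose germs lie in `P`, as a section of the subsheaf. -/
def stalkwiseMk {U : X.Opens} (s : Γ(E, U))
    (h : ∀ (x : X) (hx : x ∈ U), (E.presheaf.germ U x hx s : StalkAt E x) ∈ P x) :
    Γ(stalkwiseSheaf P, U) :=
  (⟨s, h⟩ : stalkwiseSections P U)

theorem germ_stalkwiseIncl_mem {U : X.Opens} (s : Γ(stalkwiseSheaf P, U)) (x : X) (hx : x ∈ U) :
    (E.presheaf.germ U x hx ((stalkwiseIncl P).app U s) : StalkAt E x) ∈ P x :=
  (show stalkwiseSections P U from s).2 x hx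

theorem app_injective (f : M ⟶ N) [Mono f] (U : X.Opens) : Function.Injective (f.app U) := by
  have h1 : Mono ((Scheme.Modules.toPresheafOfModules X).map f) := inferInstance
  exact PresheafOfModules.injective_of_mono ((Scheme.Modules.toPresheafOfModules X).map f) (.op U)

theorem stalkHom_injective (f : M ⟶ N) [Mono f] (x : X) : Function.Injective (stalkHom f x) := by
  rw [injective_iff_map_eq_zero]
  intro m hm
  obtain ⟨U, hU, m, rfl⟩ := M.presheaf.exists_germ_eq m
  rw [stalkHom_germ] at hm
  obtain ⟨V, hV, i, h⟩ := exists_map_eq_zero hU _ hm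
  have h1 : f.app V (M.presheaf.map i.op m) = 0 :=
    (ConcreteCategory.congr_hom (f.mapPresheaf.naturality i.op) m).trans h
  have h2 := app_injective f V (h1.trans (map_zero _).symm)
  rw [← M.presheaf.germ_res_apply i x hV, h2]
  exact map_zero _

/-- An epimorphism factors through the subsheaf of sections whose germs lie in the images on stalks.
The inclusion of that subsheaf is then a monomorphism and an epimorphism, hence invertible. -/
theorem stalkHom_surjective (f : M ⟶ N) [Epi f] (x : X) : Function.Surjective (stalkHom f x) := by
  let P : ∀ x : X, Submodule (X.presheaf.stalk x) (StalkAt N x) := fun x =>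
    LinearMap.range (stalkHom f x)
  let g : M ⟶ stalkwiseSheaf P := homOfSections (fun U =>
    { toFun := fun m => stalkwiseMk (f.app U m) fun x hx =>
        ⟨M.presheaf.germ U x hx m, stalkHom_germ f hx m⟩
      map_add' := fun m m' => Subtype.ext (map_add (f.app U).hom m m')
      map_smul' := fun r m => Subtype.ext (f.app_smul r m) })
    fun U V i m => Subtype.ext (ConcreteCategory.congr_hom (f.mapPresheaf.naturality i.op) m)
  have hg : g ≫ stalkwiseIncl P = f := rfl
  have h1 : Epi (stalkwiseIncl P) := epi_of_epi_fac hg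
  have h2 : IsIso (stalkwiseIncl P) := isIso_of_mono_of_epi _
  intro n
  obtain ⟨U, hU, n, rfl⟩ := N.presheaf.exists_germ_eq n
  have h3 : (stalkwiseIncl P).app U ((inv (stalkwiseIncl P)).app U n) = n := by
    have := congrArg (fun φ : N ⟶ N => φ.app U n) (IsIso.inv_hom_id (stalkwiseIncl P))
    exact this
  have h4 := germ_stalkwiseIncl_mem ((inv (stalkwiseIncl P)).app U n) x hU
  rwa [h3] at h4

/-- The subsheaf of sections whose germs die under g maps to zero, so exactness lifts its inclusion
through f. Near x, a representative of m is a section of this subsheaf. -/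
theorem exists_stalkHom_eq (S : ShortComplex X.Modules) (hS : S.Exact) [Mono S.f] (x : X)
    (m : StalkAt S.X₂ x) (hm : stalkHom S.g x m = 0) : ∃ n, stalkHom S.f x n = m := by
  let P : ∀ x : X, Submodule (X.presheaf.stalk x) (StalkAt S.X₂ x) := fun x =>
    LinearMap.ker (stalkHom S.g x)
  have h0 : stalkwiseIncl P ≫ S.g = 0 := by
    ext U s
    refine section_eq_zero _ fun x hx => ?_
    have h1 := germ_stalkwiseIncl_mem s x hx
    rw [LinearMap.mem_ker, stalkHom_germ] at h1
    exact h1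
  obtain ⟨U, hU, m, rfl⟩ := S.X₂.presheaf.exists_germ_eq m
  rw [stalkHom_germ] at hm
  obtain ⟨V, hV, i, h⟩ := exists_map_eq_zero hU _ hm
  have h1 : S.g.app V (S.X₂.presheaf.map i.op m) = 0 :=
    (ConcreteCategory.congr_hom (S.g.mapPresheaf.naturality i.op) m).trans h
  let s : Γ(stalkwiseSheaf P, V) := stalkwiseMk (S.X₂.presheaf.map i.op m) fun y hy => by
    change stalkHom S.g y _ = 0
    rw [stalkHom_germ, h1]
    exact map_zero _
  refine ⟨S.X₁.presheaf.germ V x hV ((hS.lift (stalkwiseIncl P) h0).app V s), ?_⟩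
  rw [stalkHom_germ, ← S.X₂.presheaf.germ_res_apply i x hV]
  congr 1
  exact congrArg (fun φ : stalkwiseSheaf P ⟶ S.X₂ => φ.app V s)
    (hS.lift_f (stalkwiseIncl P) h0)

end Stalks

end

/-! ### Local principality of families of ideals on the curve -/

theorem exists_eq_span_singleton {O K : Type*} [CommRing O] [IsDomain O] [IsPrincipalIdealRing O]
    [Field K] [Algebra O K] [IsFractionRing O K] (J : (Submodule O K)ˣ) :
    ∃ c : K, c ≠ 0 ∧ (J : Submodule O K) = Submodule.span O {c} := by
  have hfg : (J : Submodule O K).FG := Submodule.fg_unit J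
  -- Being finitely generated, an invertible submodule is a fractional ideal, and those are
  -- principal over a principal ideal domain.
  let F : FractionalIdeal (nonZeroDivisors O) K := ⟨J, FractionalIdeal.isFractional_of_fg hfg⟩
  obtain ⟨c, hc⟩ := (inferInstance : (F : Submodule O K).IsPrincipal).principal
  have hJ : (J : Submodule O K) = Submodule.span O {c} := hc
  refine ⟨c, ?_, hJ⟩
  rintro rfl
  have h1 : (J : Submodule O K) * ((J⁻¹ : (Submodule O K)ˣ) : Submodule O K) = 1 := J.mul_inv
  rw [hJ, Submodule.span_zero_singleton, Submodule.bot_mul] at h1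
  have h2 : (1 : K) ∈ (⊥ : Submodule O K) := h1 ▸ Submodule.one_le.1 le_rfl
  exact one_ne_zero ((Submodule.mem_bot O).1 h2)

variable {C : Scheme.{u}} [IsIntegral C] [∀ x : C, IsPrincipalIdealRing (C.presheaf.stalk x)]

/-- Generizations of x are the primes of its local ring, and a prime of a principal ideal domain is
zero or maximal. -/
theorem eq_genericPoint_or_eq_of_specializes {x y : C} (h : y ⤳ x) :
    y = genericPoint C ∨ y = x := by
  have key : ∀ y : C, y ⤳ x → ∃ p : Spec (C.presheaf.stalk x), C.fromSpecStalk x p = y :=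
    fun y hy => by
      have : y ∈ Set.range (C.fromSpecStalk x) := Scheme.range_fromSpecStalk ▸ hy
      exact this
  obtain ⟨p, rfl⟩ := key y h
  by_cases hp : p.asIdeal = ⊥
  · left
    obtain ⟨q, hq⟩ := key (genericPoint C) ((genericPoint_spec C).specializes trivial)
    have hpq : p ⤳ q := (PrimeSpectrum.le_iff_specializes p q).1 (by
      change p.asIdeal ≤ q.asIdeal
      rw [hp]
      exact bot_le)
    have h1 := hpq.map (C.fromSpecStalk x).continuous
    rw [hq] at h1
    exact (h1.antisymm ((genericPoint_spec C).specializes trivial)).eq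
  · right
    have hpp : p.asIdeal.IsPrime := p.isPrime
    have hmax : p.asIdeal.IsMaximal := IsPrime.to_maximal_ideal hp
    have : p = IsLocalRing.closedPoint (C.presheaf.stalk x) :=
      PrimeSpectrum.ext (IsLocalRing.eq_maximalIdeal hmax)
    rw [this, Scheme.fromSpecStalk_closedPoint]

/-- The ratio c / g is represented by a section near the generic point, and it is a unit where that
section does not vanish. -/
theorem exists_span_eq_span {g c : C.functionField} (hg : g ≠ 0) (hc : c ≠ 0) :
    ∃ V : C.Opens, genericPoint C ∈ V ∧ ∀ y ∈ V, Submodule.span (C.presheaf.stalk y) {g} =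
      Submodule.span (C.presheaf.stalk y) {c} := by
  obtain ⟨U, hU, a, ha⟩ := C.presheaf.exists_germ_eq (x := genericPoint C) (c * g⁻¹)
  have hU' : Nonempty U := ⟨⟨_, hU⟩⟩
  have hu : IsUnit (C.presheaf.germ U _ hU a) := by
    rw [ha]
    exact (mul_ne_zero hc (inv_ne_zero hg)).isUnit
  refine ⟨C.basicOpen a, (C.mem_basicOpen a _ hU).2 hu, fun y hy => ?_⟩
  have hyU : y ∈ U := C.basicOpen_le a hy
  have h1 : IsUnit (C.presheaf.germ U y hyU a) := (C.mem_basicOpen a y hyU).1 hy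
  have h2 : C.presheaf.germ U y hyU a • g = c := by
    rw [Algebra.smul_def, Scheme.algebraMap_germ_eq_germToFunctionField]
    change C.presheaf.germ U _ hU a * g = c
    rw [ha, inv_mul_cancel_right₀ hg]
  rw [← h2]
  exact (Submodule.span_singleton_smul_eq h1 g).symm

/-- A generator c of the family at x also generates it on a neighbourhood of the generic point,
where both are trivial. The complement of that neighbourhood has finitely many irreducible
components, and x is the only point outside the neighbourhood that can remain after the components
avoiding x are removed. -/
theorem isLocallyPrincipal_of_open [NoetherianSpace C]
    (J : IdealFamily (fun x : C => (C.presheaf.stalk x : Type u)) C.functionField)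
    {U : C.Opens} (hU : genericPoint C ∈ U) (hJ : ∀ y ∈ U, J y = 1) :
    IsLocallyPrincipal fun x => (J x : Submodule (C.presheaf.stalk x) C.functionField) := by
  intro x
  obtain ⟨c, hc, hJc⟩ := exists_eq_span_singleton (O := C.presheaf.stalk x) (J x)
  obtain ⟨V, hV, hVc⟩ := exists_span_eq_span (C := C) one_ne_zero hc
  obtain ⟨S, hSf, hSi, hS⟩ := NoetherianSpace.exists_finite_set_closeds_irreducible
    (Opens.compl (U ⊓ V))
  let Z : Set C := ⋃ t ∈ {t ∈ S | x ∉ t}, (t : Set C)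
  have hZ : IsClosed Z := (hSf.subset (Set.sep_subset _ _)).isClosed_biUnion fun t _ => t.2
  refine ⟨⟨Zᶜ, hZ.isOpen_compl⟩, ?_, c, hc, fun ⟨y, hy⟩ => ?_⟩
  · intro hx
    obtain ⟨t, ⟨_, ht⟩, hxt⟩ := Set.mem_iUnion₂.1 hx
    exact ht hxt
  · by_cases hyUV : y ∈ U ⊓ V
    · rw [← hVc y hyUV.2]
      exact (congrArg Units.val (hJ y hyUV.1)).trans Submodule.one_eq_span
    · have hyS : y ∈ (sSup S : Closeds C) := hS ▸ hyUV
      obtain ⟨t, htS, hyt⟩ : ∃ t ∈ S, y ∈ t := by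
        have := hSf.coe_toFinset
        rw [← this, ← Finset.sup_id_eq_sSup, ← SetLike.mem_coe, Closeds.coe_finset_sup] at hyS
        simpa using hyS
      have hxt : x ∈ t := by
        by_contra h
        exact hy (Set.mem_iUnion₂.2 ⟨t, ⟨htS, h⟩, hyt⟩)
      -- The generic point z of a component through x and y is not the generic point of C, and it
      -- specializes to both x and y; so it equals each of them.
      obtain ⟨z, hz⟩ := QuasiSober.sober (hSi t htS) t.2
      have hzt : z ∈ t := hz.mem
      have hzUV : z ∉ U ⊓ V := by
        have : z ∈ (sSup S : Closeds C) := le_sSup htS hzt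
        rw [← hS] at this
        exact this
      have hzη : z ≠ genericPoint C := by
        rintro rfl
        exact hzUV ⟨hU, hV⟩
      have hzx : z = x := (eq_genericPoint_or_eq_of_specializes
        (hz.specializes hxt)).resolve_left hzη
      have hzy : z = y := (eq_genericPoint_or_eq_of_specializes
        (hz.specializes hyt)).resolve_left hzη
      subst hzx
      subst hzy
      exact hJc

/-! ### Local rings of smooth curves, and nilpotence of kernels -/

theorem isPrincipalIdealRing_of_isStandardSmoothOfRelativeDimension {k B L : Type*} [Field k]
    [CommRing B] [CommRing L] [Algebra B L] [IsDomain L] [IsNoetherianRing L] {f : k →+* B}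
    (hf : f.IsStandardSmoothOfRelativeDimension 1) (q : Ideal B) [q.IsPrime]
    [IsLocalization.AtPrime L q] : IsPrincipalIdealRing L := by
  -- A standard smooth algebra of relative dimension one is étale over a polynomial ring in one
  -- variable, which is a principal ideal domain.
  obtain ⟨g, -, hg⟩ := hf.exists_etale_mvPolynomial
  let := g.toAlgebra
  let R := MvPolynomial (Fin 1) k
  have hgR : Algebra.Etale R B := hg
  have hR : IsPrincipalIdealRing R := IsPrincipalIdealRing.of_surjective
    (MvPolynomial.uniqueAlgEquiv k (Fin 1)).symm.toRingEquiv.toRingHom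
    (MvPolynomial.uniqueAlgEquiv k (Fin 1)).symm.surjective
  let p : Ideal R := q.comap (algebraMap R B)
  have hp : p.IsPrime := inferInstance
  have : q.LiesOver p := ⟨rfl⟩
  let := Localization.AtPrime.algebraOfLiesOver p q
  have h1 : Algebra.IsUnramifiedAt R q := inferInstance
  -- Unramifiedness says that the maximal ideal upstairs is generated by the prime below, hence by
  -- one element. A noetherian local domain with principal maximal ideal is a principal ideal
  -- domain.
  have h2 := ((Algebra.isUnramifiedAt_iff_map_eq R p q).1 h1).2
  have e : Localization.AtPrime q ≃ₐ[B] L := IsLocalization.algEquiv q.primeCompl _ _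
  have : IsDomain (Localization.AtPrime q) := e.toMulEquiv.isDomain
  have : IsNoetherianRing (Localization.AtPrime q) :=
    isNoetherianRing_of_ringEquiv L e.symm.toRingEquiv
  have h3 : (IsLocalRing.maximalIdeal (Localization.AtPrime q)).IsPrincipal := by
    obtain ⟨a, ha⟩ := (inferInstance : p.IsPrincipal).principal
    refine ⟨algebraMap _ _ a, ?_⟩
    rw [← h2, ha, Ideal.submodule_span_eq, Ideal.map_span, Set.image_singleton]
  have h4 : IsPrincipalIdealRing (Localization.AtPrime q) :=
    ((tfae_of_isNoetherianRing_of_isLocalRing_of_isDomain (Localization.AtPrime q)).out 4 0).1 h3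
  exact IsPrincipalIdealRing.of_surjective e.toRingEquiv.toRingHom e.surjective

theorem ker_pow_eq_bot_of_comm {A A' B B' : Type*} [CommRing A] [CommRing A'] [CommRing B]
    [CommRing B'] (α : A →+* A') (ψ : A →+* B) (ψ' : A' →+* B') (hα : Function.Surjective α)
    (h : ∀ a, ψ' (α a) = 0 → ψ a = 0) {n : ℕ} (hn : RingHom.ker ψ ^ n = ⊥) :
    RingHom.ker ψ' ^ n = ⊥ := by
  have h1 : RingHom.ker ψ' ≤ (RingHom.ker ψ).map α := fun r hr => by
    obtain ⟨a, rfl⟩ := hα r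
    exact Ideal.mem_map_of_mem _ (h a hr)
  rw [eq_bot_iff, ← Ideal.map_bot (f := α), ← hn, Ideal.map_pow]
  exact Ideal.pow_right_mono h1 n

/-- The kernel is contained in the ideal generated by the image of z, whose n-th power is zero. With
A the local ring of the surface, this is where the equations z and z ^ n enter. -/
theorem ker_comp_pow_eq_bot {A B D : Type*} [CommRing A] [CommRing B] [CommRing D] (φ : A →+* B)
    (ψ : B →+* D) (hφ : Function.Surjective φ) {z : A} {n : ℕ}
    (hz : RingHom.ker (ψ.comp φ) = Ideal.span {z}) (hn : RingHom.ker φ = Ideal.span {z ^ n}) :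
    RingHom.ker ψ ^ n = ⊥ := by
  have h1 : RingHom.ker ψ ≤ Ideal.span {φ z} := fun r hr => by
    obtain ⟨a, rfl⟩ := hφ r
    have ha : a ∈ RingHom.ker (ψ.comp φ) := hr
    rw [hz] at ha
    rw [← Set.image_singleton, ← Ideal.map_span]
    exact Ideal.mem_map_of_mem _ ha
  have h2 : φ z ^ n = 0 := by
    rw [← map_pow, ← RingHom.mem_ker, hn]
    exact Ideal.mem_span_singleton_self _
  rw [eq_bot_iff]
  refine (Ideal.pow_right_mono h1 n).trans ?_
  rw [Ideal.span_singleton_pow, h2, Ideal.span_singleton_eq_bot.2 rfl]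

/-! ### The ideal of the reduced curve on stalks -/

section IdealSheaf

variable {X C : Scheme.{u}} [IsIntegral C] (i : C ⟶ X)

theorem germ_mem_ker_iff {U : X.Opens} {c : C} (hc : i c ∈ U) (s : Γ(X, U)) :
    X.presheaf.germ U (i c) hc s ∈ RingHom.ker (i.stalkMap c).hom ↔ i.app U s = 0 := by
  rw [RingHom.mem_ker]
  refine Eq.congr_left (Scheme.Hom.germ_stalkMap_apply i U c hc s) |>.trans ?_
  exact map_eq_zero_iff _ (germ_injective_of_isIntegral C c hc)

theorem exists_germ_eq_germ_mul_of_mem_ker {U : X.Opens} (hU : IsAffineOpen U) {c : C}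
    (hc : i c ∈ U) (r : X.presheaf.stalk (i c)) (hr : r ∈ RingHom.ker (i.stalkMap c).hom) :
    ∃ s a : Γ(X, U), IsUnit (X.presheaf.germ U (i c) hc s) ∧ i.app U a = 0 ∧
      X.presheaf.germ U (i c) hc a = X.presheaf.germ U (i c) hc s * r := by
  obtain ⟨s, a, hs, ha⟩ := exists_germ_eq_germ_mul hU hc r
  refine ⟨s, a, hs, (germ_mem_ker_iff i hc a).1 ?_, ha⟩
  rw [ha]
  exact Ideal.mul_mem_left _ _ hr

/-- Up to a unit, an element of the kernel at c is the germ of a section over U. That section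
vanishes on all of C ∩ U, because germs on an integral scheme are injective. -/
theorem ker_stalkMap_eq_map {U : X.Opens} (hU : IsAffineOpen U) {c : C} (hc : i c ∈ U) :
    RingHom.ker (i.stalkMap c).hom =
      (RingHom.ker (i.app U).hom).map (X.presheaf.germ U (i c) hc).hom := by
  refine le_antisymm (fun r hr => ?_) (Ideal.map_le_iff_le_comap.2 fun s hs =>
    (germ_mem_ker_iff i hc s).2 hs)
  obtain ⟨s, a, hs, ha, hr⟩ := exists_germ_eq_germ_mul_of_mem_ker i hU hc r hr
  refine (Ideal.unit_mul_mem_iff_mem _ hs).1 ?_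
  rw [← hr]
  exact Ideal.mem_map_of_mem _ ha

/-- Both kernels are generated by the kernel over one affine open containing both points. -/
theorem ker_stalkMap_eq_map_stalkSpecializes {y x : C} (h : y ⤳ x) :
    RingHom.ker (i.stalkMap y).hom = (RingHom.ker (i.stalkMap x).hom).map
      (X.presheaf.stalkSpecializes (h.map i.continuous)).hom := by
  obtain ⟨_, ⟨U, hU, rfl⟩, hxU, -⟩ :=
    X.isBasis_affineOpens.exists_subset_of_mem_open (Set.mem_univ (i x)) isOpen_univ
  have hyU : i y ∈ U := (h.map i.continuous).mem_open U.2 hxU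
  rw [ker_stalkMap_eq_map i hU hxU, ker_stalkMap_eq_map i hU hyU, Ideal.map_map]
  congr 1
  exact congrArg CommRingCat.Hom.hom
    (X.presheaf.germ_stalkSpecializes hxU (h.map i.continuous)).symm

end IdealSheaf

/-! ### Consequences of the definition of a primitive multiple curve -/

namespace IsPrimitiveMultipleCurve

variable {X C : Scheme.{0}} [IsIntegral C] {f : X ⟶ Spec (.of ℂ)} {i : C ⟶ X} {n : ℕ}

theorem isNoetherian (h : IsPrimitiveMultipleCurve f i n) : IsNoetherian X := by
  have := h.locallyOfFiniteType
  have := h.quasiCompact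
  have : CompactSpace X := QuasiCompact.compactSpace_of_compactSpace f
  exact { LocallyOfFiniteType.isLocallyNoetherian f with }

theorem isNoetherian_reduced (h : IsPrimitiveMultipleCurve f i n) : IsNoetherian C := by
  have := h.isNoetherian
  have := h.closedImmersion
  have : CompactSpace C := QuasiCompact.compactSpace_of_compactSpace i
  exact { LocallyOfFiniteType.isLocallyNoetherian i with }

theorem isPrincipalIdealRing_stalk (h : IsPrimitiveMultipleCurve f i n) (c : C) :
    IsPrincipalIdealRing (C.presheaf.stalk c) := by
  have := h.isNoetherian_reduced
  obtain ⟨U, hU, V, hV, hcV, e, hs⟩ := h.smooth.exists_isStandardSmoothOfRelativeDimension c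
  -- The base is the spectrum of a field and has only one point, so the affine open of the base is
  -- everything and its ring of sections is a field.
  have hU1 : U = ⊤ := by
    refine top_unique fun y _ => ?_
    rw [Subsingleton.elim y ((i ≫ f) c)]
    exact e hcV
  subst hU1
  have hk : IsField Γ(Spec (.of ℂ), ⊤) :=
    (Scheme.ΓSpecIso (.of ℂ)).commRingCatIsoToRingEquiv.toMulEquiv.isField (Field.toIsField ℂ)
  let := hk.toField
  let := C.presheaf.algebra_section_stalk ⟨c, hcV⟩
  have := hV.isLocalization_stalk ⟨c, hcV⟩
  exact isPrincipalIdealRing_of_isStandardSmoothOfRelativeDimension hs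
    (hV.primeIdealOf ⟨c, hcV⟩).asIdeal

/-- The local equations concern i restricted over U; the isomorphism of arrows between the stalk
maps carries the nilpotence over to i. -/
theorem ker_stalkMap_pow_of_isClosed (h : IsPrimitiveMultipleCurve f i n) {c : C}
    (hc : IsClosed {c}) : RingHom.ker (i.stalkMap c).hom ^ n = ⊥ := by
  obtain ⟨U, hcU, S, g, j, -, hj, -, z, hz, hzn⟩ := h.local_structure c hc
  let e := morphismRestrictStalkMap i U ⟨c, hcU⟩
  have hl : Function.Surjective e.hom.left.hom :=
    (ConcreteCategory.bijective_of_isIso e.hom.left).2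
  have hr : Function.Injective e.hom.right.hom :=
    (ConcreteCategory.bijective_of_isIso e.hom.right).1
  have h1 := ker_comp_pow_eq_bot _ _ (j.stalkMap_surjective _) hz hzn
  refine ker_pow_eq_bot_of_comm e.hom.left.hom _ _ hl (fun a ha => ?_) h1
  have hw := congrArg (fun φ => φ.hom a) e.hom.w
  refine hr ?_
  rw [map_zero]
  exact hw.symm.trans ha

/-- Every point specializes to a closed point, and the kernel at c is generated by the kernel there.
In particular this covers the generic point. -/
theorem ker_stalkMap_pow (h : IsPrimitiveMultipleCurve f i n) (c : C) :
    RingHom.ker (i.stalkMap c).hom ^ n = ⊥ := by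
  have := h.isNoetherian_reduced
  obtain ⟨x, hx, hxc⟩ := (isClosed_closure (s := {c})).exists_closed_singleton
    ⟨c, subset_closure rfl⟩
  have hcx : c ⤳ x := specializes_iff_mem_closure.2 hx
  rw [ker_stalkMap_eq_map_stalkSpecializes i hcx, ← Ideal.map_pow,
    h.ker_stalkMap_pow_of_isClosed hxc, Ideal.map_bot]

end IsPrimitiveMultipleCurve

noncomputable section

/-! ### Sections and morphisms from germs -/

section Gluing

variable {X : Scheme.{u}} {M N : X.Modules}

theorem exists_section_germ_eq (N : X.Modules) {U : X.Opens} (t : ∀ x : U, StalkAt N x.1)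
    (h : ∀ x : U, ∃ (V : X.Opens) (_ : x.1 ∈ V) (hVU : V ≤ U) (s : Γ(N, V)),
      ∀ (y : X) (hy : y ∈ V), N.presheaf.germ V y hy s = t ⟨y, hVU hy⟩) :
    ∃ s : Γ(N, U), ∀ x : U, N.presheaf.germ U x.1 x.2 s = t x := by
  choose V hxV hVU a ha using h
  obtain ⟨s, hs, -⟩ := TopCat.Sheaf.existsUnique_gluing' ⟨N.presheaf, N.isSheaf⟩ V U
    (fun x => homOfLE (hVU x)) (fun x hx => Opens.mem_iSup.2 ⟨⟨x, hx⟩, hxV _⟩) a (by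
      intro x y
      refine TopCat.Presheaf.section_ext ⟨N.presheaf, N.isSheaf⟩ _ _ _ fun z hz => ?_
      have h1 := N.presheaf.germ_res_apply (Opens.infLELeft (V x) (V y)) z hz (a x)
      have h2 := N.presheaf.germ_res_apply (Opens.infLERight (V x) (V y)) z hz (a y)
      exact (h1.trans (ha x z hz.1)).trans (h2.trans (ha y z hz.2)).symm)
  refine ⟨s, fun x => ?_⟩
  rw [← ha x x.1 (hxV x), ← hs x]
  exact (N.presheaf.germ_res_apply (homOfLE (hVU x)) x.1 (hxV x) s).symm

theorem section_eq {U : X.Opens} (s t : Γ(N, U))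
    (h : ∀ (x : X) (hx : x ∈ U), (N.presheaf.germ U x hx s : StalkAt N x) =
      N.presheaf.germ U x hx t) : s = t :=
  TopCat.Presheaf.section_ext ⟨N.presheaf, N.isSheaf⟩ U s t h

/-- The images of the germs of a section are locally germs of sections, so they glue; linearity and
naturality are checked on germs. -/
theorem exists_stalkHom_eq_of_local (φ : ∀ x, StalkAt M x →ₗ[X.presheaf.stalk x] StalkAt N x)
    (h : ∀ (U : X.Opens) (m : Γ(M, U)) (x : X), x ∈ U → ∃ (V : X.Opens) (_ : x ∈ V) (hVU : V ≤ U)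
      (s : Γ(N, V)), ∀ (y : X) (hy : y ∈ V),
        N.presheaf.germ V y hy s = φ y (M.presheaf.germ U y (hVU hy) m)) :
    ∃ f : M ⟶ N, ∀ x m, stalkHom f x m = φ x m := by
  have h' := fun (U : X.Opens) (m : Γ(M, U)) => exists_section_germ_eq N
    (fun x : U => φ x.1 (M.presheaf.germ U x.1 x.2 m)) fun x => h U m x.1 x.2
  choose F hF using h'
  let f : M ⟶ N := homOfSections (fun U =>
    { toFun := F U
      map_add' := fun m m' => section_eq _ _ fun x hx => by
        rw [map_add]
        refine (hF U (m + m') ⟨x, hx⟩).trans ?_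
        rw [map_add, map_add]
        exact (congrArg₂ (· + ·) (hF U m ⟨x, hx⟩) (hF U m' ⟨x, hx⟩)).symm
      map_smul' := fun r m => section_eq _ _ fun x hx => by
        refine (hF U (r • m) ⟨x, hx⟩).trans ?_
        refine Eq.trans ?_ (germ_smul_stalk N x U hx r (F U m)).symm
        refine (congrArg (φ x) (germ_smul_stalk M x U hx r m)).trans ?_
        rw [map_smul]
        exact (congrArg (X.presheaf.germ U x hx r • ·) (hF U m ⟨x, hx⟩)).symm })
    fun U V i m => section_eq _ _ fun x hx => by
      refine (hF V _ ⟨x, hx⟩).trans ?_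
      rw [M.presheaf.germ_res_apply, N.presheaf.germ_res_apply]
      exact (hF U m ⟨x, i.le hx⟩).symm
  refine ⟨f, fun x m => ?_⟩
  obtain ⟨U, hU, m, rfl⟩ := M.presheaf.exists_germ_eq m
  rw [stalkHom_germ]
  exact hF U m ⟨x, hU⟩

theorem hom_eq_of_stalkHom_eq {f g : M ⟶ N} (h : ∀ x m, stalkHom f x m = stalkHom g x m) :
    f = g := by
  ext U m
  refine section_eq _ _ fun x hx => ?_
  have := h x (M.presheaf.germ U x hx m)
  rw [stalkHom_germ, stalkHom_germ] at this
  exact this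

end Gluing

/-! ### Direct image under a closed immersion is fully faithful -/

section Pushforward

variable {X C : Scheme.{u}} (i : C ⟶ X) [IsClosedImmersion i]

/-- The stalk at `i c` of the direct image of `G`. -/
def pushStalk (G : C.Modules) (c : C) :
    StalkAt ((Scheme.Modules.pushforward i).obj G) (i c) →ₛₗ[(i.stalkMap c).hom] StalkAt G c where
  toFun := TopCat.Presheaf.stalkPushforward Ab i.base G.presheaf c
  map_add' := map_add _
  map_smul' r m := by
    obtain ⟨U, hU, r, m, rfl, rfl⟩ :=
      exists_germ_eq_germ_eq ((Scheme.Modules.pushforward i).obj G) (i c) r m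
    have h1 := TopCat.Presheaf.stalkPushforward_germ_apply Ab i.base G.presheaf U c hU (r • m)
    have h2 := TopCat.Presheaf.stalkPushforward_germ_apply Ab i.base G.presheaf U c hU m
    have h3 := germ_smul_stalk ((Scheme.Modules.pushforward i).obj G) (i c) U hU r m
    refine (congrArg (TopCat.Presheaf.stalkPushforward Ab i.base G.presheaf c) h3.symm).trans ?_
    refine h1.trans ?_
    refine (germ_smul_stalk G c (i ⁻¹ᵁ U) hU (i.app U r) m).trans ?_
    exact congrArg₂ (· • ·) (Scheme.Hom.germ_stalkMap_apply i U c hU r).symm h2.symm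

theorem pushStalk_germ (G : C.Modules) {c : C} {U : X.Opens} (hc : i c ∈ U)
    (m : Γ(G, i ⁻¹ᵁ U)) : pushStalk i G c (((Scheme.Modules.pushforward i).obj G).presheaf.germ U
      (i c) hc m) = G.presheaf.germ (i ⁻¹ᵁ U) c hc m :=
  TopCat.Presheaf.stalkPushforward_germ_apply Ab i.base G.presheaf U c hc m

/-- The topology of C is induced from X, so preimages of neighbourhoods of i c are cofinal among the
neighbourhoods of c. -/
theorem pushStalk_bijective (G : C.Modules) (c : C) : Function.Bijective (pushStalk i G c) := by
  have := TopCat.Presheaf.stalkPushforward.stalkPushforward_iso_of_isInducing Ab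
    (f := i.base) i.isClosedEmbedding.isInducing G.presheaf c
  exact (ConcreteCategory.isIso_iff_bijective _).1 this

theorem pushStalk_stalkHom {G H : C.Modules} (f : G ⟶ H) (c : C)
    (m : StalkAt ((Scheme.Modules.pushforward i).obj G) (i c)) :
    pushStalk i H c (stalkHom ((Scheme.Modules.pushforward i).map f) (i c) m) =
      stalkHom f c (pushStalk i G c m) := by
  obtain ⟨U, hU, m, rfl⟩ := TopCat.Presheaf.exists_germ_eq _ m
  rw [stalkHom_germ]
  refine (pushStalk_germ i H hU _).trans ?_
  refine Eq.trans ?_ (congrArg (stalkHom f c) (pushStalk_germ i G hU m)).symm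
  exact (stalkHom_germ f (U := i ⁻¹ᵁ U) hU m).symm

theorem pushStalk_specializeStalk (G : C.Modules) {x y : C} (h : y ⤳ x)
    (m : StalkAt ((Scheme.Modules.pushforward i).obj G) (i x)) :
    pushStalk i G y (specializeStalk _ (h.map i.continuous) m) =
      specializeStalk G h (pushStalk i G x m) := by
  obtain ⟨U, hU, m, rfl⟩ := TopCat.Presheaf.exists_germ_eq _ m
  rw [specializeStalk_germ]
  refine (pushStalk_germ i G _ _).trans ?_
  refine Eq.trans ?_ (congrArg (specializeStalk G h) (pushStalk_germ i G hU m)).symm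
  exact (specializeStalk_germ G h (U := i ⁻¹ᵁ U) hU m).symm

theorem exists_preimage_eq (V : C.Opens) : ∃ U : X.Opens, i ⁻¹ᵁ U = V := by
  obtain ⟨U, hU, hUV⟩ := i.isClosedEmbedding.isInducing.isOpen_iff.1 V.2
  exact ⟨⟨U, hU⟩, Opens.ext hUV⟩

instance : (Scheme.Modules.pushforward i).Faithful where
  map_injective {G H f g} h := hom_eq_of_stalkHom_eq fun c m => by
    obtain ⟨m, rfl⟩ := (pushStalk_bijective i G c).2 m
    rw [← pushStalk_stalkHom, h, pushStalk_stalkHom]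

/-- The stalk maps of φ at the points i c are linear over the local rings of C because the ring maps
on stalks are surjective. They come from a morphism on C, since every open of C is a preimage. -/
instance : (Scheme.Modules.pushforward i).Full where
  map_surjective {G H} φ := by
    let e := fun c => (Equiv.ofBijective _ (pushStalk_bijective i G c))
    have he : ∀ c m, e c m = pushStalk i G c m := fun _ _ => rfl
    have key : ∀ (U : X.Opens) (m : Γ(G, i ⁻¹ᵁ U)) (c : C) (hc : c ∈ i ⁻¹ᵁ U),
        H.presheaf.germ (i ⁻¹ᵁ U) c hc (φ.app U m) =
          pushStalk i H c (stalkHom φ (i c) ((e c).symm (G.presheaf.germ (i ⁻¹ᵁ U) c hc m))) := by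
      intro U m c hc
      refine (pushStalk_germ i H hc (φ.app U m)).symm.trans ?_
      refine congrArg (pushStalk i H c) ?_
      refine (stalkHom_germ φ hc m).symm.trans ?_
      refine congrArg (stalkHom φ (i c)) ?_
      rw [Equiv.eq_symm_apply]
      exact pushStalk_germ i G hc m
    obtain ⟨f, hf⟩ := exists_stalkHom_eq_of_local (M := G) (N := H) (fun c =>
      { toFun := fun m => pushStalk i H c (stalkHom φ (i c) ((e c).symm m))
        map_add' := fun m m' => by
          obtain ⟨m, rfl⟩ := (e c).surjective m
          obtain ⟨m', rfl⟩ := (e c).surjective m'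
          have : (e c).symm (e c m + e c m') = m + m' := by
            rw [Equiv.symm_apply_eq, he, he, he, map_add]
          rw [this, map_add, map_add, Equiv.symm_apply_apply, Equiv.symm_apply_apply]
        map_smul' := fun r m => by
          obtain ⟨m, rfl⟩ := (e c).surjective m
          obtain ⟨a, rfl⟩ := i.stalkMap_surjective c r
          have : (e c).symm (i.stalkMap c a • e c m) = a • m := by
            rw [Equiv.symm_apply_eq, he, he, map_smulₛₗ]
          rw [this, map_smul, map_smulₛₗ, Equiv.symm_apply_apply]
          rfl }) fun V m x hx => by
        obtain ⟨U, rfl⟩ := exists_preimage_eq i V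
        exact ⟨_, hx, le_rfl, φ.app U m, fun y hy => key U m y hy⟩
    refine ⟨f, ?_⟩
    ext U m
    refine section_eq (N := H) (U := i ⁻¹ᵁ U) _ _ fun c hc => ?_
    refine Eq.trans ?_ (key U m c hc).symm
    exact (stalkHom_germ f (U := i ⁻¹ᵁ U) hc m).symm.trans (hf c _)

/-- The counit of the adjunction is invertible because the right adjoint is fully faithful. -/
theorem nonempty_pullback_iso {G : X.Modules} {G' : C.Modules}
    (e : G ≅ (Scheme.Modules.pushforward i).obj G') :
    Nonempty ((Scheme.Modules.pullback i).obj G ≅ G') :=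
  have := (Scheme.Modules.pullbackPushforwardAdjunction i).counit_isIso_of_R_fully_faithful
  ⟨(Scheme.Modules.pullback i).mapIso e ≪≫
    asIso ((Scheme.Modules.pullbackPushforwardAdjunction i).counit.app G')⟩

end Pushforward

/-! ### Descending to C a sheaf annihilated by the ideal of C -/

variable {X C : Scheme.{u}} (i : C ⟶ X) [IsClosedImmersion i] (G : X.Modules)

/-- The stalks of `G` on `C` are annihilated by the kernels of the projections. -/
def IsKilled : Prop := ∀ (c : C) (a : X.presheaf.stalk (i c)), i.stalkMap c a = 0 →
  ∀ m : StalkAt G (i c), a • m = 0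

variable {i G}

/-- The stalk of `G` at a point of `C`. -/
def ReducedStalk (_ : IsKilled i G) (c : C) : Type u := StalkAt G (i c)

variable (hG : IsKilled i G)

instance (c : C) : AddCommGroup (ReducedStalk hG c) :=
  inferInstanceAs (AddCommGroup (StalkAt G (i c)))

instance (c : C) : Module (C.presheaf.stalk c) (ReducedStalk hG c) :=
  Thickening.Mod.moduleOfSurjective (N := StalkAt G (i c)) (i.stalkMap c).hom
    (i.stalkMap_surjective c) (hG c)

theorem stalkMap_smul (c : C) (a : X.presheaf.stalk (i c)) (m : StalkAt G (i c)) :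
    (i.stalkMap c a • (show ReducedStalk hG c from m) : ReducedStalk hG c) = a • m :=
  Thickening.Mod.moduleOfSurjective_smul (N := StalkAt G (i c)) (i.stalkMap c).hom
    (i.stalkMap_surjective c) (hG c) a m

/-- The functions on opens of `C` that are locally given by the germs of a section of `G`. -/
def germPredicate : TopCat.LocalPredicate (ReducedStalk hG) where
  pred {V} t := ∀ c : V, ∃ (U : X.Opens) (_ : i c.1 ∈ U) (m : Γ(G, U)), ∀ (y : V) (hy : i y.1 ∈ U),
    t y = G.presheaf.germ U (i y.1) hy m
  res f t h c := by
    obtain ⟨U, hU, m, hm⟩ := h (f c)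
    exact ⟨U, hU, m, fun y hy => hm (f y) hy⟩
  locality {V} t h c := by
    obtain ⟨W, hcW, f, hW⟩ := h c
    obtain ⟨U, hU, m, hm⟩ := hW ⟨c, hcW⟩
    obtain ⟨U', rfl⟩ := exists_preimage_eq i W
    refine ⟨U ⊓ U', ⟨hU, hcW⟩, G.presheaf.map (Opens.infLELeft U U').op m, fun y hy => ?_⟩
    refine (hm ⟨y.1, hy.2⟩ hy.1).trans ?_
    exact (G.presheaf.germ_res_apply (Opens.infLELeft U U') (i y.1) hy m).symm

/-- The group of sections of the restriction of `G` to `C`. -/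
def germSections (V : C.Opens) : AddSubgroup (∀ c : V, ReducedStalk hG c.1) where
  carrier := {t | (germPredicate hG).pred t}
  add_mem' {s t} hs ht c := by
    obtain ⟨U, hU, m, hm⟩ := hs c
    obtain ⟨U', hU', m', hm'⟩ := ht c
    refine ⟨U ⊓ U', ⟨hU, hU'⟩, G.presheaf.map (Opens.infLELeft U U').op m +
      G.presheaf.map (Opens.infLERight U U').op m', fun y hy => ?_⟩
    rw [map_add, TopCat.Presheaf.germ_res_apply, TopCat.Presheaf.germ_res_apply]
    exact congrArg₂ (· + ·) (hm y hy.1) (hm' y hy.2)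
  zero_mem' c := ⟨⊤, trivial, 0, fun y hy => (map_zero _).symm⟩
  neg_mem' {s} hs c := by
    obtain ⟨U, hU, m, hm⟩ := hs c
    refine ⟨U, hU, -m, fun y hy => ?_⟩
    rw [map_neg]
    exact congrArg Neg.neg (hm y hy)

instance (V : C.Opens) : Module Γ(C, V) (germSections hG V) where
  smul r t := ⟨fun c => C.presheaf.germ V c c.2 r • t.1 c, fun c => by
    obtain ⟨U, hU, m, hm⟩ := t.2 c
    -- The section r of the structure sheaf of C lifts to X only locally. Multiplying a local
    -- representative of t by such a lift represents r • t near c.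
    obtain ⟨a, ha⟩ := i.stalkMap_surjective c.1 (C.presheaf.germ V c.1 c.2 r)
    obtain ⟨U', hU', a, rfl⟩ := X.presheaf.exists_germ_eq a
    have ha' : C.presheaf.germ (i ⁻¹ᵁ U') c.1 hU' (i.app U' a) = C.presheaf.germ V c.1 c.2 r :=
      (Scheme.Hom.germ_stalkMap_apply i U' c.1 hU' a).symm.trans ha
    obtain ⟨W, hW, f, g, hfg⟩ := C.presheaf.germ_eq c.1 hU' c.2 _ _ ha'
    obtain ⟨W', rfl⟩ := exists_preimage_eq i W
    let f₁ : U ⊓ U' ⊓ W' ⟶ U := homOfLE (inf_le_left.trans inf_le_left)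
    let f₂ : U ⊓ U' ⊓ W' ⟶ U' := homOfLE (inf_le_left.trans inf_le_right)
    refine ⟨U ⊓ U' ⊓ W', ⟨⟨hU, hU'⟩, hW⟩, X.presheaf.map f₂.op a • G.presheaf.map f₁.op m,
      fun y hy => ?_⟩
    have h1 : i.stalkMap y.1 (X.presheaf.germ U' (i y.1) hy.1.2 a) =
        C.presheaf.germ V y.1 y.2 r := by
      refine (Scheme.Hom.germ_stalkMap_apply i U' y.1 hy.1.2 a).trans ?_
      refine (C.presheaf.germ_res_apply f y.1 hy.2 _).symm.trans ?_
      refine (congrArg (C.presheaf.germ (i ⁻¹ᵁ W') y.1 hy.2) hfg).trans ?_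
      exact C.presheaf.germ_res_apply g y.1 hy.2 _
    refine Eq.trans ?_ (germ_smul_stalk G (i y.1) _ hy _ _).symm
    rw [TopCat.Presheaf.germ_res_apply, TopCat.Presheaf.germ_res_apply]
    refine Eq.trans ?_ (stalkMap_smul hG y.1 _ _)
    exact congrArg₂ (· • ·) h1.symm (hm y hy.1.1)⟩
  one_smul t := Subtype.ext <| funext fun c => by
    change C.presheaf.germ V c c.2 1 • t.1 c = t.1 c
    rw [map_one, one_smul]
  mul_smul a b t := Subtype.ext <| funext fun c => by
    change C.presheaf.germ V c c.2 (a * b) • t.1 c =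
      C.presheaf.germ V c c.2 a • C.presheaf.germ V c c.2 b • t.1 c
    rw [map_mul, mul_smul]
  smul_zero a := Subtype.ext <| funext fun c => smul_zero (C.presheaf.germ V c c.2 a)
  smul_add a s t := Subtype.ext <| funext fun c =>
    smul_add (C.presheaf.germ V c c.2 a) (s.1 c) (t.1 c)
  add_smul a b t := Subtype.ext <| funext fun c => by
    change C.presheaf.germ V c c.2 (a + b) • t.1 c =
      C.presheaf.germ V c c.2 a • t.1 c + C.presheaf.germ V c c.2 b • t.1 c
    rw [map_add, add_smul]
  zero_smul t := Subtype.ext <| funext fun c => by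
    change C.presheaf.germ V c c.2 0 • t.1 c = 0
    rw [map_zero, zero_smul]

/-- The restriction of `G` to `C`, as a presheaf of abelian groups. -/
def germPresheaf : TopCat.Presheaf Ab.{u} C where
  obj V := AddCommGrpCat.of (germSections hG V.unop)
  map f := AddCommGrpCat.ofHom
    { toFun := fun t => ⟨fun c => t.1 (f.unop c), (germPredicate hG).res f.unop t.1 t.2⟩
      map_zero' := rfl
      map_add' := fun _ _ => rfl }

instance (V : (Opens C)ᵒᵖ) :
    Module (C.ringCatSheaf.obj.obj V) ((germPresheaf hG).obj V) :=
  inferInstanceAs (Module Γ(C, V.unop) (germSections hG V.unop))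

/-- The restriction of `G` to `C`. -/
def germSheaf : C.Modules where
  val := PresheafOfModules.ofPresheaf (R := C.ringCatSheaf.obj) (germPresheaf hG)
    fun U V f a t => Subtype.ext <| funext fun c => by
      change C.presheaf.germ U.unop (f.unop c) (f.unop c).2 a • t.1 (f.unop c) =
        C.presheaf.germ V.unop c c.2 (C.presheaf.map f a) • t.1 (f.unop c)
      congr 1
      exact (C.presheaf.germ_res_apply f.unop c.1 c.2 a).symm
  isSheaf := (TopCat.Presheaf.isSheaf_iff_isSheaf_comp (forget AddCommGrpCat)
      (germPresheaf hG)).2 (TopCat.subpresheafToTypes.isSheaf (germPredicate hG))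

include hG in
-- Since i hits every point of X, a section of G is the same as a compatible function of germs along
-- C, and these functions form the sections of `germSheaf`.
theorem isSheafOn_of_isKilled [Surjective i] : IsSheafOn i G := by
  refine ⟨germSheaf hG, nonempty_iso_of_bijective (fun U =>
    { toFun := fun m => (⟨fun c => G.presheaf.germ U (i c.1) c.2 m, fun c =>
        ⟨U, c.2, m, fun _ _ => rfl⟩⟩ : germSections hG (i ⁻¹ᵁ U))
      map_add' := fun m m' => Subtype.ext <| funext fun c => map_add _ m m'
      map_smul' := fun r m => Subtype.ext <| funext fun c => ?_ })
    (fun U V f m => Subtype.ext <| funext fun c => ?_) fun U => ⟨fun m m' h => ?_, fun t => ?_⟩⟩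
  · refine (germ_smul_stalk G (i c.1) U c.2 r m).trans ?_
    refine (stalkMap_smul hG c.1 _ _).symm.trans ?_
    exact congrArg (· • (show ReducedStalk hG c.1 from G.presheaf.germ U (i c.1) c.2 m))
      (Scheme.Hom.germ_stalkMap_apply i U c.1 c.2 r)
  · exact G.presheaf.germ_res_apply f (i c.1) c.2 m
  · refine section_eq _ _ fun x hx => ?_
    obtain ⟨c, rfl⟩ := i.surjective x
    exact congrArg (fun t : germSections hG (i ⁻¹ᵁ U) => t.1 ⟨c, hx⟩) h
  · let t' : germSections hG (i ⁻¹ᵁ U) := t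
    have h1 : ∀ x : U, ∃ (V : X.Opens) (_ : x.1 ∈ V) (m : Γ(G, V)), ∀ (y : i ⁻¹ᵁ U)
        (hy : i y.1 ∈ V), t'.1 y = G.presheaf.germ V (i y.1) hy m := fun ⟨x, hx⟩ => by
      obtain ⟨c, rfl⟩ := i.surjective x
      exact t'.2 ⟨c, hx⟩
    choose V hV m hm using h1
    obtain ⟨s, hs⟩ := exists_section_germ_eq G (U := U)
      (fun x => G.presheaf.germ (V x) x.1 (hV x) (m x)) fun x => by
        refine ⟨V x ⊓ U, ⟨hV x, x.2⟩, inf_le_right,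
          G.presheaf.map (homOfLE inf_le_left).op (m x), fun y hy => ?_⟩
        obtain ⟨c, rfl⟩ := i.surjective y
        refine (G.presheaf.germ_res_apply (homOfLE inf_le_left) (i c) hy (m x)).trans ?_
        exact (hm x ⟨c, hy.2⟩ hy.1).symm.trans (hm ⟨i c, hy.2⟩ ⟨c, hy.2⟩ (hV _))
    refine ⟨s, Subtype.ext <| funext fun c => ?_⟩
    exact (hs ⟨i c.1, c.2⟩).trans (hm ⟨i c.1, c.2⟩ c (hV _)).symm

/-! ### Coherent sheaves: finite stalks and localization -/

section Coherent

variable {X : Scheme.{u}} {E : X.Modules}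

theorem IsCoherent.exists_finite_span (hE : IsCoherent E) (x : X) :
    ∃ (U : X.Opens) (_ : x ∈ U) (S : Set Γ(E, U)), S.Finite ∧ ∀ (y : X) (hy : y ∈ U),
      Submodule.span (X.presheaf.stalk y) ((E.presheaf.germ U y hy : Γ(E, U) → StalkAt E y) '' S) =
        ⊤ := by
  obtain ⟨U, -, hx, hL, hfin⟩ := exists_finite_of_isCoherent hE x
  obtain ⟨S, hS⟩ := hfin.fg_top
  refine ⟨U, hx, S, S.finite_toSet, fun y hy => eq_top_iff.2 fun w _ => ?_⟩
  obtain ⟨s, m, hs, hm⟩ := hL.exists_germ_eq y hy w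
  rw [← (Submodule.smul_mem_iff_of_isUnit _ hs), ← hm]
  have hmS : m ∈ Submodule.span Γ(X, U) (S : Set Γ(E, U)) := hS ▸ Submodule.mem_top
  clear hm
  induction hmS using Submodule.span_induction with
  | mem m hm => exact Submodule.subset_span ⟨m, hm, rfl⟩
  | zero => rw [map_zero]; exact zero_mem _
  | add a b _ _ ha hb => rw [map_add]; exact add_mem ha hb
  | smul r a _ ha => rw [germ_smul_stalk]; exact Submodule.smul_mem _ _ ha

theorem IsCoherent.finite_stalk (hE : IsCoherent E) (x : X) :
    Module.Finite (X.presheaf.stalk x) (StalkAt E x) := by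
  obtain ⟨U, hx, S, hS, h⟩ := hE.exists_finite_span x
  exact ⟨⟨(hS.image _).toFinset, by rw [Set.Finite.coe_toFinset]; exact h x hx⟩⟩

/-- Together with `IsCoherent.exists_specializeStalk_eq`, this expresses the stalk at the
generization y as a localization of the stalk at x. Both stalks are localizations of the sections
over one affine open. -/
theorem IsCoherent.exists_smul_eq_zero (hE : IsCoherent E) {x y : X} (h : y ⤳ x)
    (m : StalkAt E x) (hm : specializeStalk E h m = 0) :
    ∃ a, IsUnit (X.presheaf.stalkSpecializes h a) ∧ a • m = 0 := by
  obtain ⟨U, -, hx, hL, -⟩ := exists_finite_of_isCoherent hE x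
  have hy : y ∈ U := h.mem_open U.2 hx
  obtain ⟨s, n, hs, hn⟩ := hL.exists_germ_eq x hx m
  obtain ⟨t, ht, htn⟩ := hL.exists_smul_eq_zero y hy n (by
    refine (specializeStalk_germ E h hx n).symm.trans ?_
    rw [hn, map_smulₛₗ, hm, smul_zero])
  refine ⟨X.presheaf.germ U x hx t * X.presheaf.germ U x hx s, ?_, ?_⟩
  · rw [map_mul, TopCat.Presheaf.germ_stalkSpecializes_apply]
    exact ht.mul (hs.map (X.presheaf.stalkSpecializes h).hom)
  · rw [mul_smul, ← hn, ← germ_smul_stalk, htn, map_zero]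

theorem IsCoherent.exists_specializeStalk_eq (hE : IsCoherent E) {x y : X} (h : y ⤳ x)
    (w : StalkAt E y) : ∃ a, IsUnit (X.presheaf.stalkSpecializes h a) ∧
      ∃ m, specializeStalk E h m = X.presheaf.stalkSpecializes h a • w := by
  obtain ⟨U, -, hx, hL, -⟩ := exists_finite_of_isCoherent hE x
  have hy : y ∈ U := h.mem_open U.2 hx
  obtain ⟨s, n, hs, hn⟩ := hL.exists_germ_eq y hy w
  refine ⟨X.presheaf.germ U x hx s, ?_, E.presheaf.germ U x hx n, ?_⟩
  · rw [TopCat.Presheaf.germ_stalkSpecializes_apply]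
    exact hs
  · rw [specializeStalk_germ, TopCat.Presheaf.germ_stalkSpecializes_apply]
    exact hn

end Coherent

/-! ### The thickening given by the stalks of X along C -/

section Stalkwise

variable {X C : Scheme.{u}} [IsIntegral C] (i : C ⟶ X) [IsClosedImmersion i]

theorem specializes_genericPoint (c : C) : i (genericPoint C) ⤳ i c :=
  ((genericPoint_spec C).specializes trivial).map i.continuous

theorem stalkMap_stalkSpecializes (c : C) (a : X.presheaf.stalk (i c)) :
    i.stalkMap (genericPoint C) (X.presheaf.stalkSpecializes (specializes_genericPoint i c) a) =
      algebraMap (C.presheaf.stalk c) C.functionField (i.stalkMap c a) :=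
  congrArg (fun φ => φ.hom a) (Scheme.Hom.stalkSpecializes_stalkMap i (genericPoint C) c
    ((genericPoint_spec C).specializes trivial))

/-- The map from the local ring of X at the generic point to the function field is local, so units
there are detected by being nonzero. Thus the geometric denominators are exactly those allowed in
`Thickening.Mod`. -/
theorem isUnit_stalkSpecializes_iff (c : C) (a : X.presheaf.stalk (i c)) :
    IsUnit (X.presheaf.stalkSpecializes (specializes_genericPoint i c) a) ↔
      i.stalkMap c a ≠ 0 := by
  rw [← isUnit_map_iff (i.stalkMap (genericPoint C)).hom]
  have h1 := stalkMap_stalkSpecializes i c a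
  refine (iff_of_eq (congrArg IsUnit h1)).trans ?_
  rw [isUnit_iff_ne_zero]
  exact map_ne_zero_iff _ (IsFractionRing.injective (C.presheaf.stalk c) C.functionField)

variable [∀ c : C, IsPrincipalIdealRing (C.presheaf.stalk c)] [IsLocallyNoetherian X]

/-- The stalks of `𝒪_X` at the points of `C`. -/
def thickening : Thickening.{u} (fun c : C => (C.presheaf.stalk c : Type u)) C.functionField where
  A c := X.presheaf.stalk (i c)
  A' := X.presheaf.stalk (i (genericPoint C))
  sp c := (X.presheaf.stalkSpecializes (specializes_genericPoint i c)).hom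
  π c := (i.stalkMap c).hom
  π' := (i.stalkMap (genericPoint C)).hom
  surjective c := i.stalkMap_surjective c
  surjective' := i.stalkMap_surjective (genericPoint C)
  comm c a := stalkMap_stalkSpecializes i c a

variable {E : X.Modules}

/-- The stalks of `E` at the points of `C`. -/
def stalkMod (hE : IsCoherent E) : (thickening i).Mod :=
  have := hE.finite_stalk
  { E := fun c => StalkAt E (i c)
    E' := StalkAt E (i (genericPoint C))
    module := fun c => stalkModule E (i c)
    module' := stalkModule E (i (genericPoint C))
    finite := fun c => this (i c)
    sp := fun c => specializeStalk E (specializes_genericPoint i c)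
    exists_smul_eq_zero := fun c m hm => by
      obtain ⟨a, ha, h⟩ := hE.exists_smul_eq_zero _ m hm
      exact ⟨a, (isUnit_stalkSpecializes_iff i c a).1 ha, h⟩ }

variable (hE : IsCoherent E)

/-- A family of submodules of the stalks of `E`, at the points of `C`. -/
def stalkSub (P : ∀ x, Submodule (X.presheaf.stalk x) (StalkAt E x)) : (stalkMod i hE).Sub :=
  ⟨fun c => P (i c), P (i (genericPoint C))⟩

/-- The stalks of the image of `f`. -/
def rangeSub {M : X.Modules} (f : M ⟶ E) : (stalkMod i hE).Sub :=
  stalkSub i hE fun x => LinearMap.range (stalkHom f x)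

theorem isGood_rangeSub {M : X.Modules} (hM : IsCoherent M) (f : M ⟶ E) :
    Thickening.Mod.IsGood (rangeSub i hE f) where
  map_mem c m hm := by
    obtain ⟨n, rfl⟩ := hm
    exact ⟨_, stalkHom_specializeStalk f (specializes_genericPoint i c) n⟩
  exists_smul_mem c w hw := by
    obtain ⟨v, rfl⟩ := hw
    obtain ⟨a, ha, n, hn⟩ := hM.exists_specializeStalk_eq (specializes_genericPoint i c) v
    refine ⟨a, (isUnit_stalkSpecializes_iff i c a).1 ha, stalkHom f (i c) n, ⟨n, rfl⟩, ?_⟩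
    refine (stalkHom_specializeStalk f (specializes_genericPoint i c) n).symm.trans ?_
    rw [hn]
    exact map_smul _ _ _

end Stalkwise

end

/-- The product of the denominators belonging to finitely many generators of J works for all of J.
This makes annihilators compatible with localization. -/
theorem exists_mul_smul_eq_zero {A N : Type*} [CommRing A] [AddCommGroup N] [Module A N]
    {J : Ideal A} (hJ : J.FG) (S : Submonoid A) (m : N)
    (h : ∀ a ∈ J, ∃ b ∈ S, b • a • m = 0) : ∃ b ∈ S, ∀ a ∈ J, a • b • m = 0 := by
  obtain ⟨s, rfl⟩ := hJ
  classical
  choose! b hb hbm using h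
  refine ⟨∏ a ∈ s, b a, prod_mem fun a ha => hb a (Ideal.subset_span ha), fun a ha => ?_⟩
  induction ha using Submodule.span_induction with
  | mem a ha =>
    rw [smul_comm, ← Finset.prod_erase_mul _ _ ha, mul_smul, hbm a (Ideal.subset_span ha), smul_zero]
  | zero => rw [zero_smul]
  | add x y _ _ hx hy => rw [add_smul, hx, hy, add_zero]
  | smul r x _ hx => rw [smul_assoc, hx, smul_zero]

theorem smul_eq_zero_of_mem_map {A B N : Type*} [CommRing A] [CommRing B] [AddCommGroup N]
    [Module B N] (f : A →+* B) (J : Ideal A) (m : N) (h : ∀ a ∈ J, f a • m = 0) :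
    ∀ b ∈ J.map f, b • m = 0 := by
  intro b hb
  induction hb using Submodule.span_induction with
  | mem a ha =>
    obtain ⟨a, ha, rfl⟩ := ha
    exact h a ha
  | zero => rw [zero_smul]
  | add x y _ _ hx hy => rw [add_smul, hx, hy, add_zero]
  | smul r x _ hx => rw [smul_assoc, hx, smul_zero]

/-! ### Quotients of good families in arbitrary models -/

namespace Thickening.Mod

variable {I : Type*} {O : I → Type*} [∀ x, CommRing (O x)] [∀ x, IsDomain (O x)]
  [∀ x, IsPrincipalIdealRing (O x)] [∀ x, IsLocalRing (O x)] {K : Type*} [Field K]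
  [∀ x, Algebra (O x) K] [∀ x, IsFractionRing (O x) K] {T : Thickening.{u} O K} {M M₂ : T.Mod}

/-- The lattice property of the literal quotients holds for any model of them. It is applied to the
stalks of the sheaf on C obtained from a graded piece. -/
theorem isLattice_of_surjective {P Q : M.Sub} (hP : IsGood P) (hQ : IsGood Q) {x : I}
    {N W : Type*} [AddCommGroup N] [Module (O x) N] [AddCommGroup W] [Module K W]
    {φ : N →ₛₗ[algebraMap (O x) K] W} (p : Q.1 x →ₛₗ[T.π x] N) (p' : Q.2 →ₛₗ[T.π'] W)
    (hp : Function.Surjective p) (hp' : Function.Surjective p')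
    (ker : ∀ m, p m = 0 ↔ (m : M.E x) ∈ P.1 x) (ker' : ∀ m, p' m = 0 ↔ (m : M.E') ∈ P.2)
    (comm : ∀ (m : Q.1 x) (w : Q.2), M.sp x m = w → φ (p m) = p' w) : IsLattice φ where
  finite := by
    obtain ⟨s, hs⟩ := (inferInstance : Module.Finite (T.A x) (Q.1 x)).fg_top
    classical
    refine ⟨⟨s.image p, eq_top_iff.2 fun n _ => ?_⟩⟩
    obtain ⟨m, rfl⟩ := hp n
    have hm : m ∈ Submodule.span (T.A x) (s : Set (Q.1 x)) := hs ▸ Submodule.mem_top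
    induction hm using Submodule.span_induction with
    | mem y hy => exact Submodule.subset_span (by rw [Finset.coe_image]; exact ⟨y, hy, rfl⟩)
    | zero => rw [map_zero]; exact zero_mem _
    | add y z _ _ hy hz => rw [map_add]; exact add_mem (hy trivial) (hz trivial)
    | smul r y _ hy => rw [map_smulₛₗ]; exact Submodule.smul_mem _ _ (hy trivial)
  exists_smul_eq_zero n hn := by
    obtain ⟨n, rfl⟩ := hp n
    have hn' : M.sp x n.1 ∈ P.2 :=
      (ker' ⟨_, hQ.map_mem x n n.2⟩).1 ((comm n ⟨_, hQ.map_mem x n n.2⟩ rfl).symm.trans hn)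
    obtain ⟨a, ha, m, hm, hma⟩ := hP.exists_smul_mem x _ hn'
    obtain ⟨c, hc, hcm⟩ := M.exists_smul_eq_zero x (a • n.1 - m) (by
      rw [map_sub, map_smulₛₗ, hma, sub_self])
    rw [smul_sub, sub_eq_zero] at hcm
    refine ⟨T.π x (c * a), by rw [map_mul]; exact mul_ne_zero hc ha, ?_⟩
    rw [← map_smulₛₗ, ker]
    change (c * a) • n.1 ∈ P.1 x
    rw [mul_smul, hcm]
    exact Submodule.smul_mem _ _ hm
  exists_smul_mem_range w := by
    obtain ⟨w, rfl⟩ := hp' w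
    obtain ⟨a, ha, m, hm, hma⟩ := hQ.exists_smul_mem x w.1 w.2
    refine ⟨T.π x a, ha, p ⟨m, hm⟩, ?_⟩
    rw [← T.comm, ← map_smulₛₗ]
    exact comm ⟨m, hm⟩ (T.sp x a • w) hma

theorem quotCls_congr [Nonempty I] {P Q : M.Sub} {P₂ Q₂ : M₂.Sub} (hP : IsGood P) (hQ : IsGood Q)
    (hPQ : IsThin P Q) (hP₂ : IsGood P₂) (hQ₂ : IsGood Q₂) (hPQ₂ : IsThin P₂ Q₂)
    (h : ∀ x, M.E x →ₗ[T.A x] M₂.E x)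
    (h' : M.E' →ₗ[T.A'] M₂.E') (hh : ∀ x m, M₂.sp x (h x m) = h' (M.sp x m))
    (hQQ : ∀ x, ∀ m ∈ Q.1 x, h x m ∈ Q₂.1 x) (hQQ' : ∀ m ∈ Q.2, h' m ∈ Q₂.2)
    (hPP : ∀ x, ∀ m ∈ Q.1 x, h x m ∈ P₂.1 x ↔ m ∈ P.1 x)
    (hPP' : ∀ m ∈ Q.2, h' m ∈ P₂.2 ↔ m ∈ P.2)
    (hs : ∀ x, ∀ m ∈ Q₂.1 x, ∃ n ∈ Q.1 x, m - h x n ∈ P₂.1 x)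
    (hs' : ∀ m ∈ Q₂.2, ∃ n ∈ Q.2, m - h' n ∈ P₂.2) : quotCls P Q = quotCls P₂ Q₂ := by
  obtain ⟨F, ⟨r⟩⟩ := exists_realizes hP hQ hPQ
  obtain ⟨F₂, ⟨r₂⟩⟩ := exists_realizes hP₂ hQ₂ hPQ₂
  rw [← r.cls_eq_quotCls hQ, ← r₂.cls_eq_quotCls hQ₂]
  exact r.cls_eq r₂ hQ h h' hh hQQ hQQ' hPP hPP' hs hs'

end Thickening.Mod

noncomputable section

/-! ### The members of the second canonical filtration -/

section Killed

variable {X C : Scheme.{u}} [IsIntegral C] (i : C ⟶ X) [IsClosedImmersion i]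
  [IsLocallyNoetherian X] (E : X.Modules)

/-- Near each point, `M` is generated by finitely many sections. -/
def IsLocallyFinitelyGenerated {X : Scheme.{u}} (M : X.Modules) : Prop :=
  ∀ x, ∃ (U : X.Opens) (_ : x ∈ U) (S : Set Γ(M, U)), S.Finite ∧ ∀ (y : X) (hy : y ∈ U),
    Submodule.span (X.presheaf.stalk y) ((M.presheaf.germ U y hy : Γ(M, U) → StalkAt M y) '' S) = ⊤

/-- The submodule of the stalk of `E` annihilated by the `k`-th power of the ideal of `C`. -/
def killedStalk (k : ℕ) (c : C) : Submodule (X.presheaf.stalk (i c)) (StalkAt E (i c)) where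
  carrier := {m | ∀ a ∈ RingHom.ker (i.stalkMap c).hom ^ k, a • m = 0}
  add_mem' hs ht a ha := by rw [smul_add, hs a ha, ht a ha, add_zero]
  zero_mem' a _ := smul_zero a
  smul_mem' r s hs a ha := by rw [smul_comm, hs a ha, smul_zero]

variable {E}

theorem germ_mem_killedStalk_iff {U : X.Opens} (hU : IsAffineOpen U) {c : C} (hc : i c ∈ U) (k : ℕ)
    (s : Γ(E, U)) : (E.presheaf.germ U (i c) hc s : StalkAt E (i c)) ∈ killedStalk i E k c ↔
      ∀ a ∈ RingHom.ker (i.app U).hom ^ k,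
        (E.presheaf.germ U (i c) hc (a • s) : StalkAt E (i c)) = 0 := by
  have h1 : RingHom.ker (i.stalkMap c).hom ^ k =
      (RingHom.ker (i.app U).hom ^ k).map (X.presheaf.germ U (i c) hc).hom := by
    rw [ker_stalkMap_eq_map i hU hc, Ideal.map_pow]
  constructor
  · intro h a ha
    rw [germ_smul_stalk]
    exact h _ (h1 ▸ Ideal.mem_map_of_mem _ ha)
  · intro h a ha
    rw [h1] at ha
    refine smul_eq_zero_of_mem_map _ _ _ (fun a ha => ?_) a ha
    exact (germ_smul_stalk E (i c) U hc a s).symm.trans (h a ha)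

theorem eventually_germ_eq_zero {X : Scheme.{u}} {E : X.Modules} {U : X.Opens} {x : X}
    (hx : x ∈ U) (s : Γ(E, U)) (h : (E.presheaf.germ U x hx s : StalkAt E x) = 0) :
    ∀ᶠ y in nhds x, ∀ hy : y ∈ U, (E.presheaf.germ U y hy s : StalkAt E y) = 0 := by
  obtain ⟨V, hV, f, hs⟩ := exists_map_eq_zero hx s h
  filter_upwards [V.2.mem_nhds hV] with y hyV hy
  rw [← E.presheaf.germ_res_apply f y hyV, hs]
  exact map_zero _

theorem germ_smul_eq_zero_of_mem_span {X : Scheme.{u}} {E : X.Modules} {U : X.Opens} {x : X}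
    (hx : x ∈ U) {s : Γ(E, U)} {t : Set Γ(X, U)}
    (h : ∀ a ∈ t, (E.presheaf.germ U x hx (a • s) : StalkAt E x) = 0) {a : Γ(X, U)}
    (ha : a ∈ Ideal.span t) : (E.presheaf.germ U x hx (a • s) : StalkAt E x) = 0 := by
  induction ha using Submodule.span_induction with
  | mem a ha => exact h a ha
  | zero => rw [zero_smul, map_zero]
  | add x y _ _ hx hy => rw [add_smul, map_add, hx, hy, add_zero]
  | smul r x _ hx => rw [smul_assoc, germ_smul_stalk, hx, smul_zero]

/-- Annihilation of a germ by a power of the ideal is a finite set of equations, one for each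
generator over a noetherian affine open, so it persists on a neighbourhood. -/
theorem range_stalkHom_killedIncl (k : ℕ) (c : C) :
    LinearMap.range (stalkHom (killedIncl i E k) (i c)) = killedStalk i E k c := by
  refine le_antisymm ?_ fun m hm => ?_
  · rintro _ ⟨n, rfl⟩
    obtain ⟨U, hU, n, rfl⟩ := (killedSheaf i E k).presheaf.exists_germ_eq n
    rw [stalkHom_germ]
    exact (show killedSections i E k U from n).2 c hU
  · obtain ⟨W, hW, m', hm'⟩ := E.presheaf.exists_germ_eq m
    obtain ⟨_, ⟨U, hU, rfl⟩, hcU, hUW⟩ :=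
      X.isBasis_affineOpens.exists_subset_of_mem_open hW W.2
    let s : Γ(E, U) := E.presheaf.map (homOfLE hUW).op m'
    have hs : E.presheaf.germ U (i c) hcU s = m :=
      (E.presheaf.germ_res_apply (homOfLE hUW) (i c) hcU m').trans hm'
    have : IsNoetherianRing Γ(X, U) := IsLocallyNoetherian.component_noetherian ⟨U, hU⟩
    obtain ⟨t, ht⟩ := (inferInstance : IsNoetherianRing Γ(X, U)).noetherian
      (RingHom.ker (i.app U).hom ^ k)
    have ht' : ∀ a ∈ t, ∀ᶠ y in nhds (i c), ∀ hy : y ∈ U,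
        (E.presheaf.germ U y hy (a • s) : StalkAt E y) = 0 := fun a ha =>
      eventually_germ_eq_zero hcU _ ((germ_mem_killedStalk_iff i hU hcU k s).1
        (by rw [hs]; exact hm) a (ht ▸ Ideal.subset_span ha))
    obtain ⟨V, hV, hVo, hcV⟩ := eventually_nhds_iff.1 ((Filter.eventually_all_finset t).2 ht')
    let V' : X.Opens := ⟨V, hVo⟩ ⊓ U
    have hs' : E.presheaf.map (homOfLE (inf_le_right : V' ≤ U)).op s ∈
        killedSections i E k V' :=
      (killedSections_iff_res i E _ s).2 fun y hy =>
        (germ_mem_killedStalk_iff i hU hy.2 k s).2 fun a ha =>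
          germ_smul_eq_zero_of_mem_span hy.2 (fun b hb => hV _ hy.1 b hb hy.2)
            (by rw [show Ideal.span (t : Set Γ(X, U)) = _ from ht]; exact ha)
    let n : Γ(killedSheaf i E k, V') := (⟨_, hs'⟩ : killedSections i E k V')
    refine ⟨(killedSheaf i E k).presheaf.germ V' (i c) ⟨hcV, hcU⟩ n, ?_⟩
    refine (stalkHom_germ (killedIncl i E k) (x := i c) (U := V') ⟨hcV, hcU⟩ n).trans ?_
    exact (E.presheaf.germ_res_apply (homOfLE (inf_le_right : V' ≤ U)) (i c) ⟨hcV, hcU⟩ s).trans hs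

variable [Surjective i]

/-- Over a noetherian affine open the killed sections form a submodule of a noetherian module. Their
generators also generate the stalks: up to units, every killed germ extends to a killed section over
the whole open. -/
theorem isLocallyFinitelyGenerated_killedSheaf (hE : IsCoherent E) (k : ℕ) :
    IsLocallyFinitelyGenerated (killedSheaf i E k) := by
  intro x
  obtain ⟨U, hU, hx, hL, hfin⟩ := exists_finite_of_isCoherent hE x
  have : IsNoetherianRing Γ(X, U) := IsLocallyNoetherian.component_noetherian ⟨U, hU⟩
  have : IsNoetherian Γ(X, U) Γ(E, U) := isNoetherian_of_isNoetherianRing_of_finite _ _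
  have : IsNoetherian Γ(X, U) (killedSections i E k U) := inferInstance
  obtain ⟨t, ht⟩ := this.noetherian ⊤
  let S : Set Γ(killedSheaf i E k, U) := (t : Set (killedSections i E k U))
  refine ⟨U, hx, S, t.finite_toSet, fun y hy => eq_top_iff.2 fun w _ => ?_⟩
  obtain ⟨c, rfl⟩ := i.surjective y
  have hw : stalkHom (killedIncl i E k) (i c) w ∈ killedStalk i E k c := by
    rw [← range_stalkHom_killedIncl]
    exact ⟨w, rfl⟩
  obtain ⟨s, m, hs, hm⟩ := hL.exists_germ_eq (i c) hy (stalkHom (killedIncl i E k) (i c) w)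
  have hmk : (E.presheaf.germ U (i c) hy m : StalkAt E (i c)) ∈ killedStalk i E k c := by
    rw [hm]
    exact Submodule.smul_mem _ _ hw
  rw [germ_mem_killedStalk_iff i hU hy] at hmk
  -- The section m is killed by the ideal only at i c. Multiplying by a single r, invertible there,
  -- makes it killed over all of U.
  obtain ⟨r, hr, hrm⟩ := exists_mul_smul_eq_zero
    ((inferInstance : IsNoetherianRing Γ(X, U)).noetherian (RingHom.ker (i.app U).hom ^ k))
    ((IsUnit.submonoid _).comap (X.presheaf.germ U (i c) hy).hom) m fun a ha => by
      obtain ⟨b, hb, hbm⟩ := hL.exists_smul_eq_zero (i c) hy (a • m) (hmk a ha)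
      exact ⟨b, hb, hbm⟩
  let n : Γ(killedSheaf i E k, U) := (⟨r • m, fun c' hc' =>
    (germ_mem_killedStalk_iff i hU hc' k _).2 fun a ha => by
      rw [hrm a ha, map_zero]⟩ : killedSections i E k U)
  have hn : (killedSheaf i E k).presheaf.germ U (i c) hy n =
      (X.presheaf.germ U (i c) hy r * X.presheaf.germ U (i c) hy s) • w := by
    refine stalkHom_injective (killedIncl i E k) (i c) ?_
    rw [map_smul]
    refine (stalkHom_germ (killedIncl i E k) hy n).trans ?_
    rw [mul_smul, ← hm]
    exact germ_smul_stalk E (i c) U hy r m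
  have hu : IsUnit (X.presheaf.germ U (i c) hy r * X.presheaf.germ U (i c) hy s) :=
    IsUnit.mul hr hs
  rw [← Submodule.smul_mem_iff_of_isUnit _ hu, ← hn]
  have hnt : (show killedSections i E k U from n) ∈ Submodule.span Γ(X, U)
    (t : Set (killedSections i E k U)) := ht ▸ Submodule.mem_top
  clear hn
  generalize n = n at hnt
  have key : ∀ n : killedSections i E k U, n ∈ Submodule.span Γ(X, U)
      (t : Set (killedSections i E k U)) → ((killedSheaf i E k).presheaf.germ U (i c) hy
        (show Γ(killedSheaf i E k, U) from n) : StalkAt (killedSheaf i E k) (i c)) ∈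
      Submodule.span (X.presheaf.stalk (i c)) (((killedSheaf i E k).presheaf.germ U (i c) hy :
        Γ(killedSheaf i E k, U) → StalkAt (killedSheaf i E k) (i c)) '' S) := fun n hn => by
    induction hn using Submodule.span_induction with
    | mem m hm => exact Submodule.subset_span ⟨m, hm, rfl⟩
    | zero =>
      have := map_zero ((killedSheaf i E k).presheaf.germ U (i c) hy).hom
      exact this ▸ zero_mem _
    | add a b _ _ ha hb =>
      have := map_add ((killedSheaf i E k).presheaf.germ U (i c) hy).hom a b
      exact this ▸ add_mem ha hb
    | smul r a _ ha =>
      have := germ_smul_stalk (killedSheaf i E k) (i c) U hy r a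
      exact this ▸ Submodule.smul_mem _ _ ha
  exact key n hnt

variable [∀ c : C, IsPrincipalIdealRing (C.presheaf.stalk c)]

/-- Localization commutes with annihilators of finitely generated ideals: a numerator m of a killed
generic element becomes killed itself after multiplication by one more denominator b. -/
theorem isGood_killed (hE : IsCoherent E) (k : ℕ) :
    Thickening.Mod.IsGood (rangeSub i hE (killedIncl i E k)) where
  map_mem c m hm := by
    obtain ⟨n, rfl⟩ := hm
    exact ⟨_, stalkHom_specializeStalk (killedIncl i E k) (specializes_genericPoint i c) n⟩
  exists_smul_mem c (w : StalkAt E (i (genericPoint C))) hw := by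
    have hw' : w ∈ killedStalk i E k (genericPoint C) := by
      rw [← range_stalkHom_killedIncl]
      exact hw
    obtain ⟨a, ha, m, hm⟩ := hE.exists_specializeStalk_eq (specializes_genericPoint i c) w
    obtain ⟨b, hb, hbm⟩ := exists_mul_smul_eq_zero
      ((inferInstance : IsNoetherianRing (X.presheaf.stalk (i c))).noetherian
        (RingHom.ker (i.stalkMap c).hom ^ k))
      ((IsUnit.submonoid _).comap (X.presheaf.stalkSpecializes (specializes_genericPoint i c)).hom)
      m fun r hr => by
        refine hE.exists_smul_eq_zero (specializes_genericPoint i c) (r • m) ?_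
        rw [map_smulₛₗ, hm, smul_comm]
        have : X.presheaf.stalkSpecializes (specializes_genericPoint i c) r ∈
            RingHom.ker (i.stalkMap (genericPoint C)).hom ^ k := by
          rw [ker_stalkMap_eq_map_stalkSpecializes i
            (show genericPoint C ⤳ c from (genericPoint_spec C).specializes trivial), ← Ideal.map_pow]
          exact Ideal.mem_map_of_mem _ hr
        exact (congrArg _ (hw' _ this)).trans (smul_zero _)
    refine ⟨b * a, ?_, b • m, ?_, ?_⟩
    · refine (isUnit_stalkSpecializes_iff i c _).1 ?_
      rw [map_mul]
      exact IsUnit.mul hb ha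
    · have h1 : b • m ∈ killedStalk i E k c := hbm
      rw [← range_stalkHom_killedIncl] at h1
      exact h1
    · have h1 := (specializeStalk E (specializes_genericPoint i c)).map_smulₛₗ b m
      refine h1.trans ?_
      rw [hm, ← mul_smul]
      exact congrArg (· • w) (map_mul _ b a).symm

theorem isThin_killed (hE : IsCoherent E) (k : ℕ) :
    Thickening.Mod.IsThin (rangeSub i hE (killedIncl i E k))
      (rangeSub i hE (killedIncl i E (k + 1))) := by
  have key : ∀ (c : C) (a : X.presheaf.stalk (i c)), i.stalkMap c a = 0 →
      ∀ m ∈ LinearMap.range (stalkHom (killedIncl i E (k + 1)) (i c)),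
        a • m ∈ LinearMap.range (stalkHom (killedIncl i E k) (i c)) := by
    intro c a ha m hm
    rw [range_stalkHom_killedIncl] at hm ⊢
    intro b hb
    rw [← mul_smul]
    exact hm _ (pow_succ (RingHom.ker (i.stalkMap c).hom) k ▸ Ideal.mul_mem_mul hb ha)
  exact ⟨key, key (genericPoint C)⟩

end Killed

/-! ### Triviality of determinants near the generic point -/

section GenericBasis

/-- A linear relation between germs involves finitely many sections and scalars, so it holds on a
neighbourhood. -/
theorem eventually_germ_mem_span {X : Scheme.{u}} {M : X.Modules} {U : X.Opens} {x : X}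
    (hx : x ∈ U) (S : Set Γ(M, U)) (m : Γ(M, U))
    (h : (M.presheaf.germ U x hx m : StalkAt M x) ∈ Submodule.span (X.presheaf.stalk x)
      ((M.presheaf.germ U x hx : Γ(M, U) → StalkAt M x) '' S)) :
    ∀ᶠ y in nhds x, ∀ hy : y ∈ U, (M.presheaf.germ U y hy m : StalkAt M y) ∈
      Submodule.span (X.presheaf.stalk y)
        ((M.presheaf.germ U y hy : Γ(M, U) → StalkAt M y) '' S) := by
  let Q : StalkAt M x → Prop := fun w => ∃ (V : X.Opens) (hxV : x ∈ V) (hVU : V ≤ U) (n : Γ(M, V)),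
    (M.presheaf.germ V x hxV n : StalkAt M x) = w ∧ ∀ (y : X) (hy : y ∈ V),
      (M.presheaf.germ V y hy n : StalkAt M y) ∈ Submodule.span (X.presheaf.stalk y)
        ((M.presheaf.germ U y (hVU hy) : Γ(M, U) → StalkAt M y) '' S)
  have key : ∀ w ∈ Submodule.span (X.presheaf.stalk x)
      ((M.presheaf.germ U x hx : Γ(M, U) → StalkAt M x) '' S), Q w := by
    intro w hw
    induction hw using Submodule.span_induction with
    | mem w hw =>
      obtain ⟨n, hn, rfl⟩ := hw
      exact ⟨U, hx, le_rfl, n, rfl, fun y hy => Submodule.subset_span ⟨n, hn, rfl⟩⟩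
    | zero => exact ⟨U, hx, le_rfl, 0, map_zero _, fun y hy => by
        rw [map_zero]
        exact zero_mem _⟩
    | add v w _ _ hv hw =>
      obtain ⟨V, hxV, hVU, n, rfl, hn⟩ := hv
      obtain ⟨W, hxW, hWU, l, rfl, hl⟩ := hw
      have hxVW : x ∈ V ⊓ W := ⟨hxV, hxW⟩
      refine ⟨V ⊓ W, hxVW, inf_le_left.trans hVU, M.presheaf.map (Opens.infLELeft V W).op n +
        M.presheaf.map (Opens.infLERight V W).op l, ?_, fun y hy => ?_⟩
      · rw [map_add, TopCat.Presheaf.germ_res_apply, TopCat.Presheaf.germ_res_apply]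
      · rw [map_add, TopCat.Presheaf.germ_res_apply, TopCat.Presheaf.germ_res_apply]
        exact add_mem (hn y hy.1) (hl y hy.2)
    | smul r w _ hw =>
      obtain ⟨V, hxV, hVU, n, rfl, hn⟩ := hw
      obtain ⟨W, hxW, r, rfl⟩ := X.presheaf.exists_germ_eq r
      have hxVW : x ∈ V ⊓ W := ⟨hxV, hxW⟩
      refine ⟨V ⊓ W, hxVW, inf_le_left.trans hVU, X.presheaf.map (Opens.infLERight V W).op r •
        M.presheaf.map (Opens.infLELeft V W).op n, ?_, fun y hy => ?_⟩
      · refine (germ_smul_stalk M x _ hxVW _ _).trans ?_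
        rw [TopCat.Presheaf.germ_res_apply, TopCat.Presheaf.germ_res_apply]
      · have h1 := germ_smul_stalk M y _ hy (X.presheaf.map (Opens.infLERight V W).op r)
          (M.presheaf.map (Opens.infLELeft V W).op n)
        rw [TopCat.Presheaf.germ_res_apply, TopCat.Presheaf.germ_res_apply] at h1
        exact h1 ▸ Submodule.smul_mem _ _ (hn y hy.1)
  obtain ⟨V, hxV, hVU, n, hn, hnS⟩ := key _ h
  obtain ⟨W, hxW, f, g, hfg⟩ := M.presheaf.germ_eq x hxV hx n m hn
  filter_upwards [W.2.mem_nhds hxW] with y hyW hy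
  have h1 : (M.presheaf.germ V y (f.le hyW) n : StalkAt M y) = M.presheaf.germ U y hy m := by
    rw [← M.presheaf.germ_res_apply f y hyW, hfg]
    exact M.presheaf.germ_res_apply g y hyW m
  exact h1 ▸ hnS y _

variable {C : Scheme.{u}} [IsIntegral C] [∀ c : C, IsPrincipalIdealRing (C.presheaf.stalk c)]

/-- The basis of the generic stalk extends to sections over an open set. The given finite set of
generators lies in their span generically, hence nearby, so these sections generate the nearby
stalks. -/
theorem exists_open_detIdeal_eq_one (D : C.Modules) (h : ∀ x, IsLattice (stalkToGeneric D x))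
    {U : C.Opens} (hU : genericPoint C ∈ U) (S : Set Γ(D, U)) (hS : S.Finite)
    (hSU : ∀ (y : C) (hy : y ∈ U), Submodule.span (C.presheaf.stalk y)
      ((D.presheaf.germ U y hy : Γ(D, U) → StalkAt D y) '' S) = ⊤) {r : ℕ}
    (b : Module.Basis (Fin r) C.functionField (StalkAt D (genericPoint C))) :
    ∃ V : C.Opens, genericPoint C ∈ V ∧ ∀ y ∈ V, detIdeal (stalkToGeneric D y) b = 1 := by
  have h1 : ∀ j, ∃ (W : C.Opens) (hW : genericPoint C ∈ W) (n : Γ(D, W)),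
      D.presheaf.germ W _ hW n = b j := fun j => D.presheaf.exists_germ_eq (b j)
  choose W hW n hn using h1
  obtain ⟨V, hV, hVo, hηV⟩ := eventually_nhds_iff.1 (Filter.eventually_all.2 fun j =>
    (W j).2.mem_nhds (hW j))
  let V' : C.Opens := ⟨V, hVo⟩ ⊓ U
  have hηV' : genericPoint C ∈ V' := ⟨hηV, hU⟩
  have hVW : ∀ j, V' ≤ W j := fun j y hy => hV y hy.1 j
  let n' : Fin r → Γ(D, V') := fun j => D.presheaf.map (homOfLE (hVW j)).op (n j)
  have hn' : ∀ j, D.presheaf.germ V' (genericPoint C) hηV' (n' j) = b j := fun j =>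
    (D.presheaf.germ_res_apply _ (genericPoint C) hηV' (n j)).trans (hn j)
  have hspan : Submodule.span (C.presheaf.stalk (genericPoint C))
      ((D.presheaf.germ V' (genericPoint C) hηV' : Γ(D, V') → StalkAt D (genericPoint C)) ''
        Set.range n') = ⊤ := by
    rw [← Set.range_comp]
    refine Eq.trans ?_ b.span_eq
    congr 2
    funext j
    exact hn' j
  have h2 : ∀ s ∈ S, ∀ᶠ y in nhds (genericPoint C), ∀ hy : y ∈ V',
      (D.presheaf.germ U y hy.2 s : StalkAt D y) ∈ Submodule.span (C.presheaf.stalk y)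
        ((D.presheaf.germ V' y hy : Γ(D, V') → StalkAt D y) '' Set.range n') := fun s _ => by
    filter_upwards [eventually_germ_mem_span (M := D) (U := V') hηV' (Set.range n')
      (D.presheaf.map (homOfLE inf_le_right).op s) (by rw [hspan]; trivial)] with y hyV hy
    have := hyV hy
    rwa [D.presheaf.germ_res_apply] at this
  obtain ⟨A, hA, hAo, hηA⟩ := eventually_nhds_iff.1 ((Filter.eventually_all_finite hS).2 h2)
  refine ⟨⟨A, hAo⟩ ⊓ V', ⟨hηA, hηV, hU⟩, fun y hy => ?_⟩
  have hy' : y ∈ V' := hy.2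
  have htop : Submodule.span (C.presheaf.stalk y)
      (Set.range fun j => (D.presheaf.germ V' y hy' (n' j) : StalkAt D y)) = ⊤ := by
    rw [eq_top_iff, ← hSU y hy'.2, Submodule.span_le]
    rintro _ ⟨s, hs, rfl⟩
    have := hA y hy.1 s hs hy'
    rwa [← Set.range_comp] at this
  -- Here L is the whole stalk and all c_i are 1, so the length is 0 and the formula reduces to
  -- triviality of the determinant ideal.
  obtain ⟨h3, h4⟩ := detIdeal_mul_pow (b := b) (h y)
    (fun j => (D.presheaf.germ V' y hy' (n' j) : StalkAt D y)) (c := fun _ => 1)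
    (fun _ => one_ne_zero) fun j => by
      rw [one_smul]
      exact (specializeStalk_germ D _ hy' (n' j)).trans (hn' j)
  rw [htop] at h4
  have h5 : Module.length (C.presheaf.stalk y)
      (StalkAt D y ⧸ (⊤ : Submodule (C.presheaf.stalk y) (StalkAt D y))) = 0 :=
    Module.length_eq_zero
  rw [h5] at h4
  simp only [ENat.toNat_zero, pow_zero, Ideal.one_eq_top, IsLocalization.coeSubmodule_top,
    Finset.prod_const_one, mul_one] at h4
  rw [h4, Submodule.one_eq_span]

end GenericBasis

/-! ### Determinants of graded pieces as classes of quotients -/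

section GradedPieces

variable {X C : Scheme.{u}} [IsIntegral C] (i : C ⟶ X) [IsClosedImmersion i]

theorem exists_stalkHom_eq_of_cokernel {A B : X.Modules} (a : A ⟶ B) [Mono a] (x : X)
    (m : StalkAt B x) (hm : stalkHom (cokernel.π a) x m = 0) : ∃ n, stalkHom a x n = m := by
  let S : ShortComplex X.Modules := ShortComplex.mk a (cokernel.π a) (cokernel.condition a)
  have hS : S.Exact := ShortComplex.exact_of_g_is_cokernel S (cokernelIsCokernel a)
  have : Mono S.f := inferInstanceAs (Mono a)
  exact exists_stalkHom_eq S hS x m hm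

/-- The projection of the stalks of `B` to those of a sheaf on `C`. -/
def reduceStalk {B : X.Modules} {D : C.Modules} (q : B ⟶ (Scheme.Modules.pushforward i).obj D)
    (c : C) : StalkAt B (i c) →ₛₗ[(i.stalkMap c).hom] StalkAt D c :=
  (pushStalk i D c).comp (stalkHom q (i c))

theorem reduceStalk_specializeStalk {B : X.Modules} {D : C.Modules}
    (q : B ⟶ (Scheme.Modules.pushforward i).obj D) (c : C) (m : StalkAt B (i c)) :
    reduceStalk i q (genericPoint C) (specializeStalk B (specializes_genericPoint i c) m) =
      stalkToGeneric D c (reduceStalk i q c m) := by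
  refine (congrArg (pushStalk i D (genericPoint C))
    (stalkHom_specializeStalk q (specializes_genericPoint i c) m)).trans ?_
  exact pushStalk_specializeStalk i D _ _

theorem reduceStalk_surjective {B : X.Modules} {D : C.Modules}
    (q : B ⟶ (Scheme.Modules.pushforward i).obj D) [Epi q] (c : C) :
    Function.Surjective (reduceStalk i q c) :=
  (pushStalk_bijective i D c).2.comp (stalkHom_surjective q (i c))

theorem exists_finite_span_of_epi {B : X.Modules} {D : C.Modules}
    (q : B ⟶ (Scheme.Modules.pushforward i).obj D) [Epi q] (hB : IsLocallyFinitelyGenerated B)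
    (c : C) : ∃ (U : C.Opens) (_ : c ∈ U) (S : Set Γ(D, U)), S.Finite ∧
      ∀ (y : C) (hy : y ∈ U), Submodule.span (C.presheaf.stalk y)
        ((D.presheaf.germ U y hy : Γ(D, U) → StalkAt D y) '' S) = ⊤ := by
  obtain ⟨U, hU, S, hS, h⟩ := hB (i c)
  refine ⟨i ⁻¹ᵁ U, hU, (q.app U : Γ(B, U) → Γ(D, i ⁻¹ᵁ U)) '' S, hS.image _, fun y hy => ?_⟩
  refine eq_top_iff.2 fun d _ => ?_
  obtain ⟨m, rfl⟩ := reduceStalk_surjective i q y d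
  have hm : m ∈ Submodule.span (X.presheaf.stalk (i y))
    ((B.presheaf.germ U (i y) hy : Γ(B, U) → StalkAt B (i y)) '' S) := h (i y) hy ▸ trivial
  induction hm using Submodule.span_induction with
  | mem m hm =>
    obtain ⟨s, hs, rfl⟩ := hm
    refine Submodule.subset_span ⟨q.app U s, ⟨s, hs, rfl⟩, ?_⟩
    refine (pushStalk_germ i D hy (q.app U s)).symm.trans ?_
    exact congrArg (pushStalk i D y) (stalkHom_germ q hy s).symm
  | zero => rw [map_zero]; exact zero_mem _
  | add a b _ _ ha hb => rw [map_add]; exact add_mem (ha trivial) (hb trivial)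
  | smul r a _ ha => rw [map_smulₛₗ]; exact Submodule.smul_mem _ _ (ha trivial)

variable [∀ c : C, IsPrincipalIdealRing (C.presheaf.stalk c)] [IsLocallyNoetherian X]
  {E : X.Modules} (hE : IsCoherent E)

/-- The quotient of the stalks embeds in a stalk of D, where functions vanishing on C act by zero.
-/
theorem isThin_of_reduceStalk {A B : X.Modules} {D : C.Modules} (a : A ⟶ B) (β : B ⟶ E)
    (q : B ⟶ (Scheme.Modules.pushforward i).obj D)
    (hq : ∀ c m, reduceStalk i q c m = 0 ↔ ∃ n, stalkHom a (i c) n = m) :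
    Thickening.Mod.IsThin (rangeSub i hE (a ≫ β)) (rangeSub i hE β) := by
  have key : ∀ (c : C) (r : X.presheaf.stalk (i c)), i.stalkMap c r = 0 →
      ∀ m ∈ LinearMap.range (stalkHom β (i c)),
        r • m ∈ LinearMap.range (stalkHom (a ≫ β) (i c)) := by
    rintro c r hr _ ⟨m, rfl⟩
    obtain ⟨n, hn⟩ := (hq c (r • m)).1 (by
      rw [map_smulₛₗ]
      exact (congrArg (· • reduceStalk i q c m) hr).trans (zero_smul _ _))
    refine ⟨n, ?_⟩
    rw [stalkHom_comp, hn, map_smul]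
  exact ⟨key, key (genericPoint C)⟩

/-- The projection of the image of the stalk of `B` to the stalk of a sheaf on `C`. -/
def reduceRange {B : X.Modules} {D : C.Modules} (β : B ⟶ E) [Mono β]
    (q : B ⟶ (Scheme.Modules.pushforward i).obj D) (c : C) :
    LinearMap.range (stalkHom β (i c)) →ₛₗ[(i.stalkMap c).hom] StalkAt D c :=
  (reduceStalk i q c).comp
    (LinearEquiv.ofInjective _ (stalkHom_injective β (i c))).symm.toLinearMap

theorem reduceRange_apply {B : X.Modules} {D : C.Modules} (β : B ⟶ E) [Mono β]
    (q : B ⟶ (Scheme.Modules.pushforward i).obj D) (c : C) (m : StalkAt B (i c)) :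
    reduceRange i β q c ⟨stalkHom β (i c) m, m, rfl⟩ = reduceStalk i q c m := by
  refine congrArg (reduceStalk i q c) ?_
  refine (LinearEquiv.symm_apply_eq _).2 ?_
  rfl

/-- The projections are q read through the embedding of B in E. They show that the stalks of D are
models of the quotients, and this also supplies the lattice property needed for det D. -/
theorem exists_realizes_stalkFamily {A B : X.Modules} {D : C.Modules} (a : A ⟶ B) (β : B ⟶ E)
    [Mono β] (q : B ⟶ (Scheme.Modules.pushforward i).obj D) [Epi q]
    (hq : ∀ c m, reduceStalk i q c m = 0 ↔ ∃ n, stalkHom a (i c) n = m)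
    (hP : Thickening.Mod.IsGood (rangeSub i hE (a ≫ β)))
    (hQ : Thickening.Mod.IsGood (rangeSub i hE β)) :
    ∃ h : ∀ x, IsLattice (stalkToGeneric D x), Nonempty (Thickening.Mod.Realizes
      (stalkFamily D h) (rangeSub i hE (a ≫ β)) (rangeSub i hE β)) := by
  have hsurj : ∀ c, Function.Surjective (reduceRange i β q c) := fun c d => by
    obtain ⟨m, rfl⟩ := reduceStalk_surjective i q c d
    exact ⟨_, reduceRange_apply i β q c m⟩
  have hker : ∀ c (m : LinearMap.range (stalkHom β (i c))), reduceRange i β q c m = 0 ↔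
      m.1 ∈ LinearMap.range (stalkHom (a ≫ β) (i c)) := by
    rintro c ⟨_, m, rfl⟩
    rw [reduceRange_apply, hq]
    constructor
    · rintro ⟨n, rfl⟩
      exact ⟨n, stalkHom_comp _ _ _ _⟩
    · rintro ⟨n, hn⟩
      rw [stalkHom_comp] at hn
      exact ⟨n, stalkHom_injective β (i c) hn⟩
  have hcomm : ∀ c (m : LinearMap.range (stalkHom β (i c)))
      (w : LinearMap.range (stalkHom β (i (genericPoint C)))),
      specializeStalk E (specializes_genericPoint i c) m.1 = w.1 →
      stalkToGeneric D c (reduceRange i β q c m) = reduceRange i β q (genericPoint C) w := by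
    rintro c ⟨_, m, rfl⟩ ⟨_, w, rfl⟩ h
    rw [reduceRange_apply, reduceRange_apply, ← reduceStalk_specializeStalk]
    congr 1
    refine stalkHom_injective β _ ?_
    exact (stalkHom_specializeStalk β _ m).trans h
  have hL : ∀ x, IsLattice (stalkToGeneric D x) := fun x =>
    Thickening.Mod.isLattice_of_surjective hP hQ (reduceRange i β q x)
      (reduceRange i β q (genericPoint C)) (hsurj x) (hsurj _) (hker x) (hker _) (hcomm x)
  exact ⟨hL, ⟨{
    p := fun x => reduceRange i β q x
    p' := reduceRange i β q (genericPoint C)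
    surj := hsurj
    surj' := hsurj _
    ker := hker
    ker' := hker _
    comm := hcomm }⟩⟩

theorem reduceStalk_eq_zero_iff {A B : X.Modules} {D : C.Modules} (a : A ⟶ B) [Mono a]
    (e : cokernel a ≅ (Scheme.Modules.pushforward i).obj D) (c : C) (m : StalkAt B (i c)) :
    reduceStalk i (cokernel.π a ≫ e.hom) c m = 0 ↔ ∃ n, stalkHom a (i c) n = m := by
  have h1 : reduceStalk i (cokernel.π a ≫ e.hom) c m = 0 ↔
      stalkHom (cokernel.π a) (i c) m = 0 := by
    refine (map_eq_zero_iff _ (pushStalk_bijective i D c).1).trans ?_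
    rw [stalkHom_comp]
    exact map_eq_zero_iff _ (stalkHom_injective e.hom (i c))
  rw [h1]
  refine ⟨exists_stalkHom_eq_of_cokernel a (i c) m, ?_⟩
  rintro ⟨n, rfl⟩
  rw [← stalkHom_comp, cokernel.condition, stalkHom_zero]

/-- This is the bridge between sheaves and classes: the stalks of the restriction of the cokernel
realize the quotient of stalks of E, and local generators of B descend to it, which makes its
determinant family trivial generically and so locally principal. -/
theorem exists_idealSheaf_iso_det [NoetherianSpace C] {A B : X.Modules} (a : A ⟶ B) [Mono a]
    (β : B ⟶ E) [Mono β] (hG : IsSheafOn i (cokernel a)) (hB : IsLocallyFinitelyGenerated B)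
    (hP : Thickening.Mod.IsGood (rangeSub i hE (a ≫ β)))
    (hQ : Thickening.Mod.IsGood (rangeSub i hE β)) :
    Thickening.Mod.IsThin (rangeSub i hE (a ≫ β)) (rangeSub i hE β) ∧
    ∃ J : IdealFamily (fun c : C => (C.presheaf.stalk c : Type u)) C.functionField,
      Nonempty (det ((Scheme.Modules.pullback i).obj (cokernel a)) ≅ idealSheaf J) ∧
      IsLocallyPrincipal (fun c => (J c : Submodule (C.presheaf.stalk c) C.functionField)) ∧
      QuotientGroup.mk J = Thickening.Mod.quotCls (rangeSub i hE (a ≫ β)) (rangeSub i hE β) := by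
  obtain ⟨G', ⟨e'⟩⟩ := hG
  obtain ⟨f⟩ := nonempty_pullback_iso i e'
  let D := (Scheme.Modules.pullback i).obj (cokernel a)
  -- The sheaf G' of the hypothesis is replaced by the restriction D of the cokernel, since
  -- `detGraded` is defined by restriction.
  let e : cokernel a ≅ (Scheme.Modules.pushforward i).obj D :=
    e' ≪≫ (Scheme.Modules.pushforward i).mapIso f.symm
  have hq := reduceStalk_eq_zero_iff i a e
  obtain ⟨h, ⟨r⟩⟩ := exists_realizes_stalkFamily i hE a β (cokernel.π a ≫ e.hom) hq hP hQ
  refine ⟨isThin_of_reduceStalk i hE a β _ hq, _, nonempty_det_iso_idealSheaf D h, ?_,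
    r.cls_eq_quotCls hQ⟩
  obtain ⟨U, hU, S, hS, hSU⟩ :=
    exists_finite_span_of_epi i (cokernel.π a ≫ e.hom) hB (genericPoint C)
  obtain ⟨V, hV, hV1⟩ := exists_open_detIdeal_eq_one D h hU S hS hSU
    (Module.finBasis C.functionField (stalkFamily D h).W)
  exact isLocallyPrincipal_of_open _ hV fun y hy => Units.ext (hV1 y hy)

end GradedPieces

end

/-! ### Filtrations and short exact sequences of families -/

namespace Thickening.Mod

variable {I : Type*} {O : I → Type*} [∀ x, CommRing (O x)] [∀ x, IsDomain (O x)]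
  [∀ x, IsPrincipalIdealRing (O x)] [∀ x, IsLocalRing (O x)] {K : Type*} [Field K]
  [∀ x, Algebra (O x) K] [∀ x, IsFractionRing (O x) K] {T : Thickening.{u} O K}

/-- Families of linear maps that are compatible with the localization maps. -/
structure Hom (M N : T.Mod) where
  /-- the maps -/
  app : ∀ x, M.E x →ₗ[T.A x] N.E x
  /-- the map of the localizations -/
  app' : M.E' →ₗ[T.A'] N.E'
  comm : ∀ x m, N.sp x (app x m) = app' (M.sp x m)

variable {M' M M'' : T.Mod} (f : Hom M' M) (g : Hom M M'')

/-- The image of a family of submodules. -/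
def Hom.map (P : M'.Sub) : M.Sub := ⟨fun x => (P.1 x).map (f.app x), P.2.map f.app'⟩

/-- The preimage of a family of submodules. -/
def Hom.comap (R : M''.Sub) : M.Sub := ⟨fun x => (R.1 x).comap (g.app x), R.2.comap g.app'⟩

theorem Hom.map_mono : Monotone f.map := fun _ _ h =>
  ⟨fun x => Submodule.map_mono (h.1 x), Submodule.map_mono h.2⟩

theorem Hom.comap_mono : Monotone g.comap := fun _ _ h =>
  ⟨fun x => Submodule.comap_mono (h.1 x), Submodule.comap_mono h.2⟩

theorem Hom.map_bot : f.map ⊥ = ⊥ :=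
  Prod.ext (funext fun _ => Submodule.map_bot _) (Submodule.map_bot _)

theorem Hom.comap_top : g.comap ⊤ = ⊤ :=
  Prod.ext (funext fun _ => Submodule.comap_top _) (Submodule.comap_top _)

variable {f g}

theorem IsGood.map {P : M'.Sub} (hP : IsGood P) : IsGood (f.map P) where
  map_mem := by
    rintro x _ ⟨m, hm, rfl⟩
    exact ⟨_, hP.map_mem x m hm, (f.comm x m).symm⟩
  exists_smul_mem := by
    rintro x _ ⟨w, hw, rfl⟩
    obtain ⟨a, ha, m, hm, hma⟩ := hP.exists_smul_mem x w hw
    refine ⟨a, ha, f.app x m, ⟨m, hm, rfl⟩, ?_⟩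
    rw [f.comm, hma, map_smul]

/-- A numerator m of w in M need not map into R; it does so after being multiplied by a denominator
from R and one more that equates the two numerators in M''. -/
theorem IsGood.comap (h : IsGood (⊤ : M.Sub)) {R : M''.Sub} (hR : IsGood R) :
    IsGood (g.comap R) where
  map_mem x m hm := by
    change g.app' (M.sp x m) ∈ R.2
    rw [← g.comm]
    exact hR.map_mem x _ hm
  exists_smul_mem x w hw := by
    obtain ⟨a, ha, m, -, hma⟩ := h.exists_smul_mem x w trivial
    obtain ⟨b, hb, r, hr, hrb⟩ := hR.exists_smul_mem x (g.app' w) hw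
    obtain ⟨c, hc, hcm⟩ := M''.exists_smul_eq_zero x (b • g.app x m - a • r) (by
      rw [map_sub, map_smulₛₗ, map_smulₛₗ, g.comm, hma, hrb, map_smul, smul_smul, smul_smul,
        mul_comm, sub_self])
    rw [smul_sub, sub_eq_zero] at hcm
    refine ⟨c * (b * a), ?_, c • b • m, ?_, ?_⟩
    · simp only [map_mul]
      exact mul_ne_zero hc (mul_ne_zero hb ha)
    · change g.app x (c • b • m) ∈ R.1 x
      rw [map_smul, map_smul, hcm]
      exact Submodule.smul_mem _ _ (Submodule.smul_mem _ _ hr)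
    · simp only [map_smulₛₗ, hma, map_mul, mul_smul]

theorem IsThin.map {P Q : M'.Sub} (h : IsThin P Q) : IsThin (f.map P) (f.map Q) where
  smul_mem := by
    rintro x a ha _ ⟨m, hm, rfl⟩
    exact ⟨a • m, h.smul_mem x a ha m hm, map_smul _ _ _⟩
  smul_mem' := by
    rintro a ha _ ⟨m, hm, rfl⟩
    exact ⟨a • m, h.smul_mem' a ha m hm, map_smul _ _ _⟩

theorem IsThin.comap {P Q : M''.Sub} (h : IsThin P Q) : IsThin (g.comap P) (g.comap Q) where
  smul_mem x a ha m hm := by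
    change g.app x (a • m) ∈ P.1 x
    rw [map_smul]
    exact h.smul_mem x a ha _ hm
  smul_mem' a ha m hm := by
    change g.app' (a • m) ∈ P.2
    rw [map_smul]
    exact h.smul_mem' a ha _ hm

variable (f g)

/-- The sequence `0 → M' → M → M'' → 0` is exact. -/
structure IsShortExact : Prop where
  inj : ∀ x, Function.Injective (f.app x)
  inj' : Function.Injective f.app'
  exact : ∀ x, Function.Exact (f.app x) (g.app x)
  exact' : Function.Exact f.app' g.app'
  surj : ∀ x, Function.Surjective (g.app x)
  surj' : Function.Surjective g.app'

variable {f g}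

theorem IsShortExact.map_top (h : IsShortExact f g) : f.map ⊤ = g.comap ⊥ :=
  Prod.ext
    (funext fun x => Submodule.ext fun m => by
      refine Iff.trans ?_ (h.exact x m).symm
      exact ⟨fun ⟨n, _, hn⟩ => ⟨n, hn⟩, fun ⟨n, hn⟩ => ⟨n, trivial, hn⟩⟩)
    (Submodule.ext fun m => by
      refine Iff.trans ?_ (h.exact' m).symm
      exact ⟨fun ⟨n, _, hn⟩ => ⟨n, hn⟩, fun ⟨n, hn⟩ => ⟨n, trivial, hn⟩⟩)

theorem IsShortExact.quotCls_map [Nonempty I] (h : IsShortExact f g) {P Q : M'.Sub}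
    (hP : IsGood P) (hQ : IsGood Q) (hPQ : IsThin P Q) :
    quotCls (f.map P) (f.map Q) = quotCls P Q := by
  refine (quotCls_congr hP hQ hPQ hP.map hQ.map hPQ.map f.app f.app' f.comm
    (fun x m hm => ⟨m, hm, rfl⟩) (fun m hm => ⟨m, hm, rfl⟩) (fun x m _ => ⟨?_, fun hm => ⟨m, hm, rfl⟩⟩)
    (fun m _ => ⟨?_, fun hm => ⟨m, hm, rfl⟩⟩) ?_ ?_).symm
  · rintro ⟨n, hn, hnm⟩
    exact h.inj x hnm ▸ hn
  · rintro ⟨n, hn, hnm⟩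
    exact h.inj' hnm ▸ hn
  · rintro x _ ⟨m, hm, rfl⟩
    exact ⟨m, hm, by rw [sub_self]; exact zero_mem _⟩
  · rintro _ ⟨m, hm, rfl⟩
    exact ⟨m, hm, by rw [sub_self]; exact zero_mem _⟩

theorem IsShortExact.quotCls_comap [Nonempty I] (h : IsShortExact f g) (hM : IsGood (⊤ : M.Sub))
    {P Q : M''.Sub} (hP : IsGood P) (hQ : IsGood Q) (hPQ : IsThin P Q) :
    quotCls (g.comap P) (g.comap Q) = quotCls P Q := by
  refine quotCls_congr (hM.comap hP) (hM.comap hQ) hPQ.comap hP hQ hPQ g.app g.app' g.comm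
    (fun x m hm => hm) (fun m hm => hm) (fun x m _ => Iff.rfl) (fun m _ => Iff.rfl) ?_ ?_
  · intro x m hm
    obtain ⟨m, rfl⟩ := h.surj x m
    exact ⟨m, hm, by rw [sub_self]; exact zero_mem _⟩
  · intro m hm
    obtain ⟨m, rfl⟩ := h.surj' m
    exact ⟨m, hm, by rw [sub_self]; exact zero_mem _⟩

/-- A finite filtration of `M` with good members and thin steps. -/
structure IsFiltration (a : ℕ → M.Sub) (m : ℕ) : Prop where
  monotone : Monotone a
  zero : a 0 = ⊥
  eq_top : a m = ⊤
  good : ∀ j ≤ m, IsGood (a j)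
  thin : ∀ j < m, IsThin (a j) (a (j + 1))

theorem IsFiltration.prod_eq_prod [Nonempty I] {a b : ℕ → M.Sub} {m n : ℕ} (ha : IsFiltration a m)
    (hb : IsFiltration b n) : ∏ j ∈ Finset.range m, quotCls (a j) (a (j + 1)) =
      ∏ j ∈ Finset.range n, quotCls (b j) (b (j + 1)) :=
  quotientInvariant.prod_eq_prod ha.monotone hb.monotone (ha.zero.trans hb.zero.symm)
    (ha.eq_top.trans hb.eq_top.symm) ha.good hb.good ha.thin hb.thin

/-- Images under f followed by preimages under g form a filtration of M whose quotients are those of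
a' and then those of a''. Independence of the filtration compares it with a. -/
theorem IsShortExact.prod_eq_mul [Nonempty I] (h : IsShortExact f g) {a' : ℕ → M'.Sub}
    {a : ℕ → M.Sub} {a'' : ℕ → M''.Sub} {m' m m'' : ℕ} (ha' : IsFiltration a' m')
    (ha : IsFiltration a m) (ha'' : IsFiltration a'' m'') :
    ∏ j ∈ Finset.range m, quotCls (a j) (a (j + 1)) =
      (∏ j ∈ Finset.range m', quotCls (a' j) (a' (j + 1))) *
        ∏ j ∈ Finset.range m'', quotCls (a'' j) (a'' (j + 1)) := by
  have hM : IsGood (⊤ : M.Sub) := ha.eq_top ▸ ha.good m le_rfl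
  let b : ℕ → M.Sub := fun j => if j ≤ m' then f.map (a' j) else g.comap (a'' (j - m'))
  have hb₁ : ∀ j ≤ m', b j = f.map (a' j) := fun j hj => if_pos hj
  -- At the junction j = 0 both descriptions apply, since the image of f is the kernel of g; so no
  -- step is lost or counted twice.
  have hb₂ : ∀ j, b (m' + j) = g.comap (a'' j) := fun j => by
    rcases Nat.eq_zero_or_pos j with rfl | hj
    · rw [add_zero, hb₁ _ le_rfl, ha'.eq_top, ha''.zero, h.map_top]
    · refine (if_neg (by omega)).trans ?_
      rw [Nat.add_sub_cancel_left]
  have hb : IsFiltration b (m' + m'') :=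
    { monotone := monotone_nat_of_le_succ fun j => by
        rcases lt_or_ge j m' with hj | hj
        · rw [hb₁ j hj.le, hb₁ (j + 1) hj]
          exact f.map_mono (ha'.monotone j.le_succ)
        · obtain ⟨k, rfl⟩ := Nat.exists_eq_add_of_le hj
          rw [add_assoc, hb₂, hb₂]
          exact g.comap_mono (ha''.monotone k.le_succ)
      zero := by rw [hb₁ 0 (Nat.zero_le _), ha'.zero, f.map_bot]
      eq_top := by rw [hb₂, ha''.eq_top, g.comap_top]
      good := fun j hj => by
        rcases lt_or_ge j m' with hj' | hj'
        · rw [hb₁ j hj'.le]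
          exact (ha'.good j hj'.le).map
        · obtain ⟨k, rfl⟩ := Nat.exists_eq_add_of_le hj'
          rw [hb₂]
          exact hM.comap (ha''.good k (by omega))
      thin := fun j hj => by
        rcases lt_or_ge j m' with hj' | hj'
        · rw [hb₁ j hj'.le, hb₁ (j + 1) hj']
          exact (ha'.thin j hj').map
        · obtain ⟨k, rfl⟩ := Nat.exists_eq_add_of_le hj'
          rw [add_assoc, hb₂, hb₂]
          exact (ha''.thin k (by omega)).comap }
  rw [ha.prod_eq_prod hb, Finset.prod_range_add]
  congr 1
  · refine Finset.prod_congr rfl fun j hj => ?_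
    have hj' : j < m' := Finset.mem_range.1 hj
    rw [hb₁ j hj'.le, hb₁ (j + 1) hj']
    exact h.quotCls_map (ha'.good j hj'.le) (ha'.good _ hj') (ha'.thin j hj')
  · refine Finset.prod_congr rfl fun j hj => ?_
    have hj' : j < m'' := Finset.mem_range.1 hj
    rw [add_assoc, hb₂, hb₂]
    exact h.quotCls_comap hM (ha''.good j hj'.le) (ha''.good _ hj') (ha''.thin j hj')

end Thickening.Mod

theorem mk_prod_range {I : Type*} {O : I → Type*} [∀ x, CommRing (O x)] {K : Type*} [Field K]
    [∀ x, Algebra (O x) K] {m : ℕ} (J : ℕ → IdealFamily O K) {q : ℕ → IdealClass O K}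
    (h : ∀ j < m, QuotientGroup.mk (J j) = q j) :
    QuotientGroup.mk (∏ j ∈ Finset.range m, J j) = ∏ j ∈ Finset.range m, q j :=
  (QuotientGroup.mk_prod _ _).trans
    (Finset.prod_congr rfl fun j hj => h j (Finset.mem_range.1 hj))

/-- This lets a sequence be chosen on all of ℕ when its property is only known below m. -/
theorem exists_of_imp {P : Prop} {α : Type*} [Nonempty α] {Q : α → Prop} (h : P → ∃ a, Q a) :
    ∃ a, P → Q a := by
  by_cases hP : P
  · obtain ⟨a, ha⟩ := h hP
    exact ⟨a, fun _ => ha⟩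
  · exact ⟨Classical.arbitrary α, fun h => (hP h).elim⟩

noncomputable section

/-! ### Comparing filtrations by subsheaves -/

section Filtrations

theorem IsLocallyFinitelyGenerated.of_epi {X : Scheme.{u}} {M N : X.Modules}
    (hM : IsLocallyFinitelyGenerated M) (f : M ⟶ N) [Epi f] : IsLocallyFinitelyGenerated N := by
  intro x
  obtain ⟨U, hU, S, hS, h⟩ := hM x
  refine ⟨U, hU, (f.app U : Γ(M, U) → Γ(N, U)) '' S, hS.image _, fun y hy => eq_top_iff.2 ?_⟩
  rw [← LinearMap.range_eq_top.2 (stalkHom_surjective f y), LinearMap.range_eq_map, ← h y hy,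
    Submodule.map_span]
  refine Submodule.span_mono ?_
  rintro _ ⟨_, ⟨s, hs, rfl⟩, rfl⟩
  exact ⟨f.app U s, ⟨s, hs, rfl⟩, (stalkHom_germ f hy s).symm⟩

variable {X C : Scheme.{u}} [IsIntegral C] (i : C ⟶ X) [IsClosedImmersion i]
  [∀ c : C, IsPrincipalIdealRing (C.presheaf.stalk c)] [IsLocallyNoetherian X]
  {E : X.Modules} (hE : IsCoherent E)

theorem rangeSub_comp {M N : X.Modules} (e : M ⟶ N) [Epi e] (f : N ⟶ E) :
    rangeSub i hE (e ≫ f) = rangeSub i hE f := by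
  refine congrArg (stalkSub i hE) (funext fun x => Submodule.ext fun m => ⟨?_, ?_⟩)
  · rintro ⟨n, rfl⟩
    exact ⟨_, (stalkHom_comp e f x n).symm⟩
  · rintro ⟨n, rfl⟩
    obtain ⟨n, rfl⟩ := stalkHom_surjective e x n
    exact ⟨n, stalkHom_comp e f x n⟩

theorem rangeSub_mono {F F' : Subobject E} (h : F ≤ F') :
    rangeSub i hE F.arrow ≤ rangeSub i hE F'.arrow := by
  have key : ∀ x, LinearMap.range (stalkHom F.arrow x) ≤ LinearMap.range (stalkHom F'.arrow x) := by
    rintro x _ ⟨n, rfl⟩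
    refine ⟨stalkHom (F.ofLE F' h) x n, ?_⟩
    rw [← stalkHom_comp, Subobject.ofLE_arrow]
  exact ⟨fun c => key (i c), key (i (genericPoint C))⟩

theorem rangeSub_bot : rangeSub i hE (⊥ : Subobject E).arrow = ⊥ := by
  have key : ∀ x, LinearMap.range (stalkHom (⊥ : Subobject E).arrow x) = ⊥ := by
    refine fun x => eq_bot_iff.2 ?_
    rintro _ ⟨n, rfl⟩
    rw [Subobject.bot_arrow, stalkHom_zero]
    exact zero_mem _
  exact Prod.ext (funext fun c => key (i c)) (key (i (genericPoint C)))

theorem rangeSub_top : rangeSub i hE (⊤ : Subobject E).arrow = ⊤ := by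
  have key : ∀ x, LinearMap.range (stalkHom (⊤ : Subobject E).arrow x) = ⊤ := fun x =>
    LinearMap.range_eq_top.2 (stalkHom_surjective _ x)
  exact Prod.ext (funext fun c => key (i c)) (key (i (genericPoint C)))

theorem isKilled_cokernel {A B : X.Modules} (a : A ⟶ B) (β : B ⟶ E) [Mono β]
    (h : Thickening.Mod.IsThin (rangeSub i hE (a ≫ β)) (rangeSub i hE β)) :
    IsKilled i (cokernel a) := by
  intro c r hr m
  obtain ⟨m, rfl⟩ := stalkHom_surjective (cokernel.π a) (i c) m
  obtain ⟨n, hn⟩ := h.smul_mem c r hr (stalkHom β (i c) m) ⟨m, rfl⟩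
  have h1 : stalkHom β (i c) (stalkHom a (i c) n) = stalkHom β (i c) (r • m) := by
    rw [map_smul, ← stalkHom_comp]
    exact hn
  rw [← map_smul, ← stalkHom_injective β (i c) h1, ← stalkHom_comp, cokernel.condition,
    stalkHom_zero]

variable [NoetherianSpace C]

/-- Coherence of the members is deliberately replaced by finite local generation and goodness, so
that the statement covers both the given filtration and the second canonical one. -/
theorem exists_idealSheaf_iso_detGraded (F : ℕ →o Subobject E) (m : ℕ)
    (hgen : ∀ j ≤ m, IsLocallyFinitelyGenerated (F j : X.Modules))
    (hgood : ∀ j ≤ m, Thickening.Mod.IsGood (rangeSub i hE (F j).arrow))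
    (hG : ∀ j < m, IsSheafOn i (graded F j)) :
    (∀ j < m, Thickening.Mod.IsThin (rangeSub i hE (F j).arrow)
      (rangeSub i hE (F (j + 1)).arrow)) ∧
    ∃ J : IdealFamily (fun c : C => (C.presheaf.stalk c : Type u)) C.functionField,
      Nonempty (detGraded i F m ≅ idealSheaf J) ∧
      IsLocallyPrincipal (fun c => (J c : Submodule (C.presheaf.stalk c) C.functionField)) ∧
      QuotientGroup.mk J = ∏ j ∈ Finset.range m, Thickening.Mod.quotCls
        (rangeSub i hE (F j).arrow) (rangeSub i hE (F (j + 1)).arrow) := by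
  have key : ∀ j < m, _ := fun j hj =>
    exists_idealSheaf_iso_det i hE ((F j).ofLE (F (j + 1)) (F.monotone j.le_succ))
      (F (j + 1)).arrow (hG j hj) (hgen _ hj)
      (by rw [Subobject.ofLE_arrow]; exact hgood j hj.le) (hgood _ hj)
  simp only [Subobject.ofLE_arrow] at key
  refine ⟨fun j hj => (key j hj).1, ?_⟩
  have key' := fun j => exists_of_imp (P := j < m) fun hj => (key j hj).2
  choose J hJ using key'
  obtain ⟨h1, h2⟩ := nonempty_tensorProd_iso (m := m) (J := J)
    (L := fun j => det ((Scheme.Modules.pullback i).obj (graded F j)))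
    (fun j hj => (hJ j hj).1) fun j hj => (hJ j hj).2.1
  exact ⟨_, h1, h2, mk_prod_range J fun j hj => (hJ j hj).2.2⟩

theorem exists_idealSheaf_iso_detGraded_of_isCoherent (F : ℕ →o Subobject E) (m : ℕ) (h0 : F 0 = ⊥)
    (hm : F m = ⊤) (hF : ∀ j ≤ m, IsCoherent (F j : X.Modules))
    (hG : ∀ j < m, IsSheafOn i (graded F j)) :
    Thickening.Mod.IsFiltration (fun j => rangeSub i hE (F j).arrow) m ∧
    ∃ J : IdealFamily (fun c : C => (C.presheaf.stalk c : Type u)) C.functionField,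
      Nonempty (detGraded i F m ≅ idealSheaf J) ∧
      QuotientGroup.mk J = ∏ j ∈ Finset.range m, Thickening.Mod.quotCls
        (rangeSub i hE (F j).arrow) (rangeSub i hE (F (j + 1)).arrow) := by
  have hgood : ∀ j ≤ m, Thickening.Mod.IsGood (rangeSub i hE (F j).arrow) := fun j hj =>
    isGood_rangeSub i hE (hF j hj) _
  obtain ⟨hthin, J, hJ, -, hJc⟩ := exists_idealSheaf_iso_detGraded i hE F m
    (fun j hj => (hF j hj).exists_finite_span) hgood hG
  exact ⟨{
    monotone := fun j k hjk => rangeSub_mono i hE (F.monotone hjk)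
    zero := by rw [h0, rangeSub_bot]
    eq_top := by rw [hm, rangeSub_top]
    good := hgood
    thin := hthin }, J, hJ, hJc⟩

theorem rangeSub_secondFiltration (k : ℕ) :
    rangeSub i hE (secondFiltration i E k).arrow = rangeSub i hE (killedIncl i E k) := by
  change rangeSub i hE (Subobject.mk (killedIncl i E k)).arrow = _
  rw [← Subobject.underlyingIso_hom_comp_eq_mk, rangeSub_comp]

variable [Surjective i]

/-- The graded pieces are sheaves on C because the ideal of C maps the (j + 1)-st member into the
j-th. -/
theorem exists_idealSheaf_iso_detC (n : ℕ) (hn : ∀ c, RingHom.ker (i.stalkMap c).hom ^ n = ⊥) :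
    Thickening.Mod.IsFiltration (fun j => rangeSub i hE (secondFiltration i E j).arrow) n ∧
    ∃ J : IdealFamily (fun c : C => (C.presheaf.stalk c : Type u)) C.functionField,
      Nonempty (detC i E n ≅ idealSheaf J) ∧
      IsLocallyPrincipal (fun c => (J c : Submodule (C.presheaf.stalk c) C.functionField)) ∧
      QuotientGroup.mk J = ∏ j ∈ Finset.range n, Thickening.Mod.quotCls
        (rangeSub i hE (secondFiltration i E j).arrow)
        (rangeSub i hE (secondFiltration i E (j + 1)).arrow) := by
  have hgood : ∀ j, Thickening.Mod.IsGood (rangeSub i hE (secondFiltration i E j).arrow) :=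
    fun j => by
      rw [rangeSub_secondFiltration]
      exact isGood_killed i hE j
  have hG : ∀ j, IsSheafOn i (graded (secondFiltration i E) j) := fun j => by
    refine isSheafOn_of_isKilled (isKilled_cokernel i hE _ (secondFiltration i E (j + 1)).arrow ?_)
    rw [Subobject.ofLE_arrow, rangeSub_secondFiltration, rangeSub_secondFiltration]
    exact isThin_killed i hE j
  have hgen : ∀ j, IsLocallyFinitelyGenerated (secondFiltration i E j : X.Modules) := fun j => by
    let e := Subobject.underlyingIso (killedIncl i E j)
    have h : IsLocallyFinitelyGenerated (Subobject.mk (killedIncl i E j) : X.Modules) :=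
      (isLocallyFinitelyGenerated_killedSheaf i hE j).of_epi e.inv
    exact h
  obtain ⟨hthin, J, hJ, hJp, hJc⟩ := exists_idealSheaf_iso_detGraded i hE (secondFiltration i E) n
    (fun j _ => hgen j) (fun j _ => hgood j) fun j _ => hG j
  have h0 : ∀ c, killedStalk i E 0 c = ⊥ := fun c => eq_bot_iff.2 fun w hw => by
    rw [← one_smul (X.presheaf.stalk (i c)) w]
    exact hw 1 (by rw [pow_zero, Ideal.one_eq_top]; trivial)
  -- Nilpotence of the ideal is what makes the filtration exhaust E after n steps.
  have hn' : ∀ c, killedStalk i E n c = ⊤ := fun c => eq_top_iff.2 fun w _ a ha => by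
    rw [hn c, Ideal.mem_bot] at ha
    rw [ha, zero_smul]
  exact ⟨{
    monotone := fun j k hjk => rangeSub_mono i hE ((secondFiltration i E).monotone hjk)
    zero := by
      rw [rangeSub_secondFiltration]
      exact Prod.ext (funext fun c => (range_stalkHom_killedIncl i 0 c).trans (h0 c))
        ((range_stalkHom_killedIncl i 0 _).trans (h0 _))
    eq_top := by
      rw [rangeSub_secondFiltration]
      exact Prod.ext (funext fun c => (range_stalkHom_killedIncl i n c).trans (hn' c))
        ((range_stalkHom_killedIncl i n _).trans (hn' _))
    good := fun j _ => hgood j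
    thin := hthin }, J, hJ, hJp, hJc⟩

/-- The maps of stalks given by a map of sheaves. -/
def stalkModHom {N : X.Modules} (hN : IsCoherent N) (f : E ⟶ N) :
    Thickening.Mod.Hom (stalkMod i hE) (stalkMod i hN) where
  app c := stalkHom f (i c)
  app' := stalkHom f (i (genericPoint C))
  comm _ m := (stalkHom_specializeStalk f _ m).symm

theorem isShortExact_stalkModHom {S : ShortComplex X.Modules} (hS : S.ShortExact)
    (h₁ : IsCoherent S.X₁) (h₂ : IsCoherent S.X₂) (h₃ : IsCoherent S.X₃) :
    Thickening.Mod.IsShortExact (stalkModHom i h₁ h₂ S.f) (stalkModHom i h₂ h₃ S.g) := by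
  have := hS.mono_f
  have := hS.epi_g
  have hex : ∀ x, Function.Exact (stalkHom S.f x) (stalkHom S.g x) := fun x m =>
    ⟨exists_stalkHom_eq S hS.exact x m, by
      rintro ⟨n, rfl⟩
      rw [← stalkHom_comp, S.zero, stalkHom_zero]⟩
  exact {
    inj := fun c => stalkHom_injective S.f (i c)
    inj' := stalkHom_injective S.f _
    exact := fun c => hex (i c)
    exact' := hex _
    surj := fun c => stalkHom_surjective S.g (i c)
    surj' := stalkHom_surjective S.g _ }

include hE in
-- Both sides are sheaves of ideal families whose classes are products over filtrations of the same
-- E.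
theorem nonempty_detC_iso_detGraded (n : ℕ) (hn : ∀ c, RingHom.ker (i.stalkMap c).hom ^ n = ⊥)
    (F : ℕ →o Subobject E) (m : ℕ) (h0 : F 0 = ⊥) (hm : F m = ⊤)
    (hF : ∀ j ≤ m, IsCoherent (F j : X.Modules)) (hG : ∀ j < m, IsSheafOn i (graded F j)) :
    Nonempty (detC i E n ≅ detGraded i F m) := by
  obtain ⟨h₁, J₁, ⟨e₁⟩, -, hJ₁⟩ := exists_idealSheaf_iso_detC i hE n hn
  obtain ⟨h₂, J₂, ⟨e₂⟩, hJ₂⟩ :=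
    exists_idealSheaf_iso_detGraded_of_isCoherent i hE F m h0 hm hF hG
  obtain ⟨e⟩ := nonempty_idealSheaf_iso (hJ₁.trans ((h₁.prod_eq_prod h₂).trans hJ₂.symm))
  exact ⟨e₁ ≪≫ e ≪≫ e₂.symm⟩

theorem nonempty_detC_iso_tensor (n : ℕ) (hn : ∀ c, RingHom.ker (i.stalkMap c).hom ^ n = ⊥)
    {S : ShortComplex X.Modules} (hS : S.ShortExact)
    (h₁ : IsCoherent S.X₁) (h₂ : IsCoherent S.X₂) (h₃ : IsCoherent S.X₃) :
    Nonempty (detC i S.X₂ n ≅ tensor (detC i S.X₁ n) (detC i S.X₃ n)) := by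
  obtain ⟨f₁, J₁, ⟨e₁⟩, hp₁, hJ₁⟩ := exists_idealSheaf_iso_detC i h₁ n hn
  obtain ⟨f₂, J₂, ⟨e₂⟩, -, hJ₂⟩ := exists_idealSheaf_iso_detC i h₂ n hn
  obtain ⟨f₃, J₃, ⟨e₃⟩, hp₃, hJ₃⟩ := exists_idealSheaf_iso_detC i h₃ n hn
  have h := (isShortExact_stalkModHom i hS h₁ h₂ h₃).prod_eq_mul f₁ f₂ f₃
  obtain ⟨e⟩ := nonempty_idealSheaf_iso (J := J₂) (J' := J₁ * J₃)
    (hJ₂.trans (h.trans (congrArg₂ (· * ·) hJ₁ hJ₃).symm))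
  obtain ⟨t⟩ := tensor_congr e₁ e₃
  obtain ⟨l⟩ := nonempty_tensor_latticeSheaf_iso hp₁ hp₃
  exact ⟨e₂ ≪≫ e ≪≫ l.symm ≪≫ t.symm⟩

end Filtrations

end

end MultipleCurve

/-! ### Conclusion for primitive multiple curves -/

theorem proposition2p3p1 {X C : Scheme.{0}} [IsIntegral C] (f : X ⟶ Spec (.of ℂ)) (i : C ⟶ X)
    (n : ℕ) (hX : MultipleCurve.IsPrimitiveMultipleCurve f i n) :
    (∀ E : X.Modules, MultipleCurve.IsCoherent E →
      ∀ (m : ℕ) (F : ℕ →o Subobject E), F 0 = ⊥ → F m = ⊤ →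
        (∀ j ≤ m, MultipleCurve.IsCoherent (F j : X.Modules)) →
        (∀ j < m, MultipleCurve.IsSheafOn i (MultipleCurve.graded F j)) →
        Nonempty (MultipleCurve.detC i E n ≅ MultipleCurve.detGraded i F m)) ∧
    (∀ S : ShortComplex X.Modules, S.ShortExact →
      MultipleCurve.IsCoherent S.X₁ → MultipleCurve.IsCoherent S.X₂ →
      MultipleCurve.IsCoherent S.X₃ →
        Nonempty (MultipleCurve.detC i S.X₂ n ≅
          MultipleCurve.tensor (MultipleCurve.detC i S.X₁ n) (MultipleCurve.detC i S.X₃ n))) := by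
  have := hX.closedImmersion
  have := hX.surjective
  have := hX.isNoetherian
  have := hX.isNoetherian_reduced
  have := hX.isPrincipalIdealRing_stalk
  exact ⟨fun E hE m F h0 hm hF hG => MultipleCurve.nonempty_detC_iso_detGraded i hE n
      hX.ker_stalkMap_pow F m h0 hm hF hG,
    fun S hS h₁ h₂ h₃ => MultipleCurve.nonempty_detC_iso_tensor i n hX.ker_stalkMap_pow hS h₁ h₂ h₃⟩
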